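/- \textbf{Setting.} Let $n\ge 1$. A Dyck path of order $n$ is a path with steps $(1,\pm1)$ from $(0,0)$ to $(2n,0)$ that stays weakly above the axis. For Dyck paths $\lambda\preceq\mu$ of order $n$ ($\mu$ is everywhere at least as high as $\lambda$), a (cover-inclusive) Dyck tiling of the region $\lambda/\mu$ between them is a tiling by Dyck tiles (unions of unit boxes whose centers form a Dyck path, possibly a single box) such that whenever a box of a tile $t$ lies directly above a box of a tile $s$, the horizontal extent of $t$ is contained in that of $s$. (Such tilings are in bijection with the fixed-point free involutions of $\{1,\dots,2n\}$, the strand matchings.) To a Dyck tiling one associates a strand diagram below $\mu$, with a stub in the middle of each of the $2n$ edges of $\mu$. In each tile the strand joining the lower edge at its left-most point to the upper edge at its right-most point and the strand joining the upper edge at its left-most point to the lower edge at its right-most point cross once; all other strands in the tile run horizontally above this crossing, from an up-edge of the upper boundary to the matching down-edge. Below $\lambda$ the strands run horizontally from an up-edge of $\lambda$ to the matching down-edge. Thus crossings correspond to tiles. The cells of the strand diagram (in the disk) are colored alternately blue and red. The \emph{standard network} $\mathcal G$ has the blue cells as its vertices, and an edge through each crossing joining the two blue cells there; its $i$-th node ($1\le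 i\le n$) is the cell at the boundary between the stubs $2i-1$ and $2i$ (nodes in the same cell are glued together). The dual network $\mathcal G^*$ is formed in the same way from the red cells, its $i$-th node lying between the stubs $2i$ and $2i+1$ (cyclically). The edges $e$ of $\mathcal G$ have arbitrary conductances $c(e)>0$, and the dual edge of $e$ has conductance $1/c(e)$. At each crossing one of the edge and the dual edge is horizontal (joins the cells to the left and right of the crossing) and the other one is vertical; the \emph{vertical conductance} $c_e$ of the crossing $e$ is the conductance of the vertical one. A \emph{grove} is a set of edges without cycles such that each connected component of the network with these edges contains a node. For a partition $\tau$ of the nodes, $Z_\tau$ is the sum, over all groves whose connected components partition the nodes according to $\tau$, of the product of the conductances of the edges of the grove; $Z^*$ is the same for $\mathcal G^*$. The \emph{comb} at a crossing $\chi$ consists of the crossings on the strand going up and left from $\chi$ (including $\chi$), and of all the crossings on the strands going up and right from these. Let $\tau_\chi$ (respectively $\tau^*_\chi$) be the partition of the nodes of $\mathcal G$ (respectively $\mathcal G^*$) into connected components when one selects the edges of this network which are vertical at crossings in the comb at $\chi$, and those which are horizontal at crossings outside the comb. Let $\tau_-$ and $\tau_-^*$ be the partitions obtained by selecting all horizontal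 edges. The \emph{tripod variables} are $Z_{\tau_-}$ and the $Z_{\tau_\chi}$, for all crossings $\chi$, regarded as functions of the conductances; the \emph{dual tripod variables} are $Z^*_{\tau^*_-}$ and the $Z^*_{\tau^*_\chi}$. \textbf{Theorem.} For every Dyck tiling of order $n\ge1$: (1) The number of tripod variables is one more than the number of edges of $\mathcal G$, and the number of dual tripod variables is one more than the number of edges of $\mathcal G^*$. (2) Each tripod variable is a product of conductances: it is the product of the conductances of the edges in some set of edges of $\mathcal G$, which does not depend on the conductances. Likewise each dual tripod variable is such a product of conductances of $\mathcal G^*$. (3) For all conductances, the vertical conductance of every crossing $e$ is $$c_e=\frac{Z_{\tau_e}Z_{\tau_f}}{Z_{\tau_a}Z_{\tau_b}}=\frac{Z^*_{\tau^*_e}Z^*_{\tau^*_f}}{Z^*_{\tau^*_a}Z^*_{\tau^*_b}},$$ where $a$ is the first crossing on the strand going up and left from $e$, $b$ is the first crossing on the strand going up and right from $e$, and $f$ is the first crossing on the strand going up and left from $b$. If $a$, $b$ or $f$ does not exist, then $\tau_a$, $\tau_b$ or $\tau_f$ (and its dual) is replaced by the exterior partition $\tau_-$ (respectively $\tau_-^*$).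 -/

import Mathlib

/-! ### Electrical networks with nodes, groves and partition sums -/

/-- The combinatorial part of an electrical network with `n` nodes: a finite multigraph with a
node map. The node map need not be injective, so that nodes may be glued together (cactus
networks). Conductances are kept separate, as functions on the edges. -/
structure NodedGraph (n : ℕ) where
  /-- The vertices. -/
  Vertex : Type
  /-- The edges. -/
  Edge : Type
  /-- There are finitely many edges. -/
  fintypeEdge : Fintype Edge
  /-- The (unordered) pair of ends of an edge. -/
  ends : Edge → Sym2 Vertex
  /-- The vertex at which a node sits. -/
  node : Fin n → Vertex

namespace NodedGraph

variable {n : ℕ} (G : NodedGraph n)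

instance : Fintype G.Edge := G.fintypeEdge

/-- Two vertices are connected through edges in the set `T`. -/
def Connected (T : Set G.Edge) : G.Vertex → G.Vertex → Prop :=
  Relation.EqvGen fun u v => ∃ e ∈ T, G.ends e = s(u, v)

/-- A grove: a set of edges that contains no cycle (no edge of `T` joins two vertices which are
connected through the other edges of `T`; in particular there are no loops), and every connected
component of which contains a node. -/
def IsGrove (T : Set G.Edge) : Prop :=
  (∀ e ∈ T, ∀ u v, G.ends e = s(u, v) → ¬ G.Connected (T \ {e}) u v) ∧
    ∀ v, ∃ i, G.Connected T v (G.node i)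

/-- The partition of the nodes according to the connected components of `T`. -/
def partition (T : Set G.Edge) : Setoid (Fin n) where
  r i j := G.Connected T (G.node i) (G.node j)
  iseqv :=
    ⟨fun _ => Relation.EqvGen.refl _, fun h => Relation.EqvGen.symm _ _ h,
      fun h h' => Relation.EqvGen.trans _ _ _ h h'⟩

open Classical in
/-- The partition sum `Z_τ`: the sum over all groves with partition `τ` of the product of the
conductances of the edges of the grove. -/
noncomputable def partitionSum (c : G.Edge → ℝ) (τ : Setoid (Fin n)) : ℝ :=
  ∑ T : Finset G.Edge with G.IsGrove (T : Set G.Edge) ∧ G.partition (T : Set G.Edge) = τ,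
    ∏ e ∈ T, c e

end NodedGraph

/-! ### Dyck tilings -/

/-- The height of a Dyck path above the axis after `i` steps (`0` after its end). -/
def dyckHeight (w : DyckWord) (i : ℕ) : ℤ :=
  ((w.toList.take i).count DyckStep.U : ℤ) - ((w.toList.take i).count DyckStep.D : ℤ)

/-- A Dyck tile (a fattened Dyck path) in the lattice of points `(x, y)`, `x ≡ y` mod `2`. It is
given by its left-most point `(left, level)` and the Dyck path `path` that is formed by the
centers of its boxes, the first of which has center `(left + 1, level)`. The box with center
`(x, y)` has corners `(x ± 1, y)` and `(x, y ± 1)`. If `path` is empty, the tile is a single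
box. -/
structure DyckTile where
  /-- Horizontal position of the left-most point. -/
  left : ℕ
  /-- Height of the left-most point (and of the right-most one). -/
  level : ℤ
  /-- The Dyck path formed by the centers of the boxes. -/
  path : DyckWord

namespace DyckTile

/-- The number of steps of the path of box centers: one less than the number of boxes. -/
def steps (t : DyckTile) : ℕ := t.path.toList.length

/-- Horizontal position of the right-most point. -/
def right (t : DyckTile) : ℕ := t.left + t.steps + 2

/-- The centers of the boxes of the tile. -/
def boxes (t : DyckTile) : Set (ℕ × ℤ) :=
  {b | ∃ i ≤ t.steps, b = (t.left + 1 + i, t.level + dyckHeight t.path i)}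

/-- The left-most point of the tile. -/
def leftPoint (t : DyckTile) : ℕ × ℤ := (t.left, t.level)

/-- The right-most point of the tile. -/
def rightPoint (t : DyckTile) : ℕ × ℤ := (t.right, t.level)

/-- The upper end of the upper edge of the tile adjacent to its left-most point. -/
def topLeftPoint (t : DyckTile) : ℕ × ℤ := (t.left + 1, t.level + 1)

/-- The upper end of the upper edge of the tile adjacent to its right-most point. -/
def topRightPoint (t : DyckTile) : ℕ × ℤ := (t.left + 1 + t.steps, t.level + 1)

/-- The lower end of the lower edge of the tile adjacent to its left-most point. -/
def bottomLeftPoint (t : DyckTile) : ℕ × ℤ := (t.left + 1, t.level - 1)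

end DyckTile

/-- The centers of the boxes between the paths `lam` and `mu`, that is, of the boxes of the skew
shape. -/
def skewShape (lam mu : DyckWord) : Set (ℕ × ℤ) :=
  {b | dyckHeight lam b.1 < b.2 ∧ b.2 < dyckHeight mu b.1 ∧ Odd (b.2 - (b.1 : ℤ))}

/-- A (cover-inclusive) Dyck tiling of order `n`. -/
structure DyckTiling (n : ℕ) where
  /-- The lower Dyck path. -/
  lower : DyckWord
  /-- The upper Dyck path. -/
  upper : DyckWord
  lower_order : lower.semilength = n
  upper_order : upper.semilength = n
  lower_le_upper : ∀ x, dyckHeight lower x ≤ dyckHeight upper x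
  /-- The tiles. -/
  tiles : Finset DyckTile
  boxes_subset : ∀ t ∈ tiles, t.boxes ⊆ skewShape lower upper
  existsUnique_tile : ∀ b ∈ skewShape lower upper, ∃! t, t ∈ tiles ∧ b ∈ t.boxes
  /-- If a box of `t` lies directly above a box of `s`, then the horizontal extent of `t` is
  contained in that of `s`. -/
  cover_inclusive : ∀ s ∈ tiles, ∀ t ∈ tiles, ∀ x y, (x, y) ∈ s.boxes → (x, y + 2) ∈ t.boxes →
    s.left ≤ t.left ∧ t.right ≤ s.right

/-! ### The strand diagram of a Dyck tiling

There is a stub in the middle of each of the `2 * n` edges of the upper path, and the strands are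
drawn below the upper path. In each tile the strand which enters at the lower edge adjacent to the
left-most point and leaves at the upper edge adjacent to the right-most point, and the strand which
enters at the upper edge adjacent to the left-most point and leaves at the lower edge adjacent to
the right-most point, cross once. Above this crossing, further strands pass through the tile
horizontally, from an up-edge of its upper boundary to the matching down-edge. Below the lower
path the strands turn around horizontally as well, from an up-edge to the matching down-edge.
So the crossings correspond to the tiles. -/

/-- The colors of the cells of the strand diagram. The blue cells are the vertices of the network,
the red cells are the vertices of the dual network. -/
inductive CellColor
  | blue
  | red

/-- The color of the left and right cells at the crossing in a tile (the cells above and below the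
crossing have the other color): the edge that joins the left and the right cell, which is the
horizontal edge, belongs to the network of this color. Blue cells contain lattice points with
odd coordinates, red cells contain lattice points with even coordinates. -/
def DyckTile.horizontalColor (t : DyckTile) : CellColor :=
  if Odd t.left then CellColor.blue else CellColor.red

namespace DyckTiling

variable {n : ℕ} (D : DyckTiling n)

/-- The crossings of the strand diagram: one in each tile. -/
abbrev Crossing : Type := {t : DyckTile // t ∈ D.tiles}

/-- Lattice points that are visibly in the same cell of the strand diagram, that is, can be joined
inside one tile, or inside the region below the lower path, without meeting a strand.
(A lattice point in the interior of the lower boundary of a tile, and above the level of the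
lowest points there, is not needed to describe a cell, as no strand comes near it from below;
the lowest points in the interior of the lower boundary are in the cell below the crossing.) -/
inductive SameCell : ℕ × ℤ → ℕ × ℤ → Prop
  /-- Two points of the lower path at the same height, without a lower point of that path in
  between: the strands below the lower path join its matching edges horizontally. -/
  | below (x x' : ℕ) (hx : x ≤ x') (hx' : x' ≤ 2 * n)
      (h : dyckHeight D.lower x = dyckHeight D.lower x')
      (hm : ∀ m, x ≤ m → m ≤ x' → dyckHeight D.lower x ≤ dyckHeight D.lower m) :
      SameCell (x, dyckHeight D.lower x) (x', dyckHeight D.lower x')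
  /-- Two points in the interior of the upper boundary of a tile at the same height, without a
  lower point of that boundary in between. In particular, the points at height `level + 1` are in
  the cell just above the crossing. -/
  | above (t : DyckTile) (ht : t ∈ D.tiles) (i j : ℕ) (hij : i ≤ j) (hj : j ≤ t.steps)
      (h : dyckHeight t.path i = dyckHeight t.path j)
      (hm : ∀ m, i ≤ m → m ≤ j → dyckHeight t.path i ≤ dyckHeight t.path m) :
      SameCell (t.left + 1 + i, t.level + dyckHeight t.path i + 1)
        (t.left + 1 + j, t.level + dyckHeight t.path j + 1)
  /-- Two lowest points in the interior of the lower boundary of a tile: they are in the cell just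
  below the crossing, since no strands pass through the tile below the crossing. -/
  | bottom (t : DyckTile) (ht : t ∈ D.tiles) (i j : ℕ) (hi : i ≤ t.steps) (hj : j ≤ t.steps)
      (h : dyckHeight t.path i = 0) (h' : dyckHeight t.path j = 0) :
      SameCell (t.left + 1 + i, t.level - 1) (t.left + 1 + j, t.level - 1)

/-- The cell of a lattice point. -/
def cell (p : ℕ × ℤ) : Quot D.SameCell := Quot.mk D.SameCell p

/-- The cell that contains a node. The stubs `1, …, 2 * n` are at horizontal positions
`1/2, 3/2, …`. The (blue) node `i` of the network lies between the stubs `2 * i - 1` and `2 * i`,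
the (red) node `i` of the dual network lies between the stubs `2 * i` and `2 * i + 1`
(for `i = n`, between the last stub and the first one: the two end points of the lower path
lie in the same cell). Here the index `i` runs from `1` to `n`; in the code it starts at `0`. -/
def nodeCell : CellColor → Fin n → Quot D.SameCell
  | CellColor.blue, i => D.cell (2 * (i : ℕ) + 1, dyckHeight D.upper (2 * (i : ℕ) + 1))
  | CellColor.red, i => D.cell (2 * (i : ℕ) + 2, dyckHeight D.upper (2 * (i : ℕ) + 2))

open Classical in
/-- The two opposite cells of the given color at a crossing: left and right, or below and above. -/
noncomputable def endCells (col : CellColor) (e : D.Crossing) :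
    Quot D.SameCell × Quot D.SameCell :=
  if e.1.horizontalColor = col then (D.cell e.1.leftPoint, D.cell e.1.rightPoint)
  else (D.cell e.1.bottomLeftPoint, D.cell e.1.topLeftPoint)

/-- The cells of the given color: every cell touches the boundary of the disk between two stubs
or has a crossing at one of its corners. -/
def IsCellOfColor (col : CellColor) (v : Quot D.SameCell) : Prop :=
  (∃ i, v = D.nodeCell col i) ∨ ∃ e, v = (D.endCells col e).1 ∨ v = (D.endCells col e).2

/-- The graph of the standard network (blue) of a Dyck tiling, and of its dual network (red): the
vertices are the cells of the given color in the strand diagram, with an edge through each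
crossing. The edge and the dual edge at a crossing are both named by the crossing. -/
noncomputable def graph (col : CellColor) : NodedGraph n where
  Vertex := {v : Quot D.SameCell // D.IsCellOfColor col v}
  Edge := D.Crossing
  fintypeEdge := inferInstance
  ends e := s(⟨(D.endCells col e).1, Or.inr ⟨e, Or.inl rfl⟩⟩,
    ⟨(D.endCells col e).2, Or.inr ⟨e, Or.inr rfl⟩⟩)
  node i := ⟨D.nodeCell col i, Or.inl ⟨i, rfl⟩⟩

/-- Conductances on the edges of the network: positive real numbers. -/
abbrev Conductances : Type := {c : D.Crossing → ℝ // ∀ e, 0 < c e}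

/-- The conductances of the network (blue) and of its dual network (red): the conductance of a dual
edge is the reciprocal of the conductance of the edge. -/
noncomputable def edgeConductance (c : D.Conductances) : CellColor → D.Crossing → ℝ
  | CellColor.blue, e => c.1 e
  | CellColor.red, e => (c.1 e)⁻¹

open Classical in
/-- The vertical conductance of a crossing: the conductance of the edge or of the dual edge at the
crossing, whichever is vertical. -/
noncomputable def verticalConductance (c : D.Conductances) (e : D.Crossing) : ℝ :=
  if e.1.horizontalColor = CellColor.blue then D.edgeConductance c CellColor.red e
  else D.edgeConductance c CellColor.blue e

/-! ### Combs and tripod variables -/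

/-- `t` is the first crossing on the strand going up and left from `e`: that strand leaves the tile
of `e` through its upper edge adjacent to the left-most point, and this is the lower edge of the
tile of `t` adjacent to the right-most point. -/
def UpLeft (e t : D.Crossing) : Prop := t.1.rightPoint = e.1.topLeftPoint

/-- `t` is the first crossing on the strand going up and right from `e`: that strand leaves the
tile of `e` through its upper edge adjacent to the right-most point, and this is the lower edge of
the tile of `t` adjacent to the left-most point. -/
def UpRight (e t : D.Crossing) : Prop := t.1.leftPoint = e.1.topRightPoint

open Classical in
/-- The first crossing on the strand going up and left from `e`, if there is one. -/
noncomputable def firstUpLeft (e : D.Crossing) : Option D.Crossing :=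
  if h : ∃ t, D.UpLeft e t then some h.choose else none

open Classical in
/-- The first crossing on the strand going up and right from `e`, if there is one. -/
noncomputable def firstUpRight (e : D.Crossing) : Option D.Crossing :=
  if h : ∃ t, D.UpRight e t then some h.choose else none

/-- The crossings of the comb at `e`: those on its spine, which goes up and left from `e`
(starting with `e`), and those on its teeth, which go up and right from the crossings on the
spine. -/
def comb (e : D.Crossing) : Set D.Crossing :=
  {t | ∃ s, Relation.ReflTransGen D.UpLeft e s ∧ Relation.ReflTransGen D.UpRight s t}

/-- The comb at a crossing, or the empty set of crossings (for the exterior partition). -/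
def combOrEmpty : Option D.Crossing → Set D.Crossing
  | some e => D.comb e
  | none => ∅

/-- The edges of the given color that are selected if each crossing in `C` is resolved vertically
and each other crossing is resolved horizontally: those edges which are vertical and at a crossing
in `C`, or horizontal and at a crossing outside `C`. -/
def resolvedEdges (col : CellColor) (C : Set D.Crossing) : Set D.Crossing :=
  {e | (e ∈ C ∧ e.1.horizontalColor ≠ col) ∨ (e ∉ C ∧ e.1.horizontalColor = col)}

/-- The partition `τ_χ` of the nodes (or the dual partition of the dual nodes) for a crossing `χ`;
for `none` the exterior partition `τ_-`. -/
noncomputable def tripodPartition (col : CellColor) (o : Option D.Crossing) : Setoid (Fin n) :=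
  (D.graph col).partition (D.resolvedEdges col (D.combOrEmpty o))

/-- The tripod variables `Z_τ` of the network (blue) and of its dual network (red), as functions of
the conductances of the network. -/
noncomputable def tripodVariable (col : CellColor) (o : Option D.Crossing) (c : D.Conductances) :
    ℝ :=
  (D.graph col).partitionSum (D.edgeConductance c col) (D.tripodPartition col o)

end DyckTiling

/-!
A tripod variable is the sum over all groves with a certain partition `τ`, where `τ` is given by one
set `R` of edges. The heart of the matter is that `R` is a grove, and the *only* grove with this
partition, so that the sum has a single term: the product of the conductances of the edges in `R`
(`tripodVariable_eq_prod`).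

Uniqueness rests on a criterion for arbitrary graphs, `NodedGraph.Certificate`. The edges of `R` are
oriented from `near` to `far`, and all edges are ranked, such that an edge of `R` outranks all other
edges at its near end. The vertices from which oriented paths lead to the near end of `e` form a
tree whose only exit along `R` is `e`, and all other edges at this tree have smaller rank than `e`.
Suppose that a grove `T` has the same partition as `R`, and agrees with `R` on the edges of rank
smaller than that of `e`. If `e` is in `R` but not in `T`, the component in `T` of the near end of
`e` is confined to the tree of `e`, whereas a node in this tree must be joined to a node outside it.
If `e` is in `T` but not in `R`, its two ends are joined in `T` to nodes by edges of smaller rank,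
and these nodes are in different components of `R`, as a label that is constant on the components of
`R` takes different values at the two ends. Both are contradictions (`eq_of_partition_eq`).

To find such data for a Dyck tiling, each cell of the strand diagram is viewed as a horizontal run
at a fixed height (`Row`), and each crossing as a segment at the level of its tile. The strands do
not matter otherwise: cells are distinguished by the crossings that begin or end at their height,
and every cell ends, on the left and on the right, at the boundary or at a crossing. Tiles with a
common column are ordered consistently by their levels (`level_trichotomy`), by
cover-inclusiveness. The comb cuts the diagram into layers: what is below the comb, on the left or
on the right of its tip, and what is above its first tooth, above the first two teeth, and so on
(`Above`, `depth`). The ranks run through these layers from the outside inwards, and along each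
tooth from left to right (`rank`). The edges are oriented upwards along the teeth, to the right
below the comb on the left side, and to the left elsewhere (`Forward`). The components turn around
at the spine, and climb through a tooth by two units of height per tooth, so the height minus twice
the depth, suitably continued below the comb, is the label (`label`).

Given the product formula, passing from the exterior partition to the comb at `e` multiplies the
tripod variable by the vertical conductances of the crossings in the comb
(`tripodVariable_eq_mul`). With `a`, `b` and `f` the crossings next to `e` as in the biratio, the
comb at `e` is the disjoint union of `e`, the first tooth of the comb at `b`, and the comb at `a`;
the comb at `b` is the disjoint union of its first tooth and the comb at `f`. This gives the
biratio (`verticalConductance_eq`). Finally, the comb can be read off from its tripod variable by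
varying single conductances, and the crossing from its comb, so there are as many tripod variables
as crossings, plus one.
-/

/-! ### Heights of Dyck paths -/

lemma dyckHeight_zero (w : DyckWord) : dyckHeight w 0 = 0 := by simp [dyckHeight]

lemma dyckHeight_nonneg (w : DyckWord) (i : ℕ) : 0 ≤ dyckHeight w i := by
  have := w.count_D_le_count_U i
  unfold dyckHeight
  omega

lemma dyckHeight_of_length_le (w : DyckWord) {i : ℕ} (h : w.toList.length ≤ i) :
    dyckHeight w i = 0 := by
  unfold dyckHeight
  rw [List.take_of_length_le h, w.count_U_eq_count_D, sub_self]

lemma dyckHeight_succ (w : DyckWord) {i : ℕ} (h : i < w.toList.length) :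
    dyckHeight w (i + 1) = dyckHeight w i + 1 ∨ dyckHeight w (i + 1) = dyckHeight w i - 1 := by
  unfold dyckHeight
  rw [List.take_succ_eq_append_getElem h, List.count_append, List.count_append]
  rcases DyckStep.dichotomy w.toList[i] with h | h <;> rw [h]
  · left; simp; ring
  · right; simp; ring

lemma dyckHeight_parity (w : DyckWord) {i : ℕ} (h : i ≤ w.toList.length) :
    Even (dyckHeight w i - i) := by
  induction i with
  | zero => simp [dyckHeight_zero]
  | succ i ih =>
    have h1 := ih (by omega)
    rw [Int.even_iff] at h1 ⊢
    rcases dyckHeight_succ w (i := i) (by omega) with h2 | h2 <;> rw [h2] <;> push_cast <;> omega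

/-- A discrete intermediate value theorem, going back from `m`. -/
lemma exists_last_eq {f : ℕ → ℤ} {y : ℤ} {m : ℕ} (h0 : f 0 ≤ y) (hm : y ≤ f m)
    (hf : ∀ i < m, f (i + 1) ≤ f i + 1) :
    ∃ i ≤ m, f i = y ∧ ∀ j, i ≤ j → j ≤ m → y ≤ f j := by
  induction m with
  | zero =>
    exact ⟨0, le_rfl, le_antisymm h0 hm, fun j _ hj => by simpa [Nat.le_zero.1 hj] using hm⟩
  | succ m ih =>
    by_cases h : y ≤ f m
    · obtain ⟨i, hi, h1, h2⟩ := ih h fun i hi => hf i (by omega)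
      refine ⟨i, by omega, h1, fun j hj hj' => ?_⟩
      rcases Nat.lt_or_ge j (m + 1) with h3 | h3
      · exact h2 j hj (by omega)
      · rwa [show j = m + 1 by omega]
    · have := hf m (by omega)
      refine ⟨m + 1, le_rfl, by omega, fun j hj hj' => ?_⟩
      rwa [show j = m + 1 by omega]

/-- A discrete intermediate value theorem, going forward from `m`. -/
lemma exists_first_eq {f : ℕ → ℤ} {y : ℤ} {m N : ℕ} (hmN : m ≤ N) (hN : f N ≤ y) (hm : y ≤ f m)
    (hf : ∀ i, m ≤ i → i < N → f i - 1 ≤ f (i + 1)) :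
    ∃ i, m ≤ i ∧ i ≤ N ∧ f i = y ∧ ∀ j, m ≤ j → j ≤ i → y ≤ f j := by
  obtain ⟨i, hi, h1, h2⟩ := exists_last_eq (f := fun k => f (N - k)) (y := y) (m := N - m)
    (by simpa)
    (by simpa [show N - (N - m) = m by omega]) (fun i hi => by
      have := hf (N - (i + 1)) (by omega) (by omega)
      rw [show N - (i + 1) + 1 = N - i by omega] at this
      show f (N - (i + 1)) ≤ f (N - i) + 1
      omega)
  refine ⟨N - i, by omega, by omega, h1, fun j hj hj' => ?_⟩
  have := h2 (N - j) (by omega) (by omega)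
  simpa [show N - (N - j) = j by omega] using this

/-! ### Tiles and their columns -/

namespace DyckTile

variable (t : DyckTile)

/-- The columns that contain a box of the tile. -/
def Col (x : ℕ) : Prop := t.left < x ∧ x < t.right

/-- The height of the center of the box in column `x`, for a column of the tile. -/
def center (x : ℕ) : ℤ := t.level + dyckHeight t.path (x - (t.left + 1))

lemma left_add_two_le_right : t.left + 2 ≤ t.right := by unfold right; omega

lemma col_left : t.Col (t.left + 1) := by
  have := t.left_add_two_le_right
  constructor <;> omega

lemma col_right : t.Col (t.right - 1) := by
  have := t.left_add_two_le_right
  constructor <;> omega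

lemma mem_boxes_iff {x : ℕ} {y : ℤ} : (x, y) ∈ t.boxes ↔ t.Col x ∧ y = t.center x := by
  unfold boxes Col center right
  constructor
  · rintro ⟨i, hi, h⟩
    simp only [Prod.mk.injEq] at h
    refine ⟨by omega, ?_⟩
    rw [h.2, show x - (t.left + 1) = i by omega]
  · rintro ⟨h1, h2⟩
    exact ⟨x - (t.left + 1), by omega, by rw [h2]; congr 1; omega⟩

lemma center_left : t.center (t.left + 1) = t.level := by simp [center, dyckHeight_zero]

lemma center_right : t.center (t.right - 1) = t.level := by
  unfold center
  rw [dyckHeight_of_length_le, add_zero]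
  unfold right steps
  omega

lemma level_le_center (x : ℕ) : t.level ≤ t.center x := by
  have := dyckHeight_nonneg t.path (x - (t.left + 1))
  unfold center
  omega

variable {t} in
lemma Col.center_succ {x : ℕ} (h : t.Col x) (h' : t.Col (x + 1)) :
    t.center (x + 1) = t.center x + 1 ∨ t.center (x + 1) = t.center x - 1 := by
  unfold Col right steps at *
  unfold center
  have := dyckHeight_succ t.path (i := x - (t.left + 1)) (by omega)
  rw [show x + 1 - (t.left + 1) = x - (t.left + 1) + 1 by omega]
  omega

end DyckTile

/-! ### The geometry of a Dyck tiling -/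

namespace DyckTiling

variable {n : ℕ} (D : DyckTiling n)

lemma length_upper : D.upper.toList.length = 2 * n := by
  rw [← DyckWord.two_mul_semilength_eq_length, D.upper_order]

lemma length_lower : D.lower.toList.length = 2 * n := by
  rw [← DyckWord.two_mul_semilength_eq_length, D.lower_order]

lemma upper_succ {x : ℕ} (h : x < 2 * n) : dyckHeight D.upper (x + 1) = dyckHeight D.upper x + 1 ∨
    dyckHeight D.upper (x + 1) = dyckHeight D.upper x - 1 :=
  dyckHeight_succ _ (by rwa [D.length_upper])

lemma lower_succ {x : ℕ} (h : x < 2 * n) : dyckHeight D.lower (x + 1) = dyckHeight D.lower x + 1 ∨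
    dyckHeight D.lower (x + 1) = dyckHeight D.lower x - 1 :=
  dyckHeight_succ _ (by rwa [D.length_lower])

lemma upper_parity {x : ℕ} (h : x ≤ 2 * n) : (dyckHeight D.upper x - x) % 2 = 0 :=
  Int.even_iff.1 (dyckHeight_parity _ (by rwa [D.length_upper]))

lemma lower_parity {x : ℕ} (h : x ≤ 2 * n) : (dyckHeight D.lower x - x) % 2 = 0 :=
  Int.even_iff.1 (dyckHeight_parity _ (by rwa [D.length_lower]))

lemma upper_end : dyckHeight D.upper (2 * n) = 0 :=
  dyckHeight_of_length_le _ (by rw [D.length_upper])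

lemma lower_end : dyckHeight D.lower (2 * n) = 0 :=
  dyckHeight_of_length_le _ (by rw [D.length_lower])

variable {D}

lemma box_mem (e : D.Crossing) {x : ℕ} (hx : e.1.Col x) :
    (x, e.1.center x) ∈ skewShape D.lower D.upper :=
  D.boxes_subset e.1 e.2 (e.1.mem_boxes_iff.2 ⟨hx, rfl⟩)

lemma lower_lt_center (e : D.Crossing) {x : ℕ} (hx : e.1.Col x) :
    dyckHeight D.lower x < e.1.center x := (box_mem e hx).1

lemma col_lt (e : D.Crossing) {x : ℕ} (hx : e.1.Col x) : x < 2 * n := by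
  by_contra h
  have h1 := (box_mem e hx).1
  have h2 := (box_mem e hx).2.1
  have h3 := dyckHeight_of_length_le D.upper (i := x) (by rw [D.length_upper]; omega)
  have := dyckHeight_nonneg D.lower x
  simp only at h1 h2
  omega

lemma center_parity (e : D.Crossing) {x : ℕ} (hx : e.1.Col x) :
    (e.1.center x - x) % 2 = 1 := Int.odd_iff.1 (box_mem e hx).2.2

lemma center_lt_upper (e : D.Crossing) {x : ℕ} (hx : e.1.Col x) :
    e.1.center x + 1 ≤ dyckHeight D.upper x := (box_mem e hx).2.1

lemma right_le (e : D.Crossing) : e.1.right ≤ 2 * n := by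
  have := col_lt e e.1.col_right
  omega

lemma left_parity (e : D.Crossing) : (e.1.level - e.1.left) % 2 = 0 := by
  have := center_parity e e.1.col_left
  rw [e.1.center_left] at this
  push_cast at this
  omega

lemma right_parity (e : D.Crossing) : (e.1.level - e.1.right) % 2 = 0 := by
  have := center_parity e e.1.col_right
  rw [e.1.center_right] at this
  have := e.1.left_add_two_le_right
  omega

lemma eq_of_center_eq {s t : D.Crossing} {x : ℕ} (hs : s.1.Col x) (ht : t.1.Col x)
    (h : s.1.center x = t.1.center x) : s = t := by
  obtain ⟨u, -, hu⟩ := D.existsUnique_tile _ (box_mem s hs)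
  have h1 := hu s.1 ⟨s.2, s.1.mem_boxes_iff.2 ⟨hs, rfl⟩⟩
  have h2 := hu t.1 ⟨t.2, t.1.mem_boxes_iff.2 ⟨ht, h⟩⟩
  exact Subtype.ext (h1.trans h2.symm)

lemma exists_crossing {x : ℕ} {y : ℤ} (h1 : dyckHeight D.lower x < y)
    (h2 : y < dyckHeight D.upper x) (h3 : (y - x) % 2 = 1) :
    ∃ e : D.Crossing, e.1.Col x ∧ e.1.center x = y := by
  obtain ⟨u, ⟨hu, hb⟩, -⟩ := D.existsUnique_tile (x, y) ⟨h1, h2, Int.odd_iff.2 h3⟩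
  rw [DyckTile.mem_boxes_iff] at hb
  exact ⟨⟨u, hu⟩, hb.1, hb.2.symm⟩

lemma extent_of_center_eq {s t : D.Crossing} {x : ℕ} (hs : s.1.Col x) (ht : t.1.Col x)
    (h : t.1.center x = s.1.center x + 2) : s.1.left ≤ t.1.left ∧ t.1.right ≤ s.1.right :=
  D.cover_inclusive s.1 s.2 t.1 t.2 x (s.1.center x) (s.1.mem_boxes_iff.2 ⟨hs, rfl⟩)
    (t.1.mem_boxes_iff.2 ⟨ht, h.symm⟩)

/-- Cover-inclusiveness for tiles that are not adjacent, by induction over the boxes of a column. -/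
lemma extent_of_center_lt {s t : D.Crossing} {x : ℕ} (hs : s.1.Col x) (ht : t.1.Col x)
    (h : s.1.center x < t.1.center x) : s.1.left ≤ t.1.left ∧ t.1.right ≤ s.1.right := by
  obtain ⟨k, hk⟩ : ∃ k : ℕ, t.1.center x - s.1.center x ≤ k := ⟨_, Int.self_le_toNat _⟩
  induction k generalizing s with
  | zero => push_cast at hk; omega
  | succ k ih =>
    have p1 := center_parity s hs
    have p2 := center_parity t ht
    have := lower_lt_center s hs
    have := center_lt_upper t ht
    obtain ⟨r, hr, hc⟩ := exists_crossing (D := D) (x := x) (y := s.1.center x + 2)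
      (by omega) (by omega) (by omega)
    have h1 := extent_of_center_eq hs hr hc
    by_cases h2 : r = t
    · rwa [← h2]
    · have h3 : r.1.center x ≠ t.1.center x := fun h3 => h2 (eq_of_center_eq hr ht h3)
      have h4 := ih hr (by omega) (by push_cast at hk; omega)
      omega

/-- Two tiles do not change their order from a column to the next one to the left. -/
lemma center_lt_pred {s t : D.Crossing} {x : ℕ} (hs : s.1.Col x) (ht : t.1.Col x)
    (hs' : s.1.Col (x + 1)) (ht' : t.1.Col (x + 1)) (h : s.1.center (x + 1) < t.1.center (x + 1)) :
    s.1.center x < t.1.center x := by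
  have h1 := hs.center_succ hs'
  have h2 := ht.center_succ ht'
  have h3 : s.1.center x ≠ t.1.center x := fun h3 => by
    rw [eq_of_center_eq hs ht h3] at h
    omega
  have p1 := center_parity s hs
  have p2 := center_parity t ht
  omega

lemma level_lt_of_center_lt {s t : D.Crossing} {x : ℕ} (hs : s.1.Col x) (ht : t.1.Col x)
    (h : s.1.center x < t.1.center x) : s.1.level + 2 ≤ t.1.level := by
  obtain ⟨h1, h2⟩ := extent_of_center_lt hs ht h
  have key : ∀ k, t.1.left + 1 + k < t.1.right →
      s.1.center (t.1.left + 1 + k) < t.1.center (t.1.left + 1 + k) →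
      s.1.center (t.1.left + 1) < t.1.center (t.1.left + 1) := by
    intro k
    induction k with
    | zero => exact fun _ h => h
    | succ k ih =>
      exact fun h3 h4 => ih (by omega) (center_lt_pred ⟨by omega, by omega⟩ ⟨by omega, by omega⟩
        ⟨by omega, by omega⟩ ⟨by omega, by omega⟩ h4)
  unfold DyckTile.Col at ht
  have h3 := key (x - (t.1.left + 1)) (by omega)
    (by rwa [show t.1.left + 1 + (x - (t.1.left + 1)) = x by omega])
  have h4 : s.1.Col (t.1.left + 1) := ⟨by omega, by omega⟩
  have p1 := center_parity s h4
  have p2 := center_parity t t.1.col_left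
  have := s.1.level_le_center (t.1.left + 1)
  rw [t.1.center_left] at *
  omega

/-- Tiles in a common column are ordered by their levels, which differ by at least two. -/
lemma level_trichotomy {s t : D.Crossing} {x : ℕ} (hs : s.1.Col x) (ht : t.1.Col x) :
    s = t ∨ s.1.level + 2 ≤ t.1.level ∨ t.1.level + 2 ≤ s.1.level := by
  rcases lt_trichotomy (s.1.center x) (t.1.center x) with h | h | h
  · exact Or.inr (Or.inl (level_lt_of_center_lt hs ht h))
  · exact Or.inl (eq_of_center_eq hs ht h)
  · exact Or.inr (Or.inr (level_lt_of_center_lt ht hs h))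

lemma eq_of_level_eq {s t : D.Crossing} {x : ℕ} (hs : s.1.Col x) (ht : t.1.Col x)
    (h : s.1.level = t.1.level) : s = t := by
  rcases level_trichotomy hs ht with h1 | h1 | h1
  · exact h1
  all_goals omega

lemma center_lt_of_level_lt {s t : D.Crossing} {x : ℕ} (hs : s.1.Col x) (ht : t.1.Col x)
    (h : s.1.level < t.1.level) : s.1.center x + 2 ≤ t.1.center x := by
  have p1 := center_parity s hs
  have p2 := center_parity t ht
  rcases lt_trichotomy (s.1.center x) (t.1.center x) with h1 | h1 | h1
  · omega
  · rw [eq_of_center_eq hs ht h1] at h; omega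
  · have := level_lt_of_center_lt ht hs h1; omega

lemma level_le_upper (e : D.Crossing) {x : ℕ} (h1 : e.1.left ≤ x) (h2 : x ≤ e.1.right) :
    e.1.level ≤ dyckHeight D.upper x := by
  have h3 := center_lt_upper e e.1.col_left
  have h4 := center_lt_upper e e.1.col_right
  rw [e.1.center_left] at h3
  rw [e.1.center_right] at h4
  have h5 := e.1.left_add_two_le_right
  have h6 := right_le e
  by_cases hx : e.1.Col x
  · have := center_lt_upper e hx
    have := e.1.level_le_center x
    omega
  · unfold DyckTile.Col at hx
    rcases (by omega : x = e.1.left ∨ x = e.1.right) with h | h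
    · subst h
      have := D.upper_succ (x := e.1.left) (by omega)
      omega
    · subst h
      have := D.upper_succ (x := e.1.right - 1) (by omega)
      rw [show e.1.right - 1 + 1 = e.1.right by omega] at this
      omega

lemma level_lt_upper (e : D.Crossing) {x : ℕ} (hx : e.1.Col x) :
    e.1.level + 1 ≤ dyckHeight D.upper x := by
  have := center_lt_upper e hx
  have := e.1.level_le_center x
  omega

lemma lower_left_le (e : D.Crossing) : dyckHeight D.lower e.1.left ≤ e.1.level := by
  have h3 := lower_lt_center e e.1.col_left
  rw [e.1.center_left] at h3
  have := D.lower_succ (x := e.1.left) (by have := col_lt e e.1.col_left; omega)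
  omega

lemma lower_right_le (e : D.Crossing) : dyckHeight D.lower e.1.right ≤ e.1.level := by
  have h3 := lower_lt_center e e.1.col_right
  rw [e.1.center_right] at h3
  have h5 := e.1.left_add_two_le_right
  have := D.lower_succ (x := e.1.right - 1) (by have := col_lt e e.1.col_right; omega)
  rw [show e.1.right - 1 + 1 = e.1.right by omega] at this
  omega

/-! ### Consecutive crossings on a strand -/

lemma upRight_iff {s t : D.Crossing} :
    D.UpRight s t ↔ t.1.left + 1 = s.1.right ∧ t.1.level = s.1.level + 1 := by
  unfold UpRight DyckTile.leftPoint DyckTile.topRightPoint DyckTile.right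
  simp only [Prod.mk.injEq]
  omega

lemma upLeft_iff {s t : D.Crossing} :
    D.UpLeft s t ↔ t.1.right = s.1.left + 1 ∧ t.1.level = s.1.level + 1 := by
  unfold UpLeft DyckTile.rightPoint DyckTile.topLeftPoint
  simp only [Prod.mk.injEq]

lemma eq_of_left_eq {s t : D.Crossing} (h : s.1.left = t.1.left) (h' : s.1.level = t.1.level) :
    s = t :=
  eq_of_level_eq s.1.col_left (h ▸ t.1.col_left) h'

lemma eq_of_right_eq {s t : D.Crossing} (h : s.1.right = t.1.right) (h' : s.1.level = t.1.level) :
    s = t :=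
  eq_of_level_eq s.1.col_right (h ▸ t.1.col_right) h'

lemma UpRight.unique {s t t' : D.Crossing} (h : D.UpRight s t) (h' : D.UpRight s t') : t = t' := by
  rw [upRight_iff] at h h'
  exact eq_of_left_eq (by omega) (by omega)

lemma UpRight.unique_left {s s' t : D.Crossing} (h : D.UpRight s t) (h' : D.UpRight s' t) :
    s = s' := by
  rw [upRight_iff] at h h'
  exact eq_of_right_eq (by omega) (by omega)

lemma UpLeft.unique {s t t' : D.Crossing} (h : D.UpLeft s t) (h' : D.UpLeft s t') : t = t' := by
  rw [upLeft_iff] at h h'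
  exact eq_of_right_eq (by omega) (by omega)

/-- A strand that goes up and right either meets another crossing or leaves through the upper
path. -/
lemma exists_upRight (s : D.Crossing) :
    (∃ t, D.UpRight s t) ∨ dyckHeight D.upper s.1.right = s.1.level := by
  by_cases h : dyckHeight D.upper s.1.right = s.1.level
  · exact Or.inr h
  left
  have h1 := level_le_upper s (x := s.1.right) (by have := s.1.left_add_two_le_right; omega) le_rfl
  have h2 := lower_right_le s
  have h3 := right_parity s
  have h4 := D.upper_parity (right_le s)
  have h5 := s.1.left_add_two_le_right
  obtain ⟨r, hr, hc⟩ := exists_crossing (D := D) (x := s.1.right) (y := s.1.level + 1)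
    (by omega) (by omega) (by omega)
  have h6 : ¬ r.1.Col (s.1.right - 1) := by
    intro h6
    have h7 := DyckTile.Col.center_succ h6 (by rwa [show s.1.right - 1 + 1 = s.1.right by omega])
    rw [show s.1.right - 1 + 1 = s.1.right by omega] at h7
    have h8 := s.1.center_right
    rcases h7 with h7 | h7
    · have := eq_of_center_eq h6 s.1.col_right (by omega)
      subst this
      exact lt_irrefl _ hr.2
    · have := (extent_of_center_eq s.1.col_right h6 (by omega)).2
      have := hr.2
      omega
  have h9 : r.1.left + 1 = s.1.right := by
    unfold DyckTile.Col at *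
    omega
  refine ⟨r, upRight_iff.2 ⟨h9, ?_⟩⟩
  rw [← hc, ← h9, r.1.center_left]

/-- A strand that goes up and left either meets another crossing or leaves through the upper
path. -/
lemma exists_upLeft (s : D.Crossing) :
    (∃ t, D.UpLeft s t) ∨ dyckHeight D.upper s.1.left = s.1.level := by
  by_cases h : dyckHeight D.upper s.1.left = s.1.level
  · exact Or.inr h
  left
  have h5 := s.1.left_add_two_le_right
  have h0 := right_le s
  have h1 := level_le_upper s (x := s.1.left) le_rfl (by omega)
  have h2 := lower_left_le s
  have h3 := left_parity s
  have h4 := D.upper_parity (x := s.1.left) (by omega)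
  obtain ⟨r, hr, hc⟩ := exists_crossing (D := D) (x := s.1.left) (y := s.1.level + 1)
    (by omega) (by omega) (by omega)
  have h6 : ¬ r.1.Col (s.1.left + 1) := by
    intro h6
    have h7 := hr.center_succ h6
    have h8 := s.1.center_left
    rcases h7 with h7 | h7
    · have := (extent_of_center_eq s.1.col_left h6 (by omega)).1
      have := hr.1
      omega
    · have := eq_of_center_eq h6 s.1.col_left (by omega)
      subst this
      exact lt_irrefl _ hr.1
  have h9 : r.1.right = s.1.left + 1 := by
    unfold DyckTile.Col at *
    omega
  refine ⟨r, upLeft_iff.2 ⟨h9, ?_⟩⟩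
  rw [← hc, show s.1.left = r.1.right - 1 by omega, r.1.center_right]

end DyckTiling

/-! ### Cells as horizontal runs -/

namespace DyckTiling

variable {n : ℕ} {D : DyckTiling n}

variable (D) in
/-- The row at height `y` runs below the upper path from column `x` to column `x'`, and no crossing
at this height begins or ends in between. -/
def Row (x x' : ℕ) (y : ℤ) : Prop :=
  x ≤ x' ∧ x' ≤ 2 * n ∧ (∀ m, x ≤ m → m ≤ x' → y ≤ dyckHeight D.upper m) ∧
    ∀ s : D.Crossing, s.1.level = y →
      ¬ (x ≤ s.1.left ∧ s.1.left < x') ∧ ¬ (x < s.1.right ∧ s.1.right ≤ x')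

/-- For a tile, compare the height of the path of centers with heights of box centers. -/
lemma center_eq (t : DyckTile) (i : ℕ) :
    t.center (t.left + 1 + i) = t.level + dyckHeight t.path i := by
  unfold DyckTile.center
  rw [show t.left + 1 + i - (t.left + 1) = i by omega]

lemma col_add {t : DyckTile} {i : ℕ} (h : i ≤ t.steps) : t.Col (t.left + 1 + i) := by
  unfold DyckTile.Col DyckTile.right
  omega

lemma row_below {x x' : ℕ} (hx : x ≤ x') (hx' : x' ≤ 2 * n)
    (h : dyckHeight D.lower x = dyckHeight D.lower x')
    (hm : ∀ m, x ≤ m → m ≤ x' → dyckHeight D.lower x ≤ dyckHeight D.lower m) :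
    D.Row x x' (dyckHeight D.lower x) := by
  refine ⟨hx, hx', fun m h1 h2 => (hm m h1 h2).trans (D.lower_le_upper m), fun s hs => ⟨?_, ?_⟩⟩
  · rintro ⟨h1, h2⟩
    have := lower_lt_center s s.1.col_left
    rw [s.1.center_left] at this
    have := hm (s.1.left + 1) (by omega) (by omega)
    omega
  · rintro ⟨h1, h2⟩
    have := lower_lt_center s s.1.col_right
    rw [s.1.center_right] at this
    have := hm (s.1.right - 1) (by omega) (by omega)
    omega

/-- No crossing begins or ends on the part of the row at height `y` that lies on or below the upper
boundary of a tile and above its level. -/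
lemma row_above (t : D.Crossing) {x x' : ℕ} {y : ℤ} (hx : t.1.left < x) (hxx : x ≤ x')
    (hx' : x' < t.1.right) (hy : t.1.level < y)
    (hm : ∀ m, x ≤ m → m ≤ x' → y ≤ t.1.center m + 1) : D.Row x x' y := by
  have key : ∀ s : D.Crossing, s.1.level = y → ∀ m, s.1.Col m → s.1.center m = s.1.level →
      x ≤ m → m ≤ x' → False := by
    intro s hs m h1 h2 h3 h4
    have h5 : t.1.Col m := ⟨by omega, by omega⟩
    have := center_lt_of_level_lt h5 h1 (by omega)
    have := hm m h3 h4
    omega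
  refine ⟨hxx, ?_, fun m h1 h2 => ?_, fun s hs => ⟨?_, ?_⟩⟩
  · have := right_le t; omega
  · have := hm m h1 h2
    have := center_lt_upper t (x := m) ⟨by omega, by omega⟩
    omega
  · rintro ⟨h1, h2⟩
    exact key s hs _ s.1.col_left s.1.center_left (by omega) (by omega)
  · rintro ⟨h1, h2⟩
    exact key s hs _ s.1.col_right s.1.center_right (by omega) (by omega)

lemma row_bottom (t : D.Crossing) {x x' : ℕ} (hx : t.1.left < x) (hxx : x ≤ x')
    (hx' : x' < t.1.right) : D.Row x x' (t.1.level - 1) := by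
  refine ⟨hxx, ?_, fun m h1 h2 => ?_, fun s hs => ⟨?_, ?_⟩⟩
  · have := right_le t; omega
  · have := level_lt_upper t (x := m) ⟨by omega, by omega⟩
    omega
  · rintro ⟨h1, h2⟩
    have := level_trichotomy s.1.col_left (t := t) ⟨by omega, by omega⟩
    rcases this with rfl | h | h <;> omega
  · rintro ⟨h1, h2⟩
    have := level_trichotomy s.1.col_right (t := t) ⟨by omega, by omega⟩
    rcases this with rfl | h | h <;> omega

/-- Points that are visibly in the same cell are joined by a run. -/
lemma row_of_sameCell {p q : ℕ × ℤ} (h : D.SameCell p q) :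
    p.2 = q.2 ∧ (D.Row p.1 q.1 p.2 ∨ D.Row q.1 p.1 p.2) := by
  cases h with
  | below x x' hx hx' h hm => exact ⟨h, Or.inl (row_below hx hx' h hm)⟩
  | above t ht i j hij hj h hm =>
    refine ⟨by simp only [h], Or.inl (row_above ⟨t, ht⟩ ?_ ?_ ?_ ?_ ?_)⟩
    · show t.left < t.left + 1 + i; omega
    · simpa using hij
    · exact (col_add hj).2
    · have := dyckHeight_nonneg t.path i
      show t.level < _
      simp only
      omega
    · intro m h1 h2
      simp only at h1 h2 ⊢
      have h3 := hm (m - (t.left + 1)) (by omega) (by omega)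
      unfold DyckTile.center
      omega
  | bottom t ht i j hi hj h h' =>
    refine ⟨rfl, ?_⟩
    have h1 := col_add hi
    have h2 := col_add hj
    rcases le_total i j with h3 | h3
    · exact Or.inl (row_bottom ⟨t, ht⟩ h1.1 (by simpa using h3) h2.2)
    · exact Or.inr (row_bottom ⟨t, ht⟩ h2.1 (by simpa using h3) h1.2)

/-- A quantity on points that is constant along runs is constant on cells. -/
lemma eq_of_cell_eq {α : Type*} {f : ℕ → ℤ → α}
    (hf : ∀ x x' y, D.Row x x' y → f x y = f x' y) {p q : ℕ × ℤ} (h : D.cell p = D.cell q) :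
    f p.1 p.2 = f q.1 q.2 := by
  have key : ∀ p q, D.SameCell p q → (fun p : ℕ × ℤ => f p.1 p.2) p = (fun p => f p.1 p.2) q := by
    intro p q hpq
    obtain ⟨h1, h2 | h2⟩ := row_of_sameCell hpq
    · show f p.1 p.2 = f q.1 q.2
      rw [hf _ _ _ h2, h1]
    · show f p.1 p.2 = f q.1 q.2
      rw [← hf _ _ _ h2, h1]
  exact congrArg (Quot.lift _ key) h

lemma row_eq_of_cell_eq {p q : ℕ × ℤ} (h : D.cell p = D.cell q) : p.2 = q.2 :=
  eq_of_cell_eq (f := fun _ y => y) (fun _ _ _ _ => rfl) h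

/-- The points of a cell are all to the left of a crossing at their height, or none is. -/
lemma le_left_iff_of_cell_eq {x x' : ℕ} {y y' : ℤ} (h : D.cell (x, y) = D.cell (x', y'))
    {s : D.Crossing} (hs : s.1.level = y) : x ≤ s.1.left ↔ x' ≤ s.1.left := by
  have := eq_of_cell_eq (D := D) (f := fun x y => s.1.level = y → x ≤ s.1.left) (by
    rintro x x' y ⟨h1, -, -, h2⟩
    refine propext (forall_congr' fun hs => ?_)
    have := h2 s hs
    omega) h
  have h2 := row_eq_of_cell_eq h
  simp only [eq_iff_iff] at this h2
  exact ⟨fun h3 => this.1 (fun _ => h3) (by omega), fun h3 => this.2 (fun _ => h3) (by omega)⟩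

/-- The points of a cell are all to the right of a crossing at their height, or none is. -/
lemma right_le_iff_of_cell_eq {x x' : ℕ} {y y' : ℤ} (h : D.cell (x, y) = D.cell (x', y'))
    {s : D.Crossing} (hs : s.1.level = y) : s.1.right ≤ x ↔ s.1.right ≤ x' := by
  have := eq_of_cell_eq (D := D) (f := fun x y => s.1.level = y → s.1.right ≤ x) (by
    rintro x x' y ⟨h1, -, -, h2⟩
    refine propext (forall_congr' fun hs => ?_)
    have := h2 s hs
    omega) h
  have h2 := row_eq_of_cell_eq h
  simp only [eq_iff_iff] at this h2
  exact ⟨fun h3 => this.1 (fun _ => h3) (by omega), fun h3 => this.2 (fun _ => h3) (by omega)⟩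

/-! ### Points of actual cells -/

variable (D) in
/-- A lattice point between the two paths that is not in a column of a tile at or above the level of
the tile and on or below its lower boundary, where no strand comes near it. The points of this kind
lie in actual cells of the strand diagram. -/
def Visible (x : ℕ) (y : ℤ) : Prop :=
  x ≤ 2 * n ∧ dyckHeight D.lower x ≤ y ∧ y ≤ dyckHeight D.upper x ∧ (y - x) % 2 = 0 ∧
    ∀ t : D.Crossing, t.1.Col x → y < t.1.center x → y < t.1.level

lemma visible_upper {x : ℕ} (hx : x ≤ 2 * n) : D.Visible x (dyckHeight D.upper x) :=
  ⟨hx, D.lower_le_upper x, le_rfl, D.upper_parity hx, fun t ht h => by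
    have := center_lt_upper t ht; omega⟩

lemma visible_left (e : D.Crossing) : D.Visible e.1.left e.1.level := by
  have h1 := e.1.left_add_two_le_right
  have h2 := right_le e
  refine ⟨by omega, lower_left_le e, level_le_upper e le_rfl (by omega), left_parity e,
    fun t ht h => ?_⟩
  by_cases h3 : t.1.Col (e.1.left + 1)
  · have h4 := ht.center_succ h3
    have h5 := e.1.center_left
    have p1 := center_parity t h3
    have p2 := center_parity e e.1.col_left
    rcases (by omega : t.1.center (e.1.left + 1) = e.1.center (e.1.left + 1) ∨
      e.1.center (e.1.left + 1) < t.1.center (e.1.left + 1)) with h6 | h6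
    · rw [eq_of_center_eq h3 e.1.col_left h6] at ht
      exact absurd ht.1 (lt_irrefl _)
    · have := (extent_of_center_lt e.1.col_left h3 h6).1
      have := ht.1
      omega
  · unfold DyckTile.Col at *
    have := t.1.center_right
    rw [show t.1.right - 1 = e.1.left by omega] at this
    omega

lemma visible_right (e : D.Crossing) : D.Visible e.1.right e.1.level := by
  have h1 := e.1.left_add_two_le_right
  have h2 := right_le e
  refine ⟨by omega, lower_right_le e, level_le_upper e (by omega) le_rfl, right_parity e,
    fun t ht h => ?_⟩
  by_cases h3 : t.1.Col (e.1.right - 1)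
  · have h4 := h3.center_succ (by rwa [show e.1.right - 1 + 1 = e.1.right by omega])
    rw [show e.1.right - 1 + 1 = e.1.right by omega] at h4
    have h5 := e.1.center_right
    have p1 := center_parity t h3
    have p2 := center_parity e e.1.col_right
    rcases (by omega : t.1.center (e.1.right - 1) = e.1.center (e.1.right - 1) ∨
      e.1.center (e.1.right - 1) < t.1.center (e.1.right - 1)) with h6 | h6
    · rw [eq_of_center_eq h3 e.1.col_right h6] at ht
      exact absurd ht.2 (lt_irrefl _)
    · have := (extent_of_center_lt e.1.col_right h3 h6).2
      have := ht.2
      omega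
  · unfold DyckTile.Col at *
    have := t.1.center_left
    rw [show t.1.left + 1 = e.1.right by omega] at this
    omega

/-- A point just below a lowest box of a tile. -/
lemma visible_bottom (e : D.Crossing) {x : ℕ} (hx : e.1.Col x) (h : e.1.center x = e.1.level) :
    D.Visible x (e.1.level - 1) := by
  have h1 := lower_lt_center e hx
  have h2 := level_lt_upper e hx
  have h3 := center_parity e hx
  refine ⟨(col_lt e hx).le, by omega, by omega, by omega, fun t ht h4 => ?_⟩
  by_contra h5
  have := center_lt_of_level_lt ht hx (by omega)
  omega

lemma visible_top (e : D.Crossing) {x : ℕ} (hx : e.1.Col x) (h : e.1.center x = e.1.level) :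
    D.Visible x (e.1.level + 1) := by
  have h1 := lower_lt_center e hx
  have h2 := level_lt_upper e hx
  have h3 := center_parity e hx
  refine ⟨(col_lt e hx).le, by omega, by omega, by omega, fun t ht h4 => ?_⟩
  have := level_lt_of_center_lt hx ht (by omega)
  omega

lemma Visible.below {x x' : ℕ} {y : ℤ} (hx' : x' ≤ 2 * n)
    (h : dyckHeight D.lower x = y) (h' : dyckHeight D.lower x' = y)
    (hm : ∀ m, x ⊓ x' ≤ m → m ≤ x ⊔ x' → y ≤ dyckHeight D.lower m) (hv : D.Visible x y) :
    D.Visible x' y := by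
  refine ⟨hx', h'.le, h' ▸ D.lower_le_upper x', h' ▸ D.lower_parity hx', fun t ht h1 => ?_⟩
  by_contra h2
  have key : ∀ m, t.1.Col m → t.1.center m = t.1.level → x ⊓ x' ≤ m → m ≤ x ⊔ x' → False := by
    intro m h3 h4 h5 h6
    have := lower_lt_center t h3
    have := hm m h5 h6
    omega
  have h3 : ¬ x ⊓ x' ≤ t.1.left + 1 := fun h => key _ t.1.col_left t.1.center_left h
    (by unfold DyckTile.Col at ht; omega)
  have h4 : ¬ t.1.right - 1 ≤ x ⊔ x' := fun h => key _ t.1.col_right t.1.center_right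
    (by unfold DyckTile.Col at ht; omega) h
  have h5 : t.1.Col x := by
    unfold DyckTile.Col at *
    omega
  have := lower_lt_center t h5
  have := hv.2.2.2.2 t h5 (by omega)
  omega

lemma Visible.above (s : D.Crossing) {x x' : ℕ} {y : ℤ} (hx : s.1.Col x) (hx' : s.1.Col x')
    (h : s.1.center x + 1 = y) (h' : s.1.center x' + 1 = y)
    (hm : ∀ m, x ⊓ x' ≤ m → m ≤ x ⊔ x' → y ≤ s.1.center m + 1) (hv : D.Visible x y) :
    D.Visible x' y := by
  have p := center_parity s hx'
  have p1 := lower_lt_center s hx'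
  have p2 := center_lt_upper s hx'
  refine ⟨(col_lt s hx').le, by omega, by omega, by omega, fun t ht h1 => ?_⟩
  by_contra h2
  have key : ∀ m, t.1.Col m → t.1.center m = t.1.level → x ⊓ x' ≤ m → m ≤ x ⊔ x' → False := by
    intro m h3 h4 h5 h6
    have h8 : s.1.Col m := by
      unfold DyckTile.Col at *
      omega
    have := level_lt_of_center_lt hx' ht (by omega)
    have := center_lt_of_level_lt h8 h3 (by omega)
    have := hm m h5 h6
    omega
  have h3 : ¬ x ⊓ x' ≤ t.1.left + 1 := fun h => key _ t.1.col_left t.1.center_left h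
    (by unfold DyckTile.Col at ht; omega)
  have h4 : ¬ t.1.right - 1 ≤ x ⊔ x' := fun h => key _ t.1.col_right t.1.center_right
    (by unfold DyckTile.Col at ht; omega) h
  have h5 : t.1.Col x := by
    unfold DyckTile.Col at *
    omega
  have := level_lt_of_center_lt hx' ht (by omega)
  have := center_lt_of_level_lt hx h5 (by omega)
  have := hv.2.2.2.2 t h5 (by omega)
  omega

lemma visible_of_sameCell {p q : ℕ × ℤ} (h : D.SameCell p q) :
    D.Visible p.1 p.2 ↔ D.Visible q.1 q.2 := by
  cases h with
  | below x x' hx hx' h hm =>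
    constructor
    · refine fun hv => h ▸ Visible.below hx' rfl h.symm (fun m h1 h2 => ?_) hv
      exact hm m (by omega) (by omega)
    · refine fun hv => h ▸ Visible.below (by omega) rfl h (fun m h1 h2 => ?_) hv
      exact h ▸ hm m (by omega) (by omega)
  | above t ht i j hij hj h hm =>
    have hm' : ∀ m, t.left + 1 + i ≤ m → m ≤ t.left + 1 + j →
        t.level + dyckHeight t.path i + 1 ≤ t.center m + 1 := by
      intro m h1 h2
      have h3 := hm (m - (t.left + 1)) (by omega) (by omega)
      unfold DyckTile.center
      omega
    have hi := col_add (t := t) (hij.trans hj)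
    have hj' := col_add (t := t) hj
    constructor
    · refine fun hv => Visible.above ⟨t, ht⟩ hi hj' ?_ ?_ (fun m h1 h2 => ?_) (h ▸ hv)
      · simp only [center_eq, h]
      · simp only [center_eq]
      · have := hm' m (by simp only at h1 h2; omega) (by simp only at h1 h2; omega)
        simp only at this ⊢
        omega
    · refine fun hv => Visible.above ⟨t, ht⟩ hj' hi ?_ ?_ (fun m h1 h2 => ?_) (h ▸ hv)
      · simp only [center_eq, h]
      · simp only [center_eq]
      · have := hm' m (by simp only at h1 h2; omega) (by simp only at h1 h2; omega)
        simp only at this ⊢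
        omega
  | bottom t ht i j hi hj h h' =>
    refine iff_of_true ?_ ?_
    · exact visible_bottom ⟨t, ht⟩ (col_add hi) (by simp only [center_eq]; omega)
    · exact visible_bottom ⟨t, ht⟩ (col_add hj) (by simp only [center_eq]; omega)

/-! ### The left and right ends of a cell -/

lemma sameCell_above (t : D.Crossing) {x x' : ℕ} {y : ℤ} (hx : t.1.Col x) (hx' : t.1.Col x')
    (hxx : x ≤ x') (h : t.1.center x + 1 = y) (h' : t.1.center x' + 1 = y)
    (hm : ∀ m, x ≤ m → m ≤ x' → y ≤ t.1.center m + 1) : D.SameCell (x, y) (x', y) := by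
  unfold DyckTile.Col DyckTile.right at hx hx'
  unfold DyckTile.center at h h' hm
  have := SameCell.above (D := D) t.1 t.2 (x - (t.1.left + 1)) (x' - (t.1.left + 1)) (by omega)
    (by omega) (by omega) (fun m h1 h2 => by
      have := hm (t.1.left + 1 + m) (by omega) (by omega)
      rw [show t.1.left + 1 + m - (t.1.left + 1) = m by omega] at this
      omega)
  rwa [h, h', show t.1.left + 1 + (x - (t.1.left + 1)) = x by omega,
    show t.1.left + 1 + (x' - (t.1.left + 1)) = x' by omega] at this

lemma cell_topRight (e : D.Crossing) :
    D.cell (e.1.right - 1, e.1.level + 1) = D.cell e.1.topLeftPoint := by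
  have := e.1.left_add_two_le_right
  refine (Quot.sound (sameCell_above e e.1.col_left e.1.col_right (by omega) (by
    rw [e.1.center_left]) (by rw [e.1.center_right]) fun m _ _ => ?_)).symm
  have := e.1.level_le_center m
  omega

lemma cell_bottomRight (e : D.Crossing) :
    D.cell (e.1.right - 1, e.1.level - 1) = D.cell e.1.bottomLeftPoint := by
  have := SameCell.bottom (D := D) e.1 e.2 0 e.1.steps (by omega) le_rfl (dyckHeight_zero _)
    (dyckHeight_of_length_le _ le_rfl)
  refine (Quot.sound (?_ : D.SameCell e.1.bottomLeftPoint _)).symm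
  unfold DyckTile.right
  rwa [show e.1.left + e.1.steps + 2 - 1 = e.1.left + 1 + e.1.steps by omega]

lemma cell_end (D : DyckTiling n) : D.cell (0, 0) = D.cell (2 * n, 0) := by
  have := SameCell.below (D := D) 0 (2 * n) (by omega) le_rfl
    (by rw [dyckHeight_zero, D.lower_end])
    (fun m _ _ => by rw [dyckHeight_zero]; exact dyckHeight_nonneg _ _)
  rw [dyckHeight_zero, D.lower_end] at this
  exact Quot.sound this

/-- One step to the left along a cell. -/
lemma exists_left {x : ℕ} {y : ℤ} (h : D.Visible x y) : y = dyckHeight D.upper x ∨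
    (∃ e : D.Crossing, e.1.right = x ∧ e.1.level = y) ∨ ∃ x' < x, D.SameCell (x', y) (x, y) := by
  obtain ⟨h1, h2, h3, h4, h5⟩ := h
  by_cases h6 : y = dyckHeight D.upper x
  · exact Or.inl h6
  right
  have h7 := D.upper_parity h1
  obtain _ | x := x
  · rw [dyckHeight_zero] at *
    omega
  have h8 := D.upper_succ (x := x) (by omega)
  have h9 := D.lower_succ (x := x) (by omega)
  have h10 := D.lower_parity (x := x) (by omega)
  push_cast at h4 h7
  by_cases h11 : y < dyckHeight D.lower x
  · right
    obtain ⟨i, hi, hi', hm⟩ := exists_last_eq (f := dyckHeight D.lower) (y := y) (m := x)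
      (by rw [dyckHeight_zero]; have := dyckHeight_nonneg D.lower (x + 1); omega) h11.le
      (fun i hi => by have := D.lower_succ (x := i) (by omega); omega)
    refine ⟨i, by omega, ?_⟩
    have := SameCell.below (D := D) i (x + 1) (by omega) h1 (by omega) (fun m h12 h13 => by
      rcases Nat.lt_or_ge m (x + 1) with h14 | h14
      · rw [hi']; exact hm m h12 (by omega)
      · rw [show m = x + 1 by omega]; omega)
    rwa [hi', show dyckHeight D.lower (x + 1) = y by omega] at this
  · obtain ⟨s, hs, hc⟩ := exists_crossing (D := D) (x := x) (y := y) (by omega) (by omega)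
      (by omega)
    have h12 := s.1.level_le_center x
    by_cases h13 : s.1.right = x + 1
    · have := s.1.center_right
      rw [h13, Nat.add_sub_cancel] at this
      exact Or.inl ⟨s, h13, by omega⟩
    right
    have h14 : s.1.Col (x + 1) := by
      unfold DyckTile.Col at *
      omega
    rcases hs.center_succ h14 with h15 | h15
    · have := h5 s h14 (by omega)
      omega
    · obtain ⟨i, hi, hi', hm⟩ := exists_last_eq (f := fun i => s.1.center (s.1.left + 1 + i))
        (y := y - 1) (m := x - (s.1.left + 1))
        (by
          have := s.1.level_le_center (x + 1)
          simp only [add_zero, s.1.center_left]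
          omega)
        (by
          rw [show s.1.left + 1 + (x - (s.1.left + 1)) = x by have := hs.1; omega]
          omega)
        (fun i hi => by
          have := DyckTile.Col.center_succ (t := s.1) (x := s.1.left + 1 + i)
            ⟨by omega, by have := hs.2; omega⟩ ⟨by omega, by have := hs.2; omega⟩
          simp only [← add_assoc]
          omega)
      have hs1 := hs.1
      have hs2 := hs.2
      refine ⟨s.1.left + 1 + i, by omega, sameCell_above s ⟨by omega, by omega⟩ h14 (by omega)
        (by omega) (by omega) fun m h16 h17 => ?_⟩
      rcases Nat.lt_or_ge m (x + 1) with h18 | h18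
      · have := hm (m - (s.1.left + 1)) (by omega) (by omega)
        rw [show s.1.left + 1 + (m - (s.1.left + 1)) = m by omega] at this
        omega
      · rw [show m = x + 1 by omega]; omega

/-- One step to the right along a cell. -/
lemma exists_right {x : ℕ} {y : ℤ} (h : D.Visible x y) : y = dyckHeight D.upper x ∨
    (∃ e : D.Crossing, e.1.left = x ∧ e.1.level = y) ∨
      ∃ x', x < x' ∧ D.SameCell (x, y) (x', y) := by
  obtain ⟨h1, h2, h3, h4, h5⟩ := h
  by_cases h6 : y = dyckHeight D.upper x
  · exact Or.inl h6
  right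
  have h7 := D.upper_parity h1
  have h0 : x < 2 * n := by
    by_contra h
    obtain rfl : x = 2 * n := by omega
    rw [D.upper_end] at h3 h6
    rw [D.lower_end] at h2
    omega
  have h8 := D.upper_succ (x := x) (by omega)
  have h9 := D.lower_succ (x := x) (by omega)
  have h10 := D.lower_parity (x := x) (by omega)
  have h10' := D.lower_parity (x := x + 1) (by omega)
  push_cast at h10'
  by_cases h11 : y < dyckHeight D.lower (x + 1)
  · right
    obtain ⟨i, hi, hi', hi'', hm⟩ := exists_first_eq (f := dyckHeight D.lower) (y := y)
      (m := x + 1) (N := 2 * n) (by omega)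
      (by rw [D.lower_end]; have := dyckHeight_nonneg D.lower x; omega) h11.le
      (fun i hi hi' => by have := D.lower_succ (x := i) (by omega); omega)
    refine ⟨i, by omega, ?_⟩
    have := SameCell.below (D := D) x i (by omega) hi' (by omega) (fun m h12 h13 => by
      rcases Nat.lt_or_ge x m with h14 | h14
      · rw [show dyckHeight D.lower x = y by omega]; exact hm m (by omega) h13
      · rw [show m = x by omega])
    rwa [hi'', show dyckHeight D.lower x = y by omega] at this
  · obtain ⟨s, hs, hc⟩ := exists_crossing (D := D) (x := x + 1) (y := y) (by omega) (by omega)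
      (by push_cast; omega)
    have h12 := s.1.level_le_center (x + 1)
    by_cases h13 : s.1.left = x
    · have := s.1.center_left
      rw [h13] at this
      exact Or.inl ⟨s, h13, by omega⟩
    right
    have h14 : s.1.Col x := by
      unfold DyckTile.Col at *
      omega
    rcases h14.center_succ hs with h15 | h15
    · have hs1 := hs.1
      have hs2 := hs.2
      obtain ⟨i, hi, hi', hi'', hm⟩ := exists_first_eq (f := s.1.center)
        (y := y - 1) (m := x + 1) (N := s.1.right - 1) (by omega)
        (by
          have := s.1.level_le_center x
          rw [s.1.center_right]
          omega)
        (by omega)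
        (fun i hi hi' => by
          have := DyckTile.Col.center_succ (t := s.1) (x := i)
            ⟨by omega, by omega⟩ ⟨by omega, by omega⟩
          omega)
      refine ⟨i, by omega, sameCell_above s h14 ⟨by omega, by omega⟩ (by omega)
        (by omega) (by omega) fun m h16 h17 => ?_⟩
      rcases Nat.lt_or_ge x m with h18 | h18
      · have := hm m (by omega) (by omega)
        omega
      · rw [show m = x by omega]; omega
    · have := h5 s h14 (by omega)
      omega

variable (D) in
/-- A cell that touches the boundary of the disk between two stubs. -/
def IsBoundaryCell (v : Quot D.SameCell) : Prop :=
  ∃ x ≤ 2 * n, v = D.cell (x, dyckHeight D.upper x)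

/-- A cell ends on the left at the boundary or at a crossing. -/
lemma left_end {x : ℕ} {y : ℤ} (h : D.Visible x y) :
    D.IsBoundaryCell (D.cell (x, y)) ∨ ∃ e : D.Crossing, D.cell e.1.rightPoint = D.cell (x, y) := by
  induction x using Nat.strong_induction_on with
  | _ x ih =>
    rcases exists_left h with h1 | ⟨e, h1, h2⟩ | ⟨x', h1, h2⟩
    · exact Or.inl ⟨x, h.1, by rw [h1]⟩
    · exact Or.inr ⟨e, by rw [DyckTile.rightPoint, h1, h2]⟩
    · rw [show D.cell (x, y) = D.cell (x', y) from (Quot.sound h2).symm]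
      exact ih x' h1 ((visible_of_sameCell h2).2 h)

/-- A cell ends on the right at the boundary or at a crossing. -/
lemma right_end {x : ℕ} {y : ℤ} (h : D.Visible x y) :
    D.IsBoundaryCell (D.cell (x, y)) ∨ ∃ e : D.Crossing, D.cell e.1.leftPoint = D.cell (x, y) := by
  obtain ⟨k, hk⟩ : ∃ k, 2 * n - x = k := ⟨_, rfl⟩
  induction k using Nat.strong_induction_on generalizing x with
  | _ k ih =>
    rcases exists_right h with h1 | ⟨e, h1, h2⟩ | ⟨x', h1, h2⟩
    · exact Or.inl ⟨x, h.1, by rw [h1]⟩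
    · exact Or.inr ⟨e, by rw [DyckTile.leftPoint, h1, h2]⟩
    · rw [show D.cell (x, y) = D.cell (x', y) from Quot.sound h2]
      have h3 := (visible_of_sameCell h2).1 h
      have := h3.1
      simp only at this
      exact ih _ (by omega) h3 rfl

/-! ### Colors -/

/-- The parity of the coordinates of the points in the cells of a color. -/
def _root_.CellColor.parity : CellColor → ℤ
  | CellColor.blue => 1
  | CellColor.red => 0

lemma horizontalColor_eq_iff (e : D.Crossing) (col : CellColor) :
    e.1.horizontalColor = col ↔ e.1.level % 2 = col.parity := by
  have h := left_parity e
  unfold DyckTile.horizontalColor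
  split_ifs with h1
  · rw [Nat.odd_iff] at h1
    cases col <;> simp [CellColor.parity] <;> omega
  · rw [Nat.not_odd_iff] at h1
    cases col <;> simp [CellColor.parity] <;> omega

lemma parity_cases (col : CellColor) (y : ℤ) : y % 2 = col.parity ∨ (y + 1) % 2 = col.parity := by
  cases col <;> simp only [CellColor.parity] <;> omega

/-- Every cell of the given color contains a point of an actual cell, of the parity of the color. -/
lemma exists_visible {col : CellColor} {v : Quot D.SameCell} (hv : D.IsCellOfColor col v) :
    ∃ x y, D.Visible x y ∧ v = D.cell (x, y) ∧ y % 2 = col.parity := by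
  rcases hv with ⟨i, rfl⟩ | ⟨e, he⟩
  · have hi := i.2
    cases col
    · refine ⟨_, _, visible_upper (by omega), rfl, ?_⟩
      have := D.upper_parity (x := 2 * (i : ℕ) + 1) (by omega)
      push_cast at this
      simp only [CellColor.parity]
      omega
    · refine ⟨_, _, visible_upper (by omega), rfl, ?_⟩
      have := D.upper_parity (x := 2 * (i : ℕ) + 2) (by omega)
      push_cast at this
      simp only [CellColor.parity]
      omega
  · unfold endCells at he
    split_ifs at he with hcol
    · rw [horizontalColor_eq_iff] at hcol
      rcases he with rfl | rfl
      · exact ⟨_, _, visible_left e, rfl, hcol⟩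
      · exact ⟨_, _, visible_right e, rfl, hcol⟩
    · rw [horizontalColor_eq_iff] at hcol
      have hcol' : (e.1.level + 1) % 2 = col.parity := (parity_cases col _).resolve_left hcol
      rcases he with rfl | rfl
      · exact ⟨_, _, visible_bottom e e.1.col_left e.1.center_left, rfl, by omega⟩
      · exact ⟨_, _, visible_top e e.1.col_left e.1.center_left, rfl, hcol'⟩

lemma exists_node {col : CellColor} {v : Quot D.SameCell} (hn : 0 < n) (hv : D.IsCellOfColor col v)
    (h : D.IsBoundaryCell v) : ∃ i, v = D.nodeCell col i := by
  obtain ⟨x', y', -, rfl, hp⟩ := exists_visible hv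
  obtain ⟨x, hx, h⟩ := h
  have h0 := row_eq_of_cell_eq h
  have h1 := D.upper_parity hx
  simp only at h0
  rw [h]
  cases col
  · simp only [CellColor.parity] at hp
    refine ⟨⟨x / 2, by omega⟩, ?_⟩
    simp only [nodeCell]
    rw [show 2 * (x / 2) + 1 = x by omega]
  · simp only [CellColor.parity] at hp
    by_cases h0 : x = 0
    · refine ⟨⟨n - 1, by omega⟩, ?_⟩
      simp only [nodeCell]
      rw [show 2 * (n - 1) + 2 = 2 * n by omega, h0, dyckHeight_zero, D.upper_end, cell_end]
    · refine ⟨⟨x / 2 - 1, by omega⟩, ?_⟩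
      simp only [nodeCell]
      rw [show 2 * (x / 2 - 1) + 2 = x by omega]

end DyckTiling

/-! ### A criterion for a grove to be determined by its partition -/

namespace NodedGraph

variable {n : ℕ} {G : NodedGraph n}

lemma Connected.mono {T T' : Set G.Edge} (h : T ⊆ T') {u v : G.Vertex} (huv : G.Connected T u v) :
    G.Connected T' u v :=
  Relation.EqvGen.mono (fun _ _ ⟨e, he, h'⟩ => ⟨e, h he, h'⟩) u v huv

lemma Connected.symm {T : Set G.Edge} {u v : G.Vertex} (h : G.Connected T u v) :
    G.Connected T v u := Relation.EqvGen.symm _ _ h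

lemma Connected.trans {T : Set G.Edge} {u v w : G.Vertex} (h : G.Connected T u v)
    (h' : G.Connected T v w) : G.Connected T u w := Relation.EqvGen.trans _ _ _ h h'

lemma Connected.of_edge {T : Set G.Edge} {e : G.Edge} (he : e ∈ T) {u v : G.Vertex}
    (h : G.ends e = s(u, v)) : G.Connected T u v := Relation.EqvGen.rel _ _ ⟨e, he, h⟩

/-- A property of vertices that is invariant along the edges of `T` is invariant under
connectedness. -/
lemma Connected.invariant {T : Set G.Edge} {p : G.Vertex → Prop}
    (hp : ∀ e ∈ T, ∀ u v, G.ends e = s(u, v) → p u → p v) {u v : G.Vertex}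
    (h : G.Connected T u v) : p u ↔ p v := by
  induction h with
  | rel u v h =>
    obtain ⟨e, he, h⟩ := h
    exact ⟨hp e he u v h, hp e he v u (h.trans Sym2.eq_swap)⟩
  | refl u => exact Iff.rfl
  | symm u v _ ih => exact ih.symm
  | trans u v w _ _ ih ih' => exact ih.trans ih'

/-- A node sits at the vertex. -/
def IsNode (v : G.Vertex) : Prop := ∃ i, v = G.node i

/-- A way to see that a set `R` of edges is a grove, and that it is the only grove with its
partition. The edges of `R` are oriented, from `near` to `far`, and all edges are ranked, such that
an edge of `R` has the highest rank among all edges at its near end. So each vertex has at most one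
outgoing edge, ranks increase along oriented paths, and once the edges of smaller rank are known,
the component of the near end of an edge is known up to that edge. -/
structure Certificate (G : NodedGraph n) (R : Set G.Edge) where
  /-- The end from which an edge of `R` goes out. -/
  near : G.Edge → G.Vertex
  /-- The end into which an edge of `R` goes. -/
  far : G.Edge → G.Vertex
  /-- The rank of an edge. -/
  rank : G.Edge → ℕ ×ₗ ℕ
  /-- A label that is constant on the components of `R`. -/
  label : G.Vertex → ℤ × ℤ
  ends_eq : ∀ e ∈ R, G.ends e = s(near e, far e)
  near_ne_far : ∀ e ∈ R, near e ≠ far e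
  rank_lt : ∀ e ∈ R, ∀ e', e' ≠ e → near e ∈ G.ends e' → rank e' < rank e
  /-- A vertex at which no node sits has an edge that goes in, and another edge that goes in or
  out. -/
  degree : ∀ v, G.IsNode v ∨ (∃ e ∈ R, ∃ f ∈ R, near e = v ∧ far f = v) ∨
    ∃ f ∈ R, ∃ f' ∈ R, f ≠ f' ∧ far f = v ∧ far f' = v
  /-- The ends of an edge outside `R` are joined to nodes by edges of smaller rank. -/
  leaf : ∀ e ∉ R, ∀ u ∈ G.ends e, G.IsNode u ∨ ∃ f ∈ R, far f = u ∧ rank f < rank e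
  label_eq : ∀ e ∈ R, label (near e) = label (far e)
  label_ne : ∀ e ∉ R, ∀ u v, G.ends e = s(u, v) → label u ≠ label v

namespace Certificate

variable {R : Set G.Edge} (K : Certificate G R)

lemma near_mem {e : G.Edge} (he : e ∈ R) : K.near e ∈ G.ends e := by
  rw [K.ends_eq e he]; exact Sym2.mem_mk_left _ _

lemma far_mem {e : G.Edge} (he : e ∈ R) : K.far e ∈ G.ends e := by
  rw [K.ends_eq e he]; exact Sym2.mem_mk_right _ _

lemma near_injective {e f : G.Edge} (he : e ∈ R) (hf : f ∈ R) (h : K.near e = K.near f) :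
    e = f := by
  by_contra hne
  have h1 := K.rank_lt e he f (Ne.symm hne) (h ▸ K.near_mem hf)
  have h2 := K.rank_lt f hf e hne (h ▸ K.near_mem he)
  exact lt_asymm h1 h2

/-- One step along an oriented edge. -/
def Step (u v : G.Vertex) : Prop := ∃ f ∈ R, K.near f = u ∧ K.far f = v

lemma step_unique : Relator.RightUnique K.Step := by
  rintro u v w ⟨f, hf, h1, rfl⟩ ⟨f', hf', h2, rfl⟩
  rw [K.near_injective hf hf' (h1.trans h2.symm)]

/-- The vertices from which oriented paths lead to the near end of `e`. -/
def tree (e : G.Edge) : Set G.Vertex := {u | Relation.ReflTransGen K.Step u (K.near e)}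

lemma near_mem_tree (e : G.Edge) : K.near e ∈ K.tree e := Relation.ReflTransGen.refl

lemma mem_tree_of_far {e f : G.Edge} (hf : f ∈ R) (h : K.far f ∈ K.tree e) : K.near f ∈ K.tree e :=
  Relation.ReflTransGen.head ⟨f, hf, rfl, rfl⟩ h

lemma tree_subset {e f : G.Edge} (hf : f ∈ R) (h : K.far f ∈ K.tree e) : K.tree f ⊆ K.tree e :=
  fun _ hu => Relation.ReflTransGen.trans hu (K.mem_tree_of_far hf h)

/-- All edges at vertices of the tree of `e` have smaller rank than `e`. -/
lemma rank_lt_of_mem_tree {e : G.Edge} (he : e ∈ R) {u : G.Vertex} (hu : u ∈ K.tree e)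
    {g : G.Edge} (hg : g ≠ e) (h : u ∈ G.ends g) : K.rank g < K.rank e := by
  induction hu using Relation.ReflTransGen.head_induction_on generalizing g with
  | refl => exact K.rank_lt e he g hg h
  | head hstep htail ih =>
    obtain ⟨f, hf, rfl, rfl⟩ := hstep
    have h1 : K.rank f ≤ K.rank e := by
      by_cases hfe : f = e
      · rw [hfe]
      · exact (ih hfe (K.far_mem hf)).le
    by_cases hgf : g = f
    · subst hgf
      exact ih hg (K.far_mem hf)
    · exact (K.rank_lt f hf g hgf h).trans_le h1

lemma far_notMem_tree {e : G.Edge} (he : e ∈ R) : K.far e ∉ K.tree e := by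
  intro h
  rcases Relation.ReflTransGen.cases_head h with h1 | ⟨w, ⟨f, hf, h1, h2⟩, -⟩
  · exact K.near_ne_far e he h1.symm
  · have hfe : f ≠ e := by
      rintro rfl
      exact K.near_ne_far f hf h1
    have h3 := K.rank_lt f hf e hfe.symm (h1 ▸ K.far_mem he)
    have h4 := K.rank_lt_of_mem_tree he h hfe (h1 ▸ K.near_mem hf)
    exact lt_asymm h3 h4

/-- The only edge of `R` that leaves the tree of `e` is `e`. -/
lemma mem_tree_of_edge {e g : G.Edge} (he : e ∈ R) (hg : g ∈ R) (hge : g ≠ e) {u v : G.Vertex}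
    (h : G.ends g = s(u, v)) (hu : u ∈ K.tree e) : v ∈ K.tree e := by
  rw [K.ends_eq g hg, Sym2.eq_iff] at h
  rcases h with ⟨rfl, rfl⟩ | ⟨rfl, rfl⟩
  · rcases Relation.ReflTransGen.cases_head hu with h1 | ⟨w, ⟨f, hf, h1, rfl⟩, h3⟩
    · exact absurd (K.near_injective hg he h1) hge
    · rwa [← K.near_injective hf hg h1]
  · exact K.mem_tree_of_far hg hu

lemma connected_of_mem_tree {e : G.Edge} {u : G.Vertex} (hu : u ∈ K.tree e) :
    G.Connected R u (K.near e) := by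
  induction hu using Relation.ReflTransGen.head_induction_on with
  | refl => exact Relation.EqvGen.refl _
  | head hstep _ ih =>
    obtain ⟨f, hf, rfl, rfl⟩ := hstep
    exact (Connected.of_edge hf (K.ends_eq f hf)).trans ih

/-- The tree of `e` contains a node, which is joined to the near end of `e` by edges of smaller
rank. -/
lemma exists_node_mem_tree {e : G.Edge} (he : e ∈ R) : ∃ i, G.node i ∈ K.tree e ∧
    G.Connected {f | f ∈ R ∧ K.rank f < K.rank e} (G.node i) (K.near e) := by
  induction h : K.rank e using WellFoundedLT.induction generalizing e with
  | _ r ih =>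
    subst h
    have key : ∀ f ∈ R, K.far f = K.near e → ∃ i, G.node i ∈ K.tree e ∧
        G.Connected {f | f ∈ R ∧ K.rank f < K.rank e} (G.node i) (K.near e) := by
      intro f hf h
      have hfe : f ≠ e := by
        rintro rfl
        exact K.near_ne_far f hf h.symm
      have h1 := K.rank_lt e he f hfe (h ▸ K.far_mem hf)
      obtain ⟨i, hi, hi'⟩ := ih _ h1 hf rfl
      have h2 : G.ends f = s(K.near f, K.near e) := by rw [K.ends_eq f hf, h]
      have h3 : G.Connected {g | g ∈ R ∧ K.rank g < K.rank e} (K.near f) (K.near e) :=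
        Connected.of_edge (And.intro hf h1) h2
      exact ⟨i, K.tree_subset hf (h ▸ K.near_mem_tree e) hi,
        Connected.trans (hi'.mono fun g hg => And.intro hg.1 (hg.2.trans h1)) h3⟩
    rcases K.degree (K.near e) with ⟨i, hi⟩ | ⟨_, _, f, hf, -, h⟩ | ⟨f, hf, _, _, _, h, _⟩
    · exact ⟨i, hi ▸ K.near_mem_tree e, hi ▸ Relation.EqvGen.refl _⟩
    · exact key f hf h
    · exact key f hf h

lemma exists_node_connected (K : Certificate G R) (v : G.Vertex) :
    ∃ i, G.Connected R v (G.node i) := by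
  have key : ∀ f ∈ R, K.far f = v → ∃ i, G.Connected R v (G.node i) := by
    intro f hf h
    obtain ⟨i, hi, -⟩ := K.exists_node_mem_tree hf
    refine ⟨i, ?_⟩
    rw [← h]
    exact ((K.connected_of_mem_tree hi).trans (Connected.of_edge hf (K.ends_eq f hf))).symm
  rcases K.degree v with ⟨i, hi⟩ | ⟨_, _, f, hf, -, h⟩ | ⟨f, hf, _, _, _, h, _⟩
  · exact ⟨i, hi ▸ Relation.EqvGen.refl _⟩
  · exact key f hf h
  · exact key f hf h

/-- There is also a node in the component of the far end of `e`, outside the tree of `e`. -/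
lemma exists_node_notMem_tree {e : G.Edge} (he : e ∈ R) :
    ∃ i, G.node i ∉ K.tree e ∧ G.Connected R (K.far e) (G.node i) := by
  have wf : WellFounded fun e f : G.Edge => K.rank f < K.rank e :=
    haveI : IsTrans G.Edge fun e f => K.rank f < K.rank e := ⟨fun _ _ _ h h' => h'.trans h⟩
    haveI : Std.Irrefl fun e f : G.Edge => K.rank f < K.rank e := ⟨fun _ => lt_irrefl _⟩
    Finite.wellFounded_of_trans_of_irrefl _
  induction e using wf.induction with
  | _ e ih =>
    rcases K.degree (K.far e) with ⟨i, hi⟩ | ⟨f, hf, _, _, h, _⟩ | ⟨f, hf, f', hf', hff, h, h'⟩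
    · exact ⟨i, hi ▸ K.far_notMem_tree he, hi ▸ Relation.EqvGen.refl _⟩
    · have hfe : f ≠ e := by
        rintro rfl
        exact K.near_ne_far f hf h
      have h1 := K.rank_lt f hf e hfe.symm (h ▸ K.far_mem he)
      obtain ⟨i, hi, hi'⟩ := ih f h1 hf
      refine ⟨i, fun h2 => hi (K.tree_subset he (h ▸ K.near_mem_tree f) h2), ?_⟩
      exact (h ▸ Connected.of_edge hf (K.ends_eq f hf)).trans hi'
    · obtain ⟨g, hg, hge, hgv⟩ : ∃ g ∈ R, g ≠ e ∧ K.far g = K.far e := by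
        by_cases hfe : f = e
        · exact ⟨f', hf', fun h2 => hff (hfe.trans h2.symm), h'⟩
        · exact ⟨f, hf, hfe, h⟩
      obtain ⟨i, hi, -⟩ := K.exists_node_mem_tree hg
      refine ⟨i, fun h2 => ?_, ?_⟩
      · rcases Relation.ReflTransGen.total_of_right_unique K.step_unique hi h2 with h3 | h3
        · exact K.far_notMem_tree he
            (hgv ▸ K.mem_tree_of_edge he hg hge (K.ends_eq g hg) h3)
        · exact K.far_notMem_tree hg
            (hgv ▸ K.mem_tree_of_edge hg he hge.symm (K.ends_eq e he) h3)
      · rw [← hgv]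
        exact ((K.connected_of_mem_tree hi).trans (Connected.of_edge hg (K.ends_eq g hg))).symm

lemma label_eq_of_connected {u v : G.Vertex} (h : G.Connected R u v) : K.label u = K.label v := by
  refine ((Connected.invariant (p := fun w => K.label u = K.label w) ?_ h).1 rfl)
  intro e he w w' h1 h2
  rw [K.ends_eq e he, Sym2.eq_iff] at h1
  have := K.label_eq e he
  rcases h1 with ⟨rfl, rfl⟩ | ⟨rfl, rfl⟩
  · rw [h2, this]
  · rw [h2, this]

theorem isGrove (K : Certificate G R) : G.IsGrove R := by
  refine ⟨fun e he u v h hc => ?_, K.exists_node_connected⟩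
  have key := Connected.invariant (p := (· ∈ K.tree e)) (fun g hg u v h hu =>
    K.mem_tree_of_edge he hg.1 hg.2 h hu) hc
  rw [K.ends_eq e he, Sym2.eq_iff] at h
  rcases h with ⟨rfl, rfl⟩ | ⟨rfl, rfl⟩
  · exact K.far_notMem_tree he (key.1 (K.near_mem_tree e))
  · exact K.far_notMem_tree he (key.2 (K.near_mem_tree e))

/-- A certified set of edges is the only grove with its partition: by induction on the rank, the
partition decides for each edge whether it belongs to the grove. -/
theorem eq_of_partition_eq (K : Certificate G R) {T : Set G.Edge} (hT : G.IsGrove T)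
    (h : G.partition T = G.partition R) : T = R := by
  have hp : ∀ i j, G.Connected T (G.node i) (G.node j) ↔ G.Connected R (G.node i) (G.node j) :=
    fun i j => Setoid.ext_iff.1 h i j
  ext e
  induction h : K.rank e using WellFoundedLT.induction generalizing e with
  | _ r ih =>
    subst h
    constructor
    · intro heT
      by_contra heR
      -- The ends of `e` are already joined to nodes of different blocks.
      have key : ∀ u ∈ G.ends e, ∃ i, G.Connected T u (G.node i) ∧ G.Connected R u (G.node i) := by
        intro u hu
        rcases K.leaf e heR u hu with ⟨i, hi⟩ | ⟨f, hf, rfl, hr⟩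
        · exact ⟨i, hi ▸ Relation.EqvGen.refl _, hi ▸ Relation.EqvGen.refl _⟩
        · obtain ⟨i, -, hi⟩ := K.exists_node_mem_tree hf
          have h0 : G.Connected {g | g ∈ R ∧ K.rank g < K.rank e} (K.near f) (K.far f) :=
            Connected.of_edge (And.intro hf hr) (K.ends_eq f hf)
          have h1 : G.Connected {g | g ∈ R ∧ K.rank g < K.rank e} (G.node i) (K.far f) :=
            Connected.trans (hi.mono fun g hg => And.intro hg.1 (hg.2.trans hr)) h0
          exact ⟨i, (h1.mono fun g hg => (ih _ hg.2 g rfl).2 hg.1).symm,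
            (h1.mono fun g hg => hg.1).symm⟩
      induction hs : G.ends e with
      | _ u v =>
        obtain ⟨i, hi, hi'⟩ := key u (hs ▸ Sym2.mem_mk_left u v)
        obtain ⟨j, hj, hj'⟩ := key v (hs ▸ Sym2.mem_mk_right u v)
        have h1 := (hp i j).1 ((hi.symm.trans (Connected.of_edge heT hs)).trans hj)
        exact K.label_ne e heR u v hs
          (K.label_eq_of_connected ((hi'.trans h1).trans hj'.symm))
    · intro heR
      by_contra heT
      -- Without `e`, the component of its near end is confined to its tree.
      have key : ∀ {u v}, G.Connected T u v → (u ∈ K.tree e ↔ v ∈ K.tree e) := by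
        refine fun hc => Connected.invariant (p := (· ∈ K.tree e)) (fun g hg u v h hu => ?_) hc
        have hge : g ≠ e := fun hge => heT (hge ▸ hg)
        have h1 := K.rank_lt_of_mem_tree heR hu hge (h ▸ Sym2.mem_mk_left u v)
        exact K.mem_tree_of_edge heR ((ih _ h1 g rfl).1 hg) hge h hu
      obtain ⟨i, hi⟩ := hT.2 (K.near e)
      have h1 := (key hi).1 (K.near_mem_tree e)
      obtain ⟨j, hj, hj'⟩ := K.exists_node_notMem_tree heR
      have h2 := (hp i j).2 (((K.connected_of_mem_tree h1).trans
        (Connected.of_edge heR (K.ends_eq e heR))).trans hj')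
      exact hj ((key h2).1 h1)

open Classical in
/-- The partition sum of a certified set of edges is a single product of conductances. -/
theorem partitionSum_eq (K : Certificate G R) (c : G.Edge → ℝ) :
    G.partitionSum c (G.partition R) = ∏ e : G.Edge with e ∈ R, c e := by
  unfold partitionSum
  -- The sum ranges over the sets of edges that underlie finsets, each of them once.
  rw [Finset.sum_eq_single R]
  · refine Finset.prod_congr ?_ fun _ _ => rfl
    ext e
    simp
  · intro T hT hne
    rw [Finset.mem_filter] at hT
    exact absurd (K.eq_of_partition_eq hT.2.1 hT.2.2) hne
  · intro h
    refine absurd (Finset.mem_filter.2 ⟨?_, K.isGrove, rfl⟩) h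
    simp only [Finset.bind_def, Finset.pure_def, Finset.mem_sup]
    exact ⟨R.toFinset, Finset.mem_univ _, by simp⟩

end Certificate

end NodedGraph

/-! ### The shape of a comb -/

namespace DyckTiling

variable {n : ℕ} {D : DyckTiling n}

variable (D) in
/-- The spine of a comb (empty for the exterior partition). -/
def spine : Option D.Crossing → Set D.Crossing
  | some e => {s | Relation.ReflTransGen D.UpLeft e s}
  | none => ∅

variable (D) in
/-- The tooth that starts at `s` contains `t`. -/
def Tooth (s t : D.Crossing) : Prop := Relation.ReflTransGen D.UpRight s t

variable (D) in
/-- The column of the left-most point of the crossing at which a comb starts; for the exterior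
partition, the last column of the diagram. -/
def tipCol : Option D.Crossing → ℕ
  | some e => e.1.left
  | none => 2 * n

variable (D) in
/-- The level of the crossing at which a comb starts (`0` for the exterior partition). -/
def tipLevel : Option D.Crossing → ℤ
  | some e => e.1.level
  | none => 0

variable {o : Option D.Crossing}

lemma mem_comb {t : D.Crossing} : t ∈ D.combOrEmpty o ↔ ∃ s ∈ D.spine o, D.Tooth s t := by
  cases o with
  | none => simp [combOrEmpty, spine]
  | some e => rfl

lemma Tooth.cases_tail {s t : D.Crossing} (h : D.Tooth s t) :
    t = s ∨ ∃ u, D.Tooth s u ∧ D.UpRight u t := Relation.ReflTransGen.cases_tail h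

lemma Tooth.eq_or_right_le {s t : D.Crossing} (h : D.Tooth s t) :
    t = s ∨ s.1.right ≤ t.1.left + 1 ∧ s.1.level < t.1.level := by
  induction h with
  | refl => exact Or.inl rfl
  | tail _ h' ih =>
    rw [upRight_iff] at h'
    right
    rename_i u t _
    have := u.1.left_add_two_le_right
    rcases ih with rfl | ih <;> omega

lemma Tooth.le {s t : D.Crossing} (h : D.Tooth s t) :
    s.1.left ≤ t.1.left ∧ s.1.level ≤ t.1.level := by
  have := s.1.left_add_two_le_right
  rcases h.eq_or_right_le with rfl | h <;> omega

lemma tooth_total {s s' t : D.Crossing} (h : D.Tooth s t) (h' : D.Tooth s' t) :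
    D.Tooth s s' ∨ D.Tooth s' s := by
  have := Relation.ReflTransGen.total_of_right_unique (r := Function.swap D.UpRight)
    (fun a b c hb hc => UpRight.unique_left hb hc) (Relation.reflTransGen_swap.2 h)
    (Relation.reflTransGen_swap.2 h')
  exact (this.imp Relation.reflTransGen_swap.1 Relation.reflTransGen_swap.1).symm

/-- A tooth contains at most one crossing in each column. -/
lemma Tooth.eq_of_col {s t t' : D.Crossing} (h : D.Tooth s t) (h' : D.Tooth s t') {x : ℕ}
    (hx : t.1.Col x) (hx' : t'.1.Col x) : t = t' := by
  unfold DyckTile.Col at *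
  rcases Relation.ReflTransGen.total_of_right_unique (fun a b c => UpRight.unique) h h' with h1 | h1
  · rcases Tooth.eq_or_right_le h1 with h2 | h2
    · exact h2.symm
    · omega
  · rcases Tooth.eq_or_right_le h1 with h2 | h2
    · exact h2
    · omega

lemma upLeft_chain {s t : D.Crossing} (h : Relation.ReflTransGen D.UpLeft s t) :
    t = s ∨ t.1.right ≤ s.1.left + 1 ∧ s.1.level < t.1.level := by
  induction h with
  | refl => exact Or.inl rfl
  | tail _ h' ih =>
    rw [upLeft_iff] at h'
    right
    rename_i u t _
    have := u.1.left_add_two_le_right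
    rcases ih with rfl | ih <;> omega

/-- The crossings of the spine are ordered: columns decrease while levels increase. -/
lemma spine_total {s s' : D.Crossing} (h : s ∈ D.spine o) (h' : s' ∈ D.spine o) :
    s = s' ∨ (s.1.right ≤ s'.1.left + 1 ∧ s'.1.level < s.1.level) ∨
      (s'.1.right ≤ s.1.left + 1 ∧ s.1.level < s'.1.level) := by
  cases o with
  | none => exact h.elim
  | some e =>
    rcases Relation.ReflTransGen.total_of_right_unique (fun a b c => UpLeft.unique) h h' with
      h1 | h1
    · rcases upLeft_chain h1 with h2 | h2
      · exact Or.inl h2.symm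
      · exact Or.inr (Or.inr h2)
    · rcases upLeft_chain h1 with h2 | h2
      · exact Or.inl h2
      · exact Or.inr (Or.inl h2)

lemma left_le_tipCol {s : D.Crossing} (h : s ∈ D.spine o) :
    s.1.left ≤ D.tipCol o ∧ D.tipLevel o ≤ s.1.level := by
  cases o with
  | none => exact h.elim
  | some e =>
    have := s.1.left_add_two_le_right
    rcases upLeft_chain h with rfl | h2
    · exact ⟨le_rfl, le_rfl⟩
    · simp only [tipCol, tipLevel]; omega

lemma spine_upLeft {s : D.Crossing} (h : s ∈ D.spine o) :
    (∃ t ∈ D.spine o, D.UpLeft s t) ∨ dyckHeight D.upper s.1.left = s.1.level := by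
  cases o with
  | none => exact h.elim
  | some e =>
    rcases exists_upLeft s with ⟨t, ht⟩ | h1
    · exact Or.inl ⟨t, Relation.ReflTransGen.tail h ht, ht⟩
    · exact Or.inr h1

lemma spine_cases {s : D.Crossing} (h : s ∈ D.spine o) :
    (s.1.left = D.tipCol o ∧ s.1.level = D.tipLevel o) ∨ ∃ t ∈ D.spine o, D.UpLeft t s := by
  cases o with
  | none => exact h.elim
  | some e =>
    rcases Relation.ReflTransGen.cases_tail h with rfl | ⟨t, ht, h1⟩
    · exact Or.inl ⟨rfl, rfl⟩
    · exact Or.inr ⟨t, ht, h1⟩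

variable (o) in
lemma tip_cases : D.tipCol o = 2 * n ∨
    ∃ s ∈ D.spine o, s.1.left = D.tipCol o ∧ s.1.level = D.tipLevel o := by
  cases o with
  | none => exact Or.inl rfl
  | some e => exact Or.inr ⟨e, Relation.ReflTransGen.refl, rfl, rfl⟩

lemma spine_subset {s : D.Crossing} (h : s ∈ D.spine o) : s ∈ D.combOrEmpty o :=
  mem_comb.2 ⟨s, h, Relation.ReflTransGen.refl⟩

lemma comb_upRight {t r : D.Crossing} (h : t ∈ D.combOrEmpty o) (h' : D.UpRight t r) :
    r ∈ D.combOrEmpty o := by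
  obtain ⟨s, hs, ht⟩ := mem_comb.1 h
  exact mem_comb.2 ⟨s, hs, Relation.ReflTransGen.tail ht h'⟩

lemma comb_cases {t : D.Crossing} (h : t ∈ D.combOrEmpty o) :
    t ∈ D.spine o ∨ ∃ u ∈ D.combOrEmpty o, D.UpRight u t := by
  obtain ⟨s, hs, ht⟩ := mem_comb.1 h
  rcases ht.cases_tail with rfl | ⟨u, hu, h1⟩
  · exact Or.inl hs
  · exact Or.inr ⟨u, mem_comb.2 ⟨s, hs, hu⟩, h1⟩

lemma tipLevel_le {t : D.Crossing} (h : t ∈ D.combOrEmpty o) : D.tipLevel o ≤ t.1.level := by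
  obtain ⟨s, hs, ht⟩ := mem_comb.1 h
  exact (left_le_tipCol hs).2.trans ht.le.2

/-- The teeth of a comb are disjoint. -/
lemma tooth_disjoint {s s' t : D.Crossing} (hs : s ∈ D.spine o) (hs' : s' ∈ D.spine o)
    (h : D.Tooth s t) (h' : D.Tooth s' t) : s = s' := by
  have := s.1.left_add_two_le_right
  have := s'.1.left_add_two_le_right
  rcases spine_total hs hs' with h1 | h1 | h1
  · exact h1
  all_goals
    rcases tooth_total h h' with h2 | h2 <;>
    · have := Tooth.le h2
      omega

/-- In the columns up to the left-most point of a crossing on the spine, the comb is above it. -/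
lemma level_lt_of_col_le {s t : D.Crossing} (hs : s ∈ D.spine o) (ht : t ∈ D.combOrEmpty o) {x : ℕ}
    (hx : t.1.Col x) (h : x ≤ s.1.left) : s.1.level < t.1.level := by
  obtain ⟨s', hs', ht'⟩ := mem_comb.1 ht
  have h1 := ht'.le
  have := s.1.left_add_two_le_right
  unfold DyckTile.Col at hx
  rcases spine_total hs hs' with rfl | h2 | h2 <;> omega

lemma level_le_of_col {s t : D.Crossing} (hs : s ∈ D.spine o) (ht : t ∈ D.combOrEmpty o)
    (hx : t.1.Col (s.1.left + 1)) : s.1.level ≤ t.1.level := by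
  obtain ⟨s', hs', ht'⟩ := mem_comb.1 ht
  have h1 := ht'.le
  have := s.1.left_add_two_le_right
  unfold DyckTile.Col at hx
  rcases spine_total hs hs' with rfl | h2 | h2 <;> omega

/-! ### Regions of the diagram cut out by a comb -/

variable (o) in
/-- The comb has a crossing below height `y` in column `x`. -/
def Above (x : ℕ) (y : ℤ) : Prop := ∃ t ∈ D.combOrEmpty o, t.1.Col x ∧ t.1.level < y

/-- The tooth that starts at `s` has a crossing below height `y` in column `x`, or it starts further
to the right. -/
def Over (s : D.Crossing) (x : ℕ) (y : ℤ) : Prop :=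
  x ≤ s.1.left ∨ ∃ t, D.Tooth s t ∧ t.1.Col x ∧ t.1.level < y

variable (o) in
/-- The number of teeth that a point above the spine lies over. -/
noncomputable def depth (x : ℕ) (y : ℤ) : ℕ := {s | s ∈ D.spine o ∧ Over s x y}.ncard

variable (D o) in
/-- A run below the upper path that may pass through crossings outside the comb, but not through
ends of crossings of the comb. -/
def CombRow (x x' : ℕ) (y : ℤ) : Prop :=
  x ≤ x' ∧ x' ≤ 2 * n ∧ (∀ m, x ≤ m → m ≤ x' → y ≤ dyckHeight D.upper m) ∧
    ∀ s ∈ D.combOrEmpty o, s.1.level = y →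
      ¬ (x ≤ s.1.left ∧ s.1.left < x') ∧ ¬ (x < s.1.right ∧ s.1.right ≤ x')

lemma Row.combRow {x x' : ℕ} {y : ℤ} (h : D.Row x x' y) : D.CombRow o x x' y :=
  ⟨h.1, h.2.1, h.2.2.1, fun s _ => h.2.2.2 s⟩

lemma combRow_crossing {e : D.Crossing} (he : e ∉ D.combOrEmpty o) :
    D.CombRow o e.1.left e.1.right e.1.level := by
  have := e.1.left_add_two_le_right
  have p1 := left_parity e
  have p2 := right_parity e
  refine ⟨by omega, right_le e, fun m => level_le_upper e, fun s hs hl => ⟨?_, ?_⟩⟩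
  · rintro ⟨h1, h2⟩
    have := left_parity s
    have h3 : e.1.Col (s.1.left + 1) := ⟨by omega, by omega⟩
    exact he (eq_of_level_eq s.1.col_left h3 hl ▸ hs)
  · rintro ⟨h1, h2⟩
    have := right_parity s
    have h3 : e.1.Col (s.1.right - 1) := ⟨by omega, by omega⟩
    exact he (eq_of_level_eq s.1.col_right h3 hl ▸ hs)

/-- A quantity that does not change from a column to the next one along runs. -/
lemma eq_of_combRow {α : Type*} {f : ℕ → ℤ → α}
    (hf : ∀ x y, D.CombRow o x (x + 1) y → f x y = f (x + 1) y) {x x' : ℕ} {y : ℤ}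
    (h : D.CombRow o x x' y) : f x y = f x' y := by
  obtain ⟨h1, h2, h3, h4⟩ := h
  induction x', h1 using Nat.le_induction with
  | base => rfl
  | succ m hm ih =>
    rw [ih (by omega) (fun k h5 h6 => h3 k h5 (by omega)) fun s hs hl => by
      have := h4 s hs hl; omega]
    refine hf m y ⟨by omega, h2, fun k h5 h6 => h3 k (by omega) h6, fun s hs hl => ?_⟩
    have := h4 s hs hl
    omega

/-- Going to the right, a tooth that ends below height `y` is continued by its next crossing. -/
lemma exists_col_succ {t : D.Crossing} {x : ℕ} {y : ℤ} (hx : t.1.Col x)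
    (hl : t.1.level < y) (hy : y ≤ dyckHeight D.upper (x + 1)) :
    t.1.Col (x + 1) ∨ ∃ r, D.UpRight t r ∧ r.1.left = x ∧ r.1.Col (x + 1) ∧
      r.1.level = t.1.level + 1 := by
  by_cases h : t.1.Col (x + 1)
  · exact Or.inl h
  right
  obtain rfl : x = t.1.right - 1 := by
    unfold DyckTile.Col at *
    omega
  have h0 := t.1.left_add_two_le_right
  rw [show t.1.right - 1 + 1 = t.1.right by omega] at hy ⊢
  rcases exists_upRight t with ⟨r, hr⟩ | h1
  · have h2 := upRight_iff.1 hr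
    exact ⟨r, hr, by omega, h2.1 ▸ r.1.col_left, h2.2⟩
  · omega

lemma above_step {x : ℕ} {y : ℤ} (h : D.CombRow o x (x + 1) y) :
    Above o x y ↔ Above o (x + 1) y := by
  obtain ⟨-, -, h3, h4⟩ := h
  constructor
  · rintro ⟨t, ht, hx, hl⟩
    rcases exists_col_succ hx hl (h3 _ (by omega) le_rfl) with h5 | ⟨r, hr, h5, h6, h7⟩
    · exact ⟨t, ht, h5, hl⟩
    · have h8 := comb_upRight ht hr
      have := h4 r h8
      exact ⟨r, h8, h6, by omega⟩
  · rintro ⟨t, ht, hx, hl⟩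
    by_cases h5 : t.1.left < x
    · exact ⟨t, ht, ⟨h5, by have := hx.2; omega⟩, hl⟩
    obtain rfl : x = t.1.left := by
      unfold DyckTile.Col at hx
      omega
    rcases comb_cases ht with hs | ⟨u, hu, h6⟩
    · rcases spine_upLeft hs with ⟨u, hu, h6⟩ | h6
      · rw [upLeft_iff] at h6
        have := u.1.left_add_two_le_right
        have := h4 u (spine_subset hu)
        exact ⟨u, spine_subset hu, ⟨by omega, by omega⟩, by omega⟩
      · have := h3 _ le_rfl (by omega)
        omega
    · rw [upRight_iff] at h6
      have := u.1.left_add_two_le_right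
      exact ⟨u, hu, ⟨by omega, by omega⟩, by omega⟩

lemma over_step {x : ℕ} {y : ℤ} (hy : y ≤ dyckHeight D.upper (x + 1))
    (h : ∀ t ∈ D.combOrEmpty o, t.1.level = y → t.1.left ≠ x)
    (h' : ∃ t ∈ D.combOrEmpty o, t.1.Col x ∧ t.1.level ≤ y) {s : D.Crossing}
    (hs : s ∈ D.spine o) : Over s x y ↔ Over s (x + 1) y := by
  constructor
  · rintro (h1 | ⟨t, ht, hx, hl⟩)
    · by_cases h2 : x = s.1.left
      · obtain ⟨t, ht, hx, hl⟩ := h'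
        have := level_lt_of_col_le hs ht hx h1
        exact Or.inr ⟨s, Relation.ReflTransGen.refl, h2 ▸ s.1.col_left, by omega⟩
      · exact Or.inl (by omega)
    · right
      rcases exists_col_succ hx hl hy with h5 | ⟨r, hr, h5, h6, h7⟩
      · exact ⟨t, ht, h5, hl⟩
      · have h8 : D.Tooth s r := Relation.ReflTransGen.tail ht hr
        have := h r (mem_comb.2 ⟨s, hs, h8⟩)
        exact ⟨r, h8, h6, by omega⟩
  · rintro (h1 | ⟨t, ht, hx, hl⟩)
    · exact Or.inl (by omega)
    · by_cases h5 : t.1.left < x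
      · exact Or.inr ⟨t, ht, ⟨h5, by have := hx.2; omega⟩, hl⟩
      obtain rfl : x = t.1.left := by
        unfold DyckTile.Col at hx
        omega
      rcases ht.cases_tail with rfl | ⟨u, hu, h6⟩
      · exact Or.inl le_rfl
      · rw [upRight_iff] at h6
        have := u.1.left_add_two_le_right
        exact Or.inr ⟨u, hu, ⟨by omega, by omega⟩, by omega⟩

lemma depth_step' {x : ℕ} {y : ℤ} (hy : y ≤ dyckHeight D.upper (x + 1))
    (h : ∀ t ∈ D.combOrEmpty o, t.1.level = y → t.1.left ≠ x)
    (h' : ∃ t ∈ D.combOrEmpty o, t.1.Col x ∧ t.1.level ≤ y) : depth o x y = depth o (x + 1) y := by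
  unfold depth
  congr 1
  ext s
  exact and_congr_right fun hs => over_step hy h h' hs

lemma depth_step {x : ℕ} {y : ℤ} (h : D.CombRow o x (x + 1) y) (h' : Above o x y) :
    depth o x y = depth o (x + 1) y := by
  obtain ⟨t, ht, hx, hl⟩ := h'
  exact depth_step' (h.2.2.1 _ (by omega) le_rfl)
    (fun s hs hl => by have := h.2.2.2 s hs hl; omega) ⟨t, ht, hx, hl.le⟩

/-- The depth is constant along a crossing of the comb and does not change on its right. -/
lemma depth_crossing {e : D.Crossing} (he : e ∈ D.combOrEmpty o) {x : ℕ} (h : e.1.left < x)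
    (h' : x ≤ e.1.right) : depth o (e.1.left + 1) e.1.level = depth o x e.1.level := by
  induction x, (show e.1.left + 1 ≤ x from h) using Nat.le_induction with
  | base => rfl
  | succ m hm ih =>
    rw [ih (by omega) (by omega)]
    refine depth_step' (level_le_upper e (by omega) h') (fun t _ hl hm' => ?_)
      ⟨e, he, ⟨by omega, by omega⟩, le_rfl⟩
    have p1 := left_parity t
    have p2 := right_parity e
    have h3 : e.1.Col (t.1.left + 1) := ⟨by omega, by omega⟩
    have := eq_of_level_eq t.1.col_left h3 hl
    subst this
    omega

lemma above_succ {x : ℕ} {y : ℤ} (h : ∀ t ∈ D.combOrEmpty o, t.1.Col x → t.1.level ≠ y) :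
    Above o x (y + 1) ↔ Above o x y := by
  refine exists_congr fun t => and_congr_right fun ht => and_congr_right fun hx => ?_
  have := h t ht hx
  omega

lemma depth_succ {x : ℕ} {y : ℤ} (h : ∀ t ∈ D.combOrEmpty o, t.1.Col x → t.1.level ≠ y) :
    depth o x (y + 1) = depth o x y := by
  unfold depth
  congr 1
  ext s
  refine and_congr_right fun hs => or_congr Iff.rfl (exists_congr fun t => and_congr_right fun ht =>
    and_congr_right fun hx => ?_)
  have := h t (mem_comb.2 ⟨s, hs, ht⟩) hx
  omega

lemma depth_succ_of_mem {e : D.Crossing} (he : e ∈ D.combOrEmpty o) {x : ℕ} (hx : e.1.Col x) :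
    depth o x (e.1.level + 1) = depth o x e.1.level + 1 := by
  obtain ⟨s, hs, hse⟩ := mem_comb.1 he
  unfold depth
  rw [← Set.ncard_insert_of_notMem (a := s) (s := {s | s ∈ D.spine o ∧ Over s x e.1.level})]
  · congr 1
    ext s'
    simp only [Set.mem_ofPred_eq, Set.mem_insert_iff]
    constructor
    · rintro ⟨hs', h1 | ⟨t, ht, htx, hl⟩⟩
      · exact Or.inr ⟨hs', Or.inl h1⟩
      · by_cases h2 : t.1.level = e.1.level
        · obtain rfl := eq_of_level_eq htx hx h2
          exact Or.inl (tooth_disjoint hs' hs ht hse)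
        · exact Or.inr ⟨hs', Or.inr ⟨t, ht, htx, by omega⟩⟩
    · rintro (rfl | ⟨hs', h1 | ⟨t, ht, htx, hl⟩⟩)
      · exact ⟨hs, Or.inr ⟨e, hse, hx, by omega⟩⟩
      · exact ⟨hs', Or.inl h1⟩
      · exact ⟨hs', Or.inr ⟨t, ht, htx, by omega⟩⟩
  · rintro ⟨-, h1 | ⟨t, ht, htx, hl⟩⟩
    · have := hse.le
      have := hx.1
      omega
    · rw [ht.eq_of_col hse htx hx] at hl
      omega

lemma level_ne_sub_one (e : D.Crossing) {x : ℕ} (hx : e.1.Col x) :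
    ∀ t ∈ D.combOrEmpty o, t.1.Col x → t.1.level ≠ e.1.level - 1 := by
  intro t _ htx h
  rcases level_trichotomy hx htx with rfl | h1 | h1 <;> omega

lemma level_ne {e : D.Crossing} (he : e ∉ D.combOrEmpty o) {x : ℕ} (hx : e.1.Col x) :
    ∀ t ∈ D.combOrEmpty o, t.1.Col x → t.1.level ≠ e.1.level :=
  fun _ ht htx h => he (eq_of_level_eq htx hx h ▸ ht)

lemma depth_bottom (e : D.Crossing) {x : ℕ} (hx : e.1.Col x) :
    depth o x (e.1.level - 1) = depth o x e.1.level := by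
  have := depth_succ (level_ne_sub_one (o := o) e hx)
  rw [← this, sub_add_cancel]

lemma above_bottom (e : D.Crossing) {x : ℕ} (hx : e.1.Col x) :
    Above o x (e.1.level - 1) ↔ Above o x e.1.level := by
  have := above_succ (level_ne_sub_one (o := o) e hx)
  rw [← this, sub_add_cancel]

lemma depth_eq_zero {x : ℕ} {y : ℤ} (h : ¬ Above o x y) (hx : D.tipCol o < x) :
    depth o x y = 0 := by
  unfold depth
  rw [Set.ncard_eq_zero]
  ext s
  simp only [Set.mem_ofPred_eq, Set.mem_empty_iff_false, iff_false]
  rintro ⟨hs, h1 | ⟨t, ht, htx, hl⟩⟩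
  · have := left_le_tipCol hs
    omega
  · exact h ⟨t, mem_comb.2 ⟨s, hs, ht⟩, htx, hl⟩

lemma not_above_spine {s : D.Crossing} (hs : s ∈ D.spine o) {x : ℕ} (hx : x ≤ s.1.left) :
    ¬ Above o x s.1.level := by
  rintro ⟨t, ht, htx, hl⟩
  have := level_lt_of_col_le hs ht htx hx
  omega

lemma not_above_spine' {s : D.Crossing} (hs : s ∈ D.spine o) :
    ¬ Above o (s.1.left + 1) s.1.level := by
  rintro ⟨t, ht, htx, hl⟩
  have := level_le_of_col hs ht htx
  omega

lemma depth_spine {s : D.Crossing} (hs : s ∈ D.spine o) :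
    (depth o (s.1.left + 1) s.1.level : ℤ) = s.1.level - D.tipLevel o := by
  obtain ⟨k, hk⟩ : ∃ k : ℕ, s.1.level - D.tipLevel o ≤ k := ⟨_, Int.self_le_toNat _⟩
  induction k generalizing s with
  | zero =>
    have h1 := left_le_tipCol hs
    rcases spine_cases hs with h2 | ⟨t, ht, h2⟩
    · rw [depth_eq_zero (not_above_spine' hs) (by omega)]
      omega
    · rw [upLeft_iff] at h2
      have := left_le_tipCol ht
      push_cast at hk
      omega
  | succ k ih =>
    rcases spine_cases hs with h2 | ⟨t, ht, h2⟩
    · rw [depth_eq_zero (not_above_spine' hs) (by omega)]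
      omega
    · rw [upLeft_iff] at h2
      have h3 := ih ht (by push_cast at hk; omega)
      have h4 := depth_succ_of_mem (spine_subset ht) t.1.col_left
      have h5 := depth_crossing (spine_subset hs) (x := s.1.right)
        (by have := s.1.left_add_two_le_right; omega) le_rfl
      rw [h5, h2.1, h2.2, h4]
      push_cast
      omega

/-- To the right of a tooth other than the first one, the comb continues below. -/
lemma tipCol_le_of_not_above {t : D.Crossing} (ht : t ∈ D.combOrEmpty o)
    (h : ¬ Above o t.1.right t.1.level) : D.tipCol o ≤ t.1.left := by
  obtain ⟨s, hs, hst⟩ := mem_comb.1 ht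
  rcases spine_cases hs with h1 | ⟨s', hs', h1⟩
  · have := hst.le
    omega
  refine absurd ?_ h
  clear h ht
  induction hst with
  | refl =>
    rw [upLeft_iff] at h1
    exact ⟨s', spine_subset hs', h1.1 ▸ s'.1.col_left, by omega⟩
  | tail htu hur ih =>
    rename_i u r
    have hr : r ∈ D.combOrEmpty o := mem_comb.2 ⟨s, hs, Relation.ReflTransGen.tail htu hur⟩
    rw [upRight_iff] at hur
    have h2 := r.1.left_add_two_le_right
    -- The comb runs below `r` from its left end to its right end.
    have hrow : D.CombRow o (r.1.left + 1) (r.1.right - 1) (r.1.level - 1) := by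
      have := row_bottom r (x := r.1.left + 1) (x' := r.1.right - 1) (by omega) (by omega)
        (by omega)
      exact this.combRow
    have h3 : Above o (r.1.right - 1) (r.1.level - 1) := by
      rw [← eq_of_combRow (f := Above o) (fun x y h => propext (above_step h)) hrow, hur.1,
        show r.1.level - 1 = u.1.level by omega]
      exact ih
    obtain ⟨v, hv, hvx, hvl⟩ := h3
    have h4 := level_le_upper r (x := r.1.right) (by omega) le_rfl
    have h5 := exists_col_succ (y := r.1.level) hvx (by omega)
      (by rwa [show r.1.right - 1 + 1 = r.1.right by omega])
    rw [show r.1.right - 1 + 1 = r.1.right by omega] at h5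
    rcases h5 with h5 | ⟨w, hw, -, h5, h6⟩
    · exact ⟨v, hv, h5, by omega⟩
    · exact ⟨w, comb_upRight hv hw, h5, by omega⟩

open Classical in
variable (o) in
/-- A label that distinguishes the components of the edges that are selected by a comb. Above the
comb, it is the height minus twice the number of teeth below; this does not change when a component
passes from below a crossing of the comb to above it. Below the comb, the components at heights at
least `tipLevel - 1` turn upwards at the comb, and the label is reflected on the left side
accordingly; the other components run from left to right, and are distinguished by the first
entry. -/
noncomputable def label (x : ℕ) (y : ℤ) : ℤ × ℤ :=
  if Above o x y then (0, y - 2 * depth o x y)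
  else if y < D.tipLevel o - 1 then (1, y)
  else if x ≤ D.tipCol o then (0, 2 * (D.tipLevel o - 1) - y)
  else (0, y)

lemma label_of_above {x : ℕ} {y : ℤ} (h : Above o x y) :
    label o x y = (0, y - 2 * depth o x y) := if_pos h

lemma label_of_lt {x : ℕ} {y : ℤ} (h : ¬ Above o x y) (h' : y < D.tipLevel o - 1) :
    label o x y = (1, y) := by
  rw [label, if_neg h, if_pos h']

lemma label_of_le {x : ℕ} {y : ℤ} (h : ¬ Above o x y) (h' : D.tipLevel o - 1 ≤ y)
    (hx : x ≤ D.tipCol o) : label o x y = (0, 2 * (D.tipLevel o - 1) - y) := by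
  rw [label, if_neg h, if_neg (by omega), if_pos hx]

lemma label_of_gt {x : ℕ} {y : ℤ} (h : ¬ Above o x y) (h' : D.tipLevel o - 1 ≤ y)
    (hx : D.tipCol o < x) : label o x y = (0, y) := by
  rw [label, if_neg h, if_neg (by omega), if_neg (by omega)]

lemma label_step {x : ℕ} {y : ℤ} (h : D.CombRow o x (x + 1) y) :
    label o x y = label o (x + 1) y := by
  by_cases h1 : Above o x y
  · rw [label_of_above h1, label_of_above ((above_step h).1 h1), depth_step h h1]
  have h2 := fun h3 => h1 ((above_step h).2 h3)
  by_cases h3 : y < D.tipLevel o - 1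
  · rw [label_of_lt h1 h3, label_of_lt h2 h3]
  rcases Nat.lt_trichotomy x (D.tipCol o) with h4 | h4 | h4
  · rw [label_of_le h1 (by omega) h4.le, label_of_le h2 (by omega) h4]
  · -- Only the row just below the tip of the comb passes from the left side to the right side.
    rw [label_of_le h1 (by omega) h4.le, label_of_gt h2 (by omega) (by omega)]
    rcases tip_cases o with h5 | ⟨s, hs, h5, h6⟩
    · have := h.2.1
      omega
    · have h7 := h.2.2.2 s (spine_subset hs)
      have h8 : y ≤ s.1.level := by
        by_contra h8
        exact h2 ⟨s, spine_subset hs, h4 ▸ h5 ▸ s.1.col_left, by omega⟩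
      have h9 : y = D.tipLevel o - 1 := by omega
      rw [h9]
      congr 1
      ring
  · rw [label_of_gt h1 (by omega) h4, label_of_gt h2 (by omega) (by omega)]

end DyckTiling

/-! ### The crossings around a cell -/

namespace DyckTiling

variable {n : ℕ} {D : DyckTiling n} {o : Option D.Crossing}

variable (o) in
/-- The crossing lies above some tooth of the comb. -/
def CrossingAbove (e : D.Crossing) : Prop := Above o (e.1.left + 1) e.1.level

variable (o) in
/-- The number of teeth that a crossing above the comb lies over; a crossing of the comb does not
lie over its own tooth. -/
noncomputable def crossingDepth (e : D.Crossing) : ℕ := depth o (e.1.left + 1) e.1.level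

lemma label_eq_of_cell_eq {p q : ℕ × ℤ} (h : D.cell p = D.cell q) :
    label o p.1 p.2 = label o q.1 q.2 :=
  eq_of_cell_eq (f := label o)
    (fun _ _ _ hr => eq_of_combRow (fun _ _ => label_step) hr.combRow) h

lemma above_iff_of_cell_eq {x x' : ℕ} {y y' : ℤ} (h : D.cell (x, y) = D.cell (x', y')) :
    Above o x y ↔ Above o x' y' :=
  iff_of_eq (eq_of_cell_eq (f := Above o) (fun _ _ _ hr =>
    eq_of_combRow (fun _ _ hs => propext (above_step hs)) hr.combRow) h)

lemma depth_eq_of_cell_eq {x x' : ℕ} {y y' : ℤ} (h : D.cell (x, y) = D.cell (x', y'))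
    (ha : Above o x' y') : depth o x y = depth o x' y' := by
  have h1 := label_eq_of_cell_eq (o := o) h
  have h2 := row_eq_of_cell_eq h
  simp only at h1 h2
  rw [label_of_above ha, label_of_above ((above_iff_of_cell_eq h).2 ha), Prod.mk.injEq] at h1
  omega

lemma above_crossing_iff {e : D.Crossing} (he : e ∉ D.combOrEmpty o) {x : ℕ} (h : e.1.left ≤ x)
    (h' : x ≤ e.1.right) : Above o x e.1.level ↔ CrossingAbove o e := by
  have h1 := e.1.left_add_two_le_right
  have key : ∀ x, e.1.left ≤ x → x ≤ e.1.right →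
      (Above o e.1.left e.1.level ↔ Above o x e.1.level) := by
    intro x h h'
    refine iff_of_eq (eq_of_combRow (o := o) (f := Above o)
      (fun _ _ hs => propext (above_step hs)) (x := e.1.left) (x' := x) ?_)
    obtain ⟨-, h2, h3, h4⟩ := combRow_crossing he
    refine ⟨h, h'.trans h2, fun m h5 h6 => h3 m h5 (h6.trans h'), fun s hs hl => ?_⟩
    have := h4 s hs hl
    omega
  exact (key x h h').symm.trans (key (e.1.left + 1) (by omega) (by omega))

lemma depth_crossing_of_notMem {e : D.Crossing} (he : e ∉ D.combOrEmpty o) {x : ℕ}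
    (h : e.1.left ≤ x) (h' : x ≤ e.1.right) (ha : CrossingAbove o e) :
    depth o x e.1.level = crossingDepth o e := by
  have h1 := e.1.left_add_two_le_right
  have hl : label o e.1.left e.1.level = label o x e.1.level := by
    refine eq_of_combRow (o := o) (fun _ _ => label_step) ?_
    obtain ⟨-, h2, h3, h4⟩ := combRow_crossing he
    refine ⟨h, h'.trans h2, fun m h5 h6 => h3 m h5 (h6.trans h'), fun s hs hl => ?_⟩
    have := h4 s hs hl
    omega
  have hl' : label o e.1.left e.1.level = label o (e.1.left + 1) e.1.level := by
    refine eq_of_combRow (o := o) (fun _ _ => label_step) ?_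
    obtain ⟨-, h2, h3, h4⟩ := combRow_crossing he
    refine ⟨by omega, by omega, fun m h5 h6 => h3 m h5 (by omega), fun s hs hl => ?_⟩
    have := h4 s hs hl
    omega
  rw [hl', label_of_above ((above_crossing_iff he h h').2 ha), label_of_above ha,
    Prod.mk.injEq] at hl
  unfold crossingDepth
  omega

lemma crossingDepth_eq {e : D.Crossing} (he : e ∈ D.combOrEmpty o) :
    depth o e.1.right e.1.level = crossingDepth o e :=
  (depth_crossing he (by have := e.1.left_add_two_le_right; omega) le_rfl).symm

/-- The cell is at a corner of the crossing. -/
def Incident (e : D.Crossing) (v : Quot D.SameCell) : Prop :=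
  D.cell e.1.leftPoint = v ∨ D.cell e.1.rightPoint = v ∨ D.cell e.1.bottomLeftPoint = v ∨
    D.cell e.1.topLeftPoint = v

section Corners

variable {e : D.Crossing} {x : ℕ} {y : ℤ}

/-- At a crossing outside the comb, all cells are equally far above the comb. -/
lemma Incident.of_notMem (h : Incident e (D.cell (x, y))) (he : e ∉ D.combOrEmpty o) :
    (CrossingAbove o e ↔ Above o x y) ∧ (Above o x y → crossingDepth o e = depth o x y) := by
  have h1 := e.1.left_add_two_le_right
  have key : ∀ {p : ℕ × ℤ}, D.cell p = D.cell (x, y) → (Above o p.1 p.2 ↔ CrossingAbove o e) →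
      (CrossingAbove o e → depth o p.1 p.2 = crossingDepth o e) →
      (CrossingAbove o e ↔ Above o x y) ∧ (Above o x y → crossingDepth o e = depth o x y) := by
    intro p h2 h3 h4
    have h5 := above_iff_of_cell_eq (o := o) h2
    exact ⟨h3.symm.trans h5, fun h6 =>
      (h4 (h3.1 (h5.2 h6))).symm.trans (depth_eq_of_cell_eq h2 h6)⟩
  rcases h with h | h | h | h
  · exact key h (above_crossing_iff (x := e.1.left) he le_rfl (by omega))
      (depth_crossing_of_notMem (x := e.1.left) he le_rfl (by omega))
  · exact key h (above_crossing_iff (x := e.1.right) he (by omega) le_rfl)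
      (depth_crossing_of_notMem (x := e.1.right) he (by omega) le_rfl)
  · exact key h (above_bottom e e.1.col_left) (fun _ => depth_bottom e e.1.col_left)
  · exact key h (above_succ (level_ne he e.1.col_left))
      (fun _ => depth_succ (level_ne he e.1.col_left))

lemma depth_of_left (h : D.cell e.1.leftPoint = D.cell (x, y)) (he : e ∈ D.combOrEmpty o)
    (ha : Above o x y) : ∃ u ∈ D.combOrEmpty o, D.UpRight u e ∧
      crossingDepth o e = crossingDepth o u ∧ depth o x y = crossingDepth o e + 1 := by
  have h1 := (above_iff_of_cell_eq (o := o) h).2 ha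
  rcases comb_cases he with hs | ⟨u, hu, h2⟩
  · exact absurd h1 (not_above_spine hs le_rfl)
  · have h3 := upRight_iff.1 h2
    have h5 := u.1.left_add_two_le_right
    have h6 : crossingDepth o e = crossingDepth o u := by
      have := depth_bottom (o := o) e e.1.col_left
      rw [h3.1, show e.1.level - 1 = u.1.level by omega, crossingDepth_eq hu] at this
      rw [this]
      unfold crossingDepth
      rw [h3.1]
    refine ⟨u, hu, h2, h6, ?_⟩
    have h4 := depth_succ_of_mem hu u.1.col_right
    rw [← depth_eq_of_cell_eq h ha, h6, h3.2, show e.1.left = u.1.right - 1 by omega, h4,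
      ← depth_crossing hu (by omega) (by omega)]
    rfl

lemma mem_spine_of_left (h : D.cell e.1.leftPoint = D.cell (x, y)) (he : e ∈ D.combOrEmpty o)
    (ha : ¬ Above o x y) : e ∈ D.spine o := by
  rcases comb_cases he with hs | ⟨u, hu, h2⟩
  · exact hs
  · rw [upRight_iff] at h2
    refine absurd ((above_iff_of_cell_eq (o := o) h).1 ⟨u, hu, ?_, ?_⟩) ha
    · have := u.1.left_add_two_le_right
      constructor <;> omega
    · omega

lemma depth_of_right (h : D.cell e.1.rightPoint = D.cell (x, y)) (he : e ∈ D.combOrEmpty o)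
    (ha : Above o x y) : crossingDepth o e = depth o x y := by
  rw [← crossingDepth_eq he]
  exact depth_eq_of_cell_eq h ha

lemma tipCol_le_of_right (h : D.cell e.1.rightPoint = D.cell (x, y)) (he : e ∈ D.combOrEmpty o)
    (ha : ¬ Above o x y) : D.tipCol o ≤ e.1.left ∧ crossingDepth o e = 0 := by
  have h1 := fun h2 => ha ((above_iff_of_cell_eq (o := o) h).1 h2)
  have h2 := tipCol_le_of_not_above he h1
  refine ⟨h2, ?_⟩
  rw [← crossingDepth_eq he]
  exact depth_eq_zero h1 (by have := e.1.left_add_two_le_right; omega)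

lemma depth_of_bottom (h : D.cell e.1.bottomLeftPoint = D.cell (x, y)) (ha : Above o x y) :
    crossingDepth o e = depth o x y := by
  unfold crossingDepth
  rw [← depth_bottom e e.1.col_left]
  exact depth_eq_of_cell_eq h ha

/-- The cell below a crossing of the comb is below the comb, if the crossing is on the spine;
otherwise it is on the right of the previous crossing of the same tooth. -/
lemma cases_of_bottom (h : D.cell e.1.bottomLeftPoint = D.cell (x, y))
    (he : e ∈ D.combOrEmpty o) : (e ∈ D.spine o ∧ ¬ Above o x y) ∨
      ∃ t ∈ D.combOrEmpty o, D.UpRight t e ∧ D.cell t.1.rightPoint = D.cell (x, y) := by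
  rcases comb_cases he with hs | ⟨u, hu, h2⟩
  · refine Or.inl ⟨hs, fun ha => not_above_spine' hs ?_⟩
    rw [← above_bottom e e.1.col_left]
    exact (above_iff_of_cell_eq h).2 ha
  · refine Or.inr ⟨u, hu, h2, ?_⟩
    rw [← h]
    rw [upRight_iff] at h2
    unfold DyckTile.rightPoint DyckTile.bottomLeftPoint
    rw [h2.1, h2.2, add_sub_cancel_right]

lemma depth_of_top (h : D.cell e.1.topLeftPoint = D.cell (x, y)) (he : e ∈ D.combOrEmpty o) :
    Above o x y ∧ depth o x y = crossingDepth o e + 1 := by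
  have ha : Above o x y :=
    (above_iff_of_cell_eq (o := o) h).1 ⟨e, he, e.1.col_left, lt_add_one _⟩
  refine ⟨ha, ?_⟩
  rw [← depth_eq_of_cell_eq h ha]
  exact depth_succ_of_mem he e.1.col_left

lemma cell_top_of_upRight {u e : D.Crossing} (h : D.UpRight u e) :
    D.cell u.1.topLeftPoint = D.cell e.1.leftPoint := by
  rw [← cell_topRight]
  rw [upRight_iff] at h
  unfold DyckTile.leftPoint
  rw [h.2, ← h.1, Nat.add_sub_cancel]

lemma cell_bottom_of_upRight {t e : D.Crossing} (h : D.UpRight t e) :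
    D.cell e.1.bottomLeftPoint = D.cell t.1.rightPoint := by
  rw [upRight_iff] at h
  unfold DyckTile.rightPoint DyckTile.bottomLeftPoint
  rw [h.1, h.2, add_sub_cancel_right]

lemma cell_bottom_of_upLeft {s t : D.Crossing} (h : D.UpLeft s t) :
    D.cell t.1.bottomLeftPoint = D.cell s.1.leftPoint := by
  rw [← cell_bottomRight]
  rw [upLeft_iff] at h
  unfold DyckTile.leftPoint
  rw [h.1, h.2, Nat.add_sub_cancel, add_sub_cancel_right]

/-- All crossings at a cell other than the one at its left end are to the right of that one. -/
lemma Incident.of_right {v : Quot D.SameCell} (hv : D.cell e.1.rightPoint = v) {e' : D.Crossing}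
    (h : Incident e' v) (hne : e' ≠ e) : e.1.right ≤ e'.1.left + 1 ∧
      (D.cell e'.1.leftPoint = v → e.1.right ≤ e'.1.left) := by
  subst hv
  have h0 : D.cell e'.1.leftPoint = D.cell e.1.rightPoint → e.1.right ≤ e'.1.left := fun h =>
    (right_le_iff_of_cell_eq (s := e) h (row_eq_of_cell_eq h).symm).2 le_rfl
  refine ⟨?_, h0⟩
  rcases h with h | h | h | h
  · have := h0 h; omega
  · have h1 : e'.1.level = e.1.level := row_eq_of_cell_eq h
    have h2 := (right_le_iff_of_cell_eq (s := e) h h1.symm).2 le_rfl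
    have h3 := (right_le_iff_of_cell_eq (s := e') h rfl).1 le_rfl
    exact absurd (eq_of_right_eq (by omega) h1) hne
  · exact (right_le_iff_of_cell_eq (s := e) h (row_eq_of_cell_eq h).symm).2 le_rfl
  · exact (right_le_iff_of_cell_eq (s := e) h (row_eq_of_cell_eq h).symm).2 le_rfl

/-- All crossings at a cell other than the one at its right end are to the left of that one. -/
lemma Incident.of_left {v : Quot D.SameCell} (hv : D.cell e.1.leftPoint = v) {e' : D.Crossing}
    (h : Incident e' v) (hne : e' ≠ e) : e'.1.left + 1 ≤ e.1.left ∧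
      (D.cell e'.1.rightPoint = v → e'.1.right ≤ e.1.left) := by
  subst hv
  have h0 : D.cell e'.1.rightPoint = D.cell e.1.leftPoint → e'.1.right ≤ e.1.left := fun h =>
    (le_left_iff_of_cell_eq (s := e) h (row_eq_of_cell_eq h).symm).2 le_rfl
  refine ⟨?_, h0⟩
  rcases h with h | h | h | h
  · have h1 : e'.1.level = e.1.level := row_eq_of_cell_eq h
    have h2 := (le_left_iff_of_cell_eq (s := e) h h1.symm).2 le_rfl
    have h3 := (le_left_iff_of_cell_eq (s := e') h rfl).1 le_rfl
    exact absurd (eq_of_left_eq (by omega) h1) hne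
  · have := h0 h
    have := e'.1.left_add_two_le_right
    omega
  · exact (le_left_iff_of_cell_eq (s := e) h (row_eq_of_cell_eq h).symm).2 le_rfl
  · exact (le_left_iff_of_cell_eq (s := e) h (row_eq_of_cell_eq h).symm).2 le_rfl

/-- The cell above or below a crossing extends to the right end of the crossing. -/
lemma right_le_of_bottom_or_top {v : Quot D.SameCell} (hv : D.cell e.1.leftPoint = v)
    {e' : D.Crossing} (h : D.cell e'.1.bottomLeftPoint = v ∨ D.cell e'.1.topLeftPoint = v) :
    e'.1.right ≤ e.1.left + 1 := by
  subst hv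
  have h1 := e'.1.left_add_two_le_right
  rcases h with h | h
  · rw [← cell_bottomRight] at h
    have := (le_left_iff_of_cell_eq (s := e) h (row_eq_of_cell_eq h).symm).2 le_rfl
    omega
  · rw [← cell_topRight] at h
    have := (le_left_iff_of_cell_eq (s := e) h (row_eq_of_cell_eq h).symm).2 le_rfl
    omega

end Corners

/-! ### Ranks -/

open Classical in
variable (o) in
/-- The order in which the crossings are examined: first those below the comb, from the outside
inwards, then the first tooth, from left to right, then what lies between the first two teeth, from
right to left, and so on upwards. -/
noncomputable def rank (e : D.Crossing) : ℕ ×ₗ ℕ :=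
  if e ∈ D.combOrEmpty o then toLex (2 * crossingDepth o e + 1, e.1.left)
  else if CrossingAbove o e then toLex (2 * crossingDepth o e, 2 * n - e.1.right)
  else if e.1.left ≤ D.tipCol o then toLex (0, e.1.left)
  else toLex (0, 2 * n - e.1.right)

lemma rank_of_mem {e : D.Crossing} (h : e ∈ D.combOrEmpty o) :
    rank o e = toLex (2 * crossingDepth o e + 1, e.1.left) := if_pos h

lemma rank_of_above {e : D.Crossing} (h : e ∉ D.combOrEmpty o) (h' : CrossingAbove o e) :
    rank o e = toLex (2 * crossingDepth o e, 2 * n - e.1.right) := by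
  rw [rank, if_neg h, if_pos h']

lemma rank_of_le {e : D.Crossing} (h : e ∉ D.combOrEmpty o) (h' : ¬ CrossingAbove o e)
    (hl : e.1.left ≤ D.tipCol o) : rank o e = toLex (0, e.1.left) := by
  rw [rank, if_neg h, if_neg h', if_pos hl]

lemma rank_of_gt {e : D.Crossing} (h : e ∉ D.combOrEmpty o) (h' : ¬ CrossingAbove o e)
    (hl : D.tipCol o < e.1.left) : rank o e = toLex (0, 2 * n - e.1.right) := by
  rw [rank, if_neg h, if_neg h', if_neg (by omega)]

lemma rank_lt_of_not_above {e e' : D.Crossing} (h : e ∉ D.combOrEmpty o)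
    (h' : ¬ CrossingAbove o e) (he : e' ∈ D.combOrEmpty o) : rank o e < rank o e' := by
  rw [rank_of_mem he]
  by_cases h1 : e.1.left ≤ D.tipCol o
  · rw [rank_of_le h h' h1, Prod.Lex.toLex_lt_toLex]
    simp only
    omega
  · rw [rank_of_gt h h' (by omega), Prod.Lex.toLex_lt_toLex]
    simp only
    omega

/-- Among the crossings at the cell on the right of a crossing that is above the comb or below it on
the right, this crossing has the highest rank. -/
lemma rank_lt_of_right {e e' : D.Crossing} (he : e ∉ D.combOrEmpty o)
    (h : CrossingAbove o e ∨ D.tipCol o < e.1.left) (h' : Incident e' (D.cell e.1.rightPoint))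
    (hne : e' ≠ e) : rank o e' < rank o e := by
  have h1 := (Incident.of_right rfl h' hne).1
  have h2 := right_le e'
  have h3 := e.1.left_add_two_le_right
  have h4 := e'.1.left_add_two_le_right
  have h5 : Incident e (D.cell (e.1.right, e.1.level)) := Or.inr (Or.inl rfl)
  obtain ⟨h6, h7⟩ := h5.of_notMem he
  by_cases he' : e' ∈ D.combOrEmpty o
  · rcases h' with h' | h' | h' | h'
    · by_cases ha : CrossingAbove o e
      · obtain ⟨u, -, -, -, h8⟩ := depth_of_left h' he' (h6.1 ha)
        rw [rank_of_mem he', rank_of_above he ha, Prod.Lex.toLex_lt_toLex, h7 (h6.1 ha), h8]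
        simp only
        omega
      · have := left_le_tipCol (mem_spine_of_left h' he' (fun h => ha (h6.2 h)))
        have := h.resolve_left ha
        omega
    · have := (Incident.of_right h' h5 hne.symm).1
      omega
    · rcases cases_of_bottom h' he' with ⟨hs, ha⟩ | ⟨t, ht, -, htr⟩
      · have := left_le_tipCol hs
        have := h.resolve_left (fun h => ha (h6.1 h))
        omega
      · have hte : t ≠ e := fun hte => he (hte ▸ ht)
        have := (Incident.of_right rfl (Or.inr (Or.inl htr)) hte).1
        have := (Incident.of_right htr h5 hte.symm).1
        have := t.1.left_add_two_le_right
        omega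
    · obtain ⟨ha, h8⟩ := depth_of_top h' he'
      rw [rank_of_mem he', rank_of_above he (h6.2 ha), Prod.Lex.toLex_lt_toLex, h7 ha, h8]
      simp only
      omega
  · obtain ⟨h8, h9⟩ := Incident.of_notMem (o := o) h' he'
    by_cases ha : CrossingAbove o e
    · rw [rank_of_above he' (h8.2 (h6.1 ha)), rank_of_above he ha, Prod.Lex.toLex_lt_toLex,
        h7 (h6.1 ha), h9 (h6.1 ha)]
      exact Or.inr ⟨rfl, show 2 * n - e'.1.right < 2 * n - e.1.right by omega⟩
    · have := h.resolve_left ha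
      rw [rank_of_gt he' (fun h => ha (h6.2 (h8.1 h))) (by omega), rank_of_gt he ha (by omega),
        Prod.Lex.toLex_lt_toLex]
      exact Or.inr ⟨rfl, show 2 * n - e'.1.right < 2 * n - e.1.right by omega⟩

/-- Among the crossings at the cell on the left of a crossing that is below the comb on the left,
this crossing has the highest rank. -/
lemma rank_lt_of_left {e e' : D.Crossing} (he : e ∉ D.combOrEmpty o)
    (ha : ¬ CrossingAbove o e) (hl : e.1.left ≤ D.tipCol o)
    (h' : Incident e' (D.cell e.1.leftPoint)) (hne : e' ≠ e) : rank o e' < rank o e := by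
  obtain ⟨h1, h1'⟩ := Incident.of_left rfl h' hne
  have h4 := e'.1.left_add_two_le_right
  have h5 : Incident e (D.cell (e.1.left, e.1.level)) := Or.inl rfl
  have h6 : ¬ Above o e.1.left e.1.level := fun h => ha ((h5.of_notMem he).1.2 h)
  by_cases he' : e' ∈ D.combOrEmpty o
  · rcases h' with h' | h' | h' | h'
    · have := (Incident.of_left h' h5 hne.symm).1
      omega
    · have := (tipCol_le_of_right h' he' h6).1
      have := h1' h'
      omega
    · rcases cases_of_bottom h' he' with ⟨hs, -⟩ | ⟨t, ht, -, htr⟩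
      · rcases spine_cases hs with h7 | ⟨s, hs', h7⟩
        · omega
        · have hse : s ≠ e := fun h => he (h ▸ spine_subset hs')
          have h8 : D.cell s.1.leftPoint = D.cell e.1.leftPoint :=
            (cell_bottom_of_upLeft h7).symm.trans h'
          have := (Incident.of_left rfl (Or.inl h8) hse).1
          have := (Incident.of_left h8 h5 hse.symm).1
          omega
      · have hte : t ≠ e := fun hte => he (hte ▸ ht)
        have := (Incident.of_left rfl (Or.inr (Or.inl htr)) hte).1
        have := (tipCol_le_of_right htr ht h6).1
        omega
    · exact absurd (depth_of_top h' he').1 h6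
  · obtain ⟨h8, h9⟩ := Incident.of_notMem (o := o) h' he'
    rw [rank_of_le he' (fun h => h6 (h8.1 h)) (by omega), rank_of_le he ha hl,
      Prod.Lex.toLex_lt_toLex]
    exact Or.inr ⟨rfl, show e'.1.left < e.1.left by omega⟩

/-- Among the crossings at the cell below a crossing of the comb, this crossing has the highest
rank. -/
lemma rank_lt_of_bottom {e e' : D.Crossing} (he : e ∈ D.combOrEmpty o)
    (h' : Incident e' (D.cell e.1.bottomLeftPoint)) (hne : e' ≠ e) : rank o e' < rank o e := by
  have h4 := e'.1.left_add_two_le_right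
  have hb := cases_of_bottom (x := e.1.left + 1) (y := e.1.level - 1) rfl he
  have hd := depth_of_bottom (o := o) (e := e) (x := e.1.left + 1) (y := e.1.level - 1) rfl
  by_cases he' : e' ∈ D.combOrEmpty o
  · rw [rank_of_mem he, rank_of_mem he', Prod.Lex.toLex_lt_toLex]
    simp only
    rcases h' with h' | h' | h' | h'
    · by_cases ha : Above o (e.1.left + 1) (e.1.level - 1)
      · obtain ⟨u, -, -, -, h8⟩ := depth_of_left h' he' ha
        have := hd ha
        omega
      · have h5 := mem_spine_of_left h' he' ha
        rcases hb with ⟨hs, -⟩ | ⟨t, ht, -, htr⟩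
        · have h6 := depth_spine h5
          have h7 := depth_spine hs
          have h8 : e'.1.level = e.1.level - 1 := row_eq_of_cell_eq h'
          unfold crossingDepth
          omega
        · have h6 := (tipCol_le_of_right htr ht ha).1
          have h7 := left_le_tipCol h5
          have h8 : D.cell e'.1.leftPoint = D.cell t.1.rightPoint := h'.trans htr.symm
          have h9 := (right_le_iff_of_cell_eq (s := t) h8 (row_eq_of_cell_eq h8).symm).2 le_rfl
          have := t.1.left_add_two_le_right
          omega
    · have h5 : e'.1.right ≤ e.1.left + 1 :=
        (right_le_iff_of_cell_eq (s := e') h' rfl).1 le_rfl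
      by_cases ha : Above o (e.1.left + 1) (e.1.level - 1)
      · have := depth_of_right h' he' ha
        have := hd ha
        omega
      · have := (tipCol_le_of_right h' he' ha).2
        omega
    · have hl : e'.1.level - 1 = e.1.level - 1 := row_eq_of_cell_eq h'
      exfalso
      rcases hb with ⟨hs, ha⟩ | ⟨t, ht, hte, htr⟩ <;>
        rcases cases_of_bottom h' he' with ⟨hs', ha'⟩ | ⟨t', ht', hte', htr'⟩
      · rcases spine_total hs hs' with h5 | h5 | h5
        · exact hne h5.symm
        all_goals omega
      · have h5 := (tipCol_le_of_right htr' ht' ha).1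
        have h6 := left_le_tipCol hs
        have h7 : t'.1.right ≤ e.1.left + 1 :=
          (right_le_iff_of_cell_eq (s := t') htr' rfl).1 le_rfl
        have := t'.1.left_add_two_le_right
        omega
      · have h5 := (tipCol_le_of_right htr ht ha').1
        have h6 := left_le_tipCol hs'
        have h8 : D.cell t.1.rightPoint = D.cell e'.1.bottomLeftPoint := htr.trans h'.symm
        have h7 : t.1.right ≤ e'.1.left + 1 :=
          (right_le_iff_of_cell_eq (s := t) h8 rfl).1 le_rfl
        have := t.1.left_add_two_le_right
        omega
      · have h5 : t = t' := by
          by_contra h5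
          have := (Incident.of_right htr (Or.inr (Or.inl htr')) (Ne.symm h5)).1
          have := (Incident.of_right htr' (Or.inr (Or.inl htr)) h5).1
          have := t.1.left_add_two_le_right
          have := t'.1.left_add_two_le_right
          omega
        subst h5
        exact hne (hte'.unique hte)
    · obtain ⟨ha, h8⟩ := depth_of_top h' he'
      have := hd ha
      omega
  · obtain ⟨h8, h9⟩ := Incident.of_notMem (o := o) h' he'
    by_cases ha : CrossingAbove o e'
    · rw [rank_of_above he' ha, rank_of_mem he, Prod.Lex.toLex_lt_toLex, h9 (h8.1 ha),
        hd (h8.1 ha)]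
      simp only
      omega
    · exact rank_lt_of_not_above he' ha he

end DyckTiling

/-! ### The edges selected by a comb -/

namespace DyckTiling

variable {n : ℕ} {D : DyckTiling n} {o : Option D.Crossing} {col : CellColor}

lemma mem_resolvedEdges_of_mem {C : Set D.Crossing} {e : D.Crossing} (he : e ∈ C) :
    e ∈ D.resolvedEdges col C ↔ e.1.horizontalColor ≠ col := by
  simp [resolvedEdges, he]

lemma mem_resolvedEdges_of_notMem {C : Set D.Crossing} {e : D.Crossing} (he : e ∉ C) :
    e ∈ D.resolvedEdges col C ↔ e.1.horizontalColor = col := by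
  simp [resolvedEdges, he]

lemma endCells_of_eq {e : D.Crossing} (h : e.1.horizontalColor = col) :
    D.endCells col e = (D.cell e.1.leftPoint, D.cell e.1.rightPoint) := if_pos h

lemma endCells_of_ne {e : D.Crossing} (h : e.1.horizontalColor ≠ col) :
    D.endCells col e = (D.cell e.1.bottomLeftPoint, D.cell e.1.topLeftPoint) := if_neg h

lemma incident_endCells (e : D.Crossing) : Incident e (D.endCells col e).1 ∧
    Incident e (D.endCells col e).2 := by
  by_cases h : e.1.horizontalColor = col
  · rw [endCells_of_eq h]
    exact ⟨Or.inl rfl, Or.inr (Or.inl rfl)⟩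
  · rw [endCells_of_ne h]
    exact ⟨Or.inr (Or.inr (Or.inl rfl)), Or.inr (Or.inr (Or.inr rfl))⟩

variable (o) in
/-- An edge that is selected by a comb is oriented upwards at a crossing of the comb, to the right
at a crossing below the comb on the left side, and to the left at the other crossings. -/
def Forward (e : D.Crossing) : Prop :=
  e ∈ D.combOrEmpty o ∨ (¬ CrossingAbove o e ∧ e.1.left ≤ D.tipCol o)

open Classical in
variable (o col) in
/-- The cell from which the edge goes out. -/
noncomputable def nearCell (e : D.Crossing) : Quot D.SameCell :=
  if Forward o e then (D.endCells col e).1 else (D.endCells col e).2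

open Classical in
variable (o col) in
/-- The cell into which the edge goes. -/
noncomputable def farCell (e : D.Crossing) : Quot D.SameCell :=
  if Forward o e then (D.endCells col e).2 else (D.endCells col e).1

lemma farCell_of_forward {e : D.Crossing} (h : e.1.horizontalColor = col) (h' : Forward o e) :
    farCell o col e = D.cell e.1.rightPoint := by
  rw [farCell, if_pos h', endCells_of_eq h]

lemma farCell_of_not_forward {e : D.Crossing} (h : e.1.horizontalColor = col)
    (h' : ¬ Forward o e) : farCell o col e = D.cell e.1.leftPoint := by
  rw [farCell, if_neg h', endCells_of_eq h]

lemma farCell_of_mem {e : D.Crossing} (h : e.1.horizontalColor ≠ col)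
    (h' : e ∈ D.combOrEmpty o) : farCell o col e = D.cell e.1.topLeftPoint := by
  rw [farCell, if_pos (show Forward o e from Or.inl h'), endCells_of_ne h]

lemma nearCell_of_forward {e : D.Crossing} (h : e.1.horizontalColor = col) (h' : Forward o e) :
    nearCell o col e = D.cell e.1.leftPoint := by
  rw [nearCell, if_pos h', endCells_of_eq h]

lemma nearCell_of_not_forward {e : D.Crossing} (h : e.1.horizontalColor = col)
    (h' : ¬ Forward o e) : nearCell o col e = D.cell e.1.rightPoint := by
  rw [nearCell, if_neg h', endCells_of_eq h]

lemma nearCell_of_mem {e : D.Crossing} (h : e.1.horizontalColor ≠ col)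
    (h' : e ∈ D.combOrEmpty o) : nearCell o col e = D.cell e.1.bottomLeftPoint := by
  rw [nearCell, if_pos (show Forward o e from Or.inl h'), endCells_of_ne h]

/-- Crossings at consecutive levels have different horizontal colors. -/
lemma horizontalColor_ne_of_succ {e f : D.Crossing} (h : e.1.horizontalColor = col)
    (hl : f.1.level = e.1.level + 1 ∨ f.1.level = e.1.level - 1) : f.1.horizontalColor ≠ col := by
  rw [horizontalColor_eq_iff] at h
  rw [Ne, horizontalColor_eq_iff]
  omega

lemma left_cell_ne_right_cell (e : D.Crossing) :
    D.cell e.1.leftPoint ≠ D.cell e.1.rightPoint := by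
  intro h
  have := (le_left_iff_of_cell_eq (s := e) h rfl).1 le_rfl
  have := e.1.left_add_two_le_right
  omega

lemma bottom_cell_ne_top_cell (e : D.Crossing) :
    D.cell e.1.bottomLeftPoint ≠ D.cell e.1.topLeftPoint := by
  intro h
  have : e.1.level - 1 = e.1.level + 1 := row_eq_of_cell_eq h
  omega

lemma nearCell_ne_farCell (e : D.Crossing) : nearCell o col e ≠ farCell o col e := by
  have h : (D.endCells col e).1 ≠ (D.endCells col e).2 := by
    by_cases h : e.1.horizontalColor = col
    · rw [endCells_of_eq h]
      exact left_cell_ne_right_cell e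
    · rw [endCells_of_ne h]
      exact bottom_cell_ne_top_cell e
  unfold nearCell farCell
  split_ifs
  exacts [h, h.symm]

lemma rank_lt_of_nearCell {e e' : D.Crossing}
    (he : e ∈ D.resolvedEdges col (D.combOrEmpty o)) (hne : e' ≠ e)
    (h : Incident e' (nearCell o col e)) : rank o e' < rank o e := by
  by_cases hC : e ∈ D.combOrEmpty o
  · rw [mem_resolvedEdges_of_mem hC] at he
    rw [nearCell_of_mem he hC] at h
    exact rank_lt_of_bottom hC h hne
  rw [mem_resolvedEdges_of_notMem hC] at he
  by_cases hf : Forward o e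
  · rw [nearCell_of_forward he hf] at h
    have hf' := hf.resolve_left hC
    exact rank_lt_of_left hC hf'.1 hf'.2 h hne
  · rw [nearCell_of_not_forward he hf] at h
    refine rank_lt_of_right hC ?_ h hne
    by_contra h'
    push Not at h'
    exact hf (Or.inr h')

/-! ### The edges around a cell -/

/-- The edge that goes in or out at the left end of a cell. -/
lemma cases_of_left_end {x : ℕ} {y : ℤ} {e : D.Crossing} (h : D.cell e.1.rightPoint = D.cell (x, y))
    (hcol : e.1.horizontalColor = col) : D.IsBoundaryCell (D.cell (x, y)) ∨
      (∃ f ∈ D.resolvedEdges col (D.combOrEmpty o), f ∉ D.combOrEmpty o ∧ Forward o f ∧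
        farCell o col f = D.cell (x, y)) ∨
      ∃ f ∈ D.resolvedEdges col (D.combOrEmpty o), nearCell o col f = D.cell (x, y) ∧
        (Above o x y ∨ D.tipCol o ≤ e.1.left) := by
  by_cases hC : e ∈ D.combOrEmpty o
  · rcases exists_upRight e with ⟨r, hr⟩ | h1
    · have h2 := upRight_iff.1 hr
      have h3 := comb_upRight hC hr
      have h4 := horizontalColor_ne_of_succ hcol (Or.inl h2.2)
      refine Or.inr (Or.inr ⟨r, (mem_resolvedEdges_of_mem h3).2 h4, ?_, ?_⟩)
      · rw [nearCell_of_mem h4 h3, cell_bottom_of_upRight hr, h]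
      · by_cases ha : Above o x y
        · exact Or.inl ha
        · exact Or.inr (tipCol_le_of_right h hC ha).1
    · refine Or.inl ⟨e.1.right, right_le e, ?_⟩
      rw [← h, h1]
      rfl
  · have he := (mem_resolvedEdges_of_notMem hC).2 hcol
    by_cases hf : Forward o e
    · exact Or.inr (Or.inl ⟨e, he, hC, hf, (farCell_of_forward hcol hf).trans h⟩)
    · refine Or.inr (Or.inr ⟨e, he, (nearCell_of_not_forward hcol hf).trans h, ?_⟩)
      by_contra h1
      push Not at h1
      have h2 : Incident e (D.cell (x, y)) := Or.inr (Or.inl h)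
      exact hf (Or.inr ⟨fun h3 => h1.1 ((h2.of_notMem hC).1.1 h3), h1.2.le⟩)

/-- The edge that goes in or out at the right end of a cell. -/
lemma cases_of_right_end {x : ℕ} {y : ℤ} {e : D.Crossing}
    (h : D.cell e.1.leftPoint = D.cell (x, y)) (hcol : e.1.horizontalColor = col) :
    D.IsBoundaryCell (D.cell (x, y)) ∨
      (∃ f ∈ D.resolvedEdges col (D.combOrEmpty o), (f ∈ D.combOrEmpty o ∨ ¬ Forward o f) ∧
        farCell o col f = D.cell (x, y)) ∨
      ∃ f ∈ D.resolvedEdges col (D.combOrEmpty o), nearCell o col f = D.cell (x, y) ∧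
        ¬ Above o x y ∧ e.1.left ≤ D.tipCol o := by
  by_cases hC : e ∈ D.combOrEmpty o
  · by_cases ha : Above o x y
    · obtain ⟨u, hu, hue, -⟩ := depth_of_left h hC ha
      have h2 := upRight_iff.1 hue
      have h4 := horizontalColor_ne_of_succ (f := u) hcol (Or.inr (by omega))
      refine Or.inr (Or.inl ⟨u, (mem_resolvedEdges_of_mem hu).2 h4, Or.inl hu, ?_⟩)
      rw [farCell_of_mem h4 hu, cell_top_of_upRight hue, h]
    · have hs := mem_spine_of_left h hC ha
      rcases spine_upLeft hs with ⟨t, ht, het⟩ | h1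
      · have h2 := upLeft_iff.1 het
        have h3 := spine_subset ht
        have h4 := horizontalColor_ne_of_succ (f := t) hcol (by omega)
        refine Or.inr (Or.inr ⟨t, (mem_resolvedEdges_of_mem h3).2 h4, ?_, ha,
          (left_le_tipCol hs).1⟩)
        rw [nearCell_of_mem h4 h3, cell_bottom_of_upLeft het, h]
      · refine Or.inl ⟨e.1.left, ?_, ?_⟩
        · have := right_le e
          have := e.1.left_add_two_le_right
          omega
        · rw [← h, h1]
          rfl
  · have he := (mem_resolvedEdges_of_notMem hC).2 hcol
    by_cases hf : Forward o e
    · have hf' := hf.resolve_left hC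
      have h2 : Incident e (D.cell (x, y)) := Or.inl h
      exact Or.inr (Or.inr ⟨e, he, (nearCell_of_forward hcol hf).trans h,
        fun h3 => hf'.1 ((h2.of_notMem hC).1.2 h3), hf'.2⟩)
    · exact Or.inr (Or.inl ⟨e, he, Or.inr hf, (farCell_of_not_forward hcol hf).trans h⟩)

lemma degree_cases {x : ℕ} {y : ℤ} (hv : D.Visible x y) (hy : y % 2 = col.parity) :
    D.IsBoundaryCell (D.cell (x, y)) ∨
      (∃ e ∈ D.resolvedEdges col (D.combOrEmpty o), ∃ f ∈ D.resolvedEdges col (D.combOrEmpty o),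
        nearCell o col e = D.cell (x, y) ∧ farCell o col f = D.cell (x, y)) ∨
      ∃ f ∈ D.resolvedEdges col (D.combOrEmpty o), ∃ f' ∈ D.resolvedEdges col (D.combOrEmpty o),
        f ≠ f' ∧ farCell o col f = D.cell (x, y) ∧ farCell o col f' = D.cell (x, y) := by
  rcases left_end hv with h | ⟨e, he⟩
  · exact Or.inl h
  rcases right_end hv with h | ⟨e', he'⟩
  · exact Or.inl h
  have h1 : e.1.level = y := row_eq_of_cell_eq he
  have h2 : e'.1.level = y := row_eq_of_cell_eq he'
  rcases cases_of_left_end (o := o) he ((horizontalColor_eq_iff e col).2 (by omega)) with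
    h | ⟨f, hf, h3, h4, h5⟩ | ⟨f, hf, h3, h4⟩
  · exact Or.inl h
  all_goals
    rcases cases_of_right_end (o := o) he' ((horizontalColor_eq_iff e' col).2 (by omega)) with
      h | ⟨f', hf', h6, h7⟩ | ⟨f', hf', h6, h7⟩
    · exact Or.inl h
  · refine Or.inr (Or.inr ⟨f, hf, f', hf', ?_, h5, h7⟩)
    rintro rfl
    tauto
  · exact Or.inr (Or.inl ⟨f', hf', f, hf, h6, h5⟩)
  · exact Or.inr (Or.inl ⟨f, hf, f', hf', h3, h7⟩)
  · have h8 := h4.resolve_left h7.1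
    have h9 : e.1.right ≤ e'.1.left :=
      (right_le_iff_of_cell_eq (s := e) (he'.trans he.symm) (h1.trans h2.symm)).2 le_rfl
    have := e.1.left_add_two_le_right
    omega

lemma exists_far_of_left {e : D.Crossing} (hC : e ∈ D.combOrEmpty o)
    (hcol : e.1.horizontalColor = col) : D.IsBoundaryCell (D.cell e.1.leftPoint) ∨
      ∃ f ∈ D.resolvedEdges col (D.combOrEmpty o), farCell o col f = D.cell e.1.leftPoint ∧
        rank o f < rank o e := by
  have he : D.cell e.1.leftPoint = D.cell (e.1.left, e.1.level) := rfl
  by_cases ha : Above o e.1.left e.1.level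
  · obtain ⟨u, hu, hue, hd, -⟩ := depth_of_left he hC ha
    have h2 := upRight_iff.1 hue
    have h4 := horizontalColor_ne_of_succ (f := u) hcol (Or.inr (by omega))
    refine Or.inr ⟨u, (mem_resolvedEdges_of_mem hu).2 h4, ?_, ?_⟩
    · rw [farCell_of_mem h4 hu, cell_top_of_upRight hue]
    · rw [rank_of_mem hu, rank_of_mem hC, hd, Prod.Lex.toLex_lt_toLex]
      have := u.1.left_add_two_le_right
      exact Or.inr ⟨rfl, show u.1.left < e.1.left by omega⟩
  · have hs := mem_spine_of_left he hC ha
    have h1 := left_le_tipCol hs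
    rcases left_end (visible_left e) with h | ⟨e', he'⟩
    · exact Or.inl h
    have h2 : e'.1.right ≤ e.1.left :=
      (right_le_iff_of_cell_eq (s := e') he' rfl).1 le_rfl
    have h3 := e'.1.left_add_two_le_right
    have h4 : e'.1.level = e.1.level := row_eq_of_cell_eq he'
    by_cases hC' : e' ∈ D.combOrEmpty o
    · have := (tipCol_le_of_right he' hC' ha).1
      omega
    · have hcol' : e'.1.horizontalColor = col := by
        rw [horizontalColor_eq_iff] at *
        omega
      have h5 : Incident e' (D.cell (e.1.left, e.1.level)) := Or.inr (Or.inl he')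
      have h6 : ¬ CrossingAbove o e' := fun h => ha ((h5.of_notMem hC').1.1 h)
      exact Or.inr ⟨e', (mem_resolvedEdges_of_notMem hC').2 hcol',
        (farCell_of_forward hcol' (Or.inr ⟨h6, by omega⟩)).trans he',
        rank_lt_of_not_above hC' h6 hC⟩

lemma exists_far_of_right {e : D.Crossing} (hC : e ∈ D.combOrEmpty o)
    (hcol : e.1.horizontalColor = col) : D.IsBoundaryCell (D.cell e.1.rightPoint) ∨
      ∃ f ∈ D.resolvedEdges col (D.combOrEmpty o), farCell o col f = D.cell e.1.rightPoint ∧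
        rank o f < rank o e := by
  have he : D.cell e.1.rightPoint = D.cell (e.1.right, e.1.level) := rfl
  rcases right_end (visible_right e) with h | ⟨e', he'⟩
  · exact Or.inl h
  have h2 : e.1.right ≤ e'.1.left :=
    (right_le_iff_of_cell_eq (s := e) he' (row_eq_of_cell_eq he').symm).2 le_rfl
  have h3 := e.1.left_add_two_le_right
  have h4 : e'.1.level = e.1.level := row_eq_of_cell_eq he'
  have hcol' : e'.1.horizontalColor = col := by
    rw [horizontalColor_eq_iff] at *
    omega
  by_cases hC' : e' ∈ D.combOrEmpty o
  · by_cases ha : Above o e.1.right e.1.level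
    · obtain ⟨u, hu, hue, hd, hd'⟩ := depth_of_left he' hC' ha
      have h5 := upRight_iff.1 hue
      have h6 := horizontalColor_ne_of_succ (f := u) hcol' (Or.inr (by omega))
      refine Or.inr ⟨u, (mem_resolvedEdges_of_mem hu).2 h6, ?_, ?_⟩
      · rw [farCell_of_mem h6 hu, cell_top_of_upRight hue, he', he]
      · rw [rank_of_mem hu, rank_of_mem hC, Prod.Lex.toLex_lt_toLex, depth_of_right he hC ha]
        simp only
        omega
    · have := (tipCol_le_of_right he hC ha).1
      have := left_le_tipCol (mem_spine_of_left he' hC' ha)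
      omega
  · have h5 : Incident e' (D.cell (e.1.right, e.1.level)) := Or.inl he'
    obtain ⟨h6, h7⟩ := h5.of_notMem hC'
    have key : ¬ Forward o e' ∧ rank o e' < rank o e := by
      by_cases ha : Above o e.1.right e.1.level
      · refine ⟨fun hf => (hf.resolve_left hC').1 (h6.2 ha), ?_⟩
        rw [rank_of_above hC' (h6.2 ha), rank_of_mem hC, Prod.Lex.toLex_lt_toLex,
          depth_of_right he hC ha, h7 ha]
        exact Or.inl (Nat.lt_succ_self _)
      · have := (tipCol_le_of_right he hC ha).1
        refine ⟨fun hf => ?_, rank_lt_of_not_above hC' (fun h => ha (h6.1 h)) hC⟩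
        have := (hf.resolve_left hC').2
        omega
    exact Or.inr ⟨e', (mem_resolvedEdges_of_notMem hC').2 hcol',
      (farCell_of_not_forward hcol' key.1).trans (he'.trans he.symm), key.2⟩

/-- If the cell above or below a crossing outside the comb does not touch the boundary, then an edge
of smaller rank goes into it: along the run at its left end, if the crossing is below the comb on
the left side, and at its right end otherwise. -/
lemma exists_far_of_bottom_or_top {e : D.Crossing} (hC : e ∉ D.combOrEmpty o) {x : ℕ} {y : ℤ}
    (hv : D.Visible x y) (hy : y % 2 = col.parity)
    (h : D.cell e.1.bottomLeftPoint = D.cell (x, y) ∨ D.cell e.1.topLeftPoint = D.cell (x, y)) :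
    D.IsBoundaryCell (D.cell (x, y)) ∨
      ∃ f ∈ D.resolvedEdges col (D.combOrEmpty o), farCell o col f = D.cell (x, y) ∧
        rank o f < rank o e := by
  have hi : Incident e (D.cell (x, y)) := Or.inr (Or.inr h)
  obtain ⟨h1, h2⟩ := hi.of_notMem hC
  have h3 := e.1.left_add_two_le_right
  have hl : e.1.level ≠ y := by
    rcases h with h | h
    · have : e.1.level - 1 = y := row_eq_of_cell_eq h
      omega
    · have : e.1.level + 1 = y := row_eq_of_cell_eq h
      omega
  by_cases hleft : ¬ Above o x y ∧ e.1.left ≤ D.tipCol o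
  · obtain ⟨ha, hleft⟩ := hleft
    rcases left_end hv with hb | ⟨e', he'⟩
    · exact Or.inl hb
    have h4 : e'.1.level = y := row_eq_of_cell_eq he'
    have h5 := (Incident.of_right he' hi (by rintro rfl; exact hl h4)).1
    have h6 := e'.1.left_add_two_le_right
    by_cases hC' : e' ∈ D.combOrEmpty o
    · have := (tipCol_le_of_right he' hC' ha).1
      omega
    · have hcol' : e'.1.horizontalColor = col := by
        rw [horizontalColor_eq_iff]
        omega
      have h7 : Incident e' (D.cell (x, y)) := Or.inr (Or.inl he')
      have h8 : ¬ CrossingAbove o e' := fun h => ha ((h7.of_notMem hC').1.1 h)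
      refine Or.inr ⟨e', (mem_resolvedEdges_of_notMem hC').2 hcol',
        (farCell_of_forward hcol' (Or.inr ⟨h8, by omega⟩)).trans he', ?_⟩
      rw [rank_of_le hC' h8 (by omega), rank_of_le hC (fun h => ha (h1.1 h)) hleft,
        Prod.Lex.toLex_lt_toLex]
      exact Or.inr ⟨rfl, show e'.1.left < e.1.left by omega⟩
  rcases right_end hv with hb | ⟨e', he'⟩
  · exact Or.inl hb
  have h4 : e'.1.level = y := row_eq_of_cell_eq he'
  have h5 := right_le_of_bottom_or_top he' h
  have h6 := e'.1.left_add_two_le_right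
  have h7 := right_le e'
  have hcol' : e'.1.horizontalColor = col := by
    rw [horizontalColor_eq_iff]
    omega
  by_cases hC' : e' ∈ D.combOrEmpty o
  · by_cases ha : Above o x y
    · obtain ⟨u, hu, hue, hd, hd'⟩ := depth_of_left he' hC' ha
      have h8 := upRight_iff.1 hue
      have h9 := horizontalColor_ne_of_succ (f := u) hcol' (Or.inr (by omega))
      refine Or.inr ⟨u, (mem_resolvedEdges_of_mem hu).2 h9, ?_, ?_⟩
      · rw [farCell_of_mem h9 hu, cell_top_of_upRight hue, he']
      · rw [rank_of_mem hu, rank_of_above hC (h1.2 ha), Prod.Lex.toLex_lt_toLex, h2 ha]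
        simp only
        omega
    · have := left_le_tipCol (mem_spine_of_left he' hC' ha)
      have : ¬ e.1.left ≤ D.tipCol o := fun h => hleft ⟨ha, h⟩
      omega
  · have h8 : Incident e' (D.cell (x, y)) := Or.inl he'
    obtain ⟨h9, h10⟩ := h8.of_notMem hC'
    have key : ¬ Forward o e' ∧ rank o e' < rank o e := by
      by_cases ha : Above o x y
      · refine ⟨fun hf => (hf.resolve_left hC').1 (h9.2 ha), ?_⟩
        rw [rank_of_above hC' (h9.2 ha), rank_of_above hC (h1.2 ha), Prod.Lex.toLex_lt_toLex,
          h2 ha, h10 ha]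
        exact Or.inr ⟨rfl, show 2 * n - e'.1.right < 2 * n - e.1.right by omega⟩
      · have h11 : ¬ e.1.left ≤ D.tipCol o := fun h => hleft ⟨ha, h⟩
        refine ⟨fun hf => ?_, ?_⟩
        · have := (hf.resolve_left hC').2
          omega
        · rw [rank_of_gt hC' (fun h => ha (h9.1 h)) (by omega),
            rank_of_gt hC (fun h => ha (h1.1 h)) (by omega), Prod.Lex.toLex_lt_toLex]
          exact Or.inr ⟨rfl, show 2 * n - e'.1.right < 2 * n - e.1.right by omega⟩
    exact Or.inr ⟨e', (mem_resolvedEdges_of_notMem hC').2 hcol',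
      (farCell_of_not_forward hcol' key.1).trans he', key.2⟩

lemma exists_far {e : D.Crossing} (he : e ∉ D.resolvedEdges col (D.combOrEmpty o))
    {v : Quot D.SameCell} (hv : v = (D.endCells col e).1 ∨ v = (D.endCells col e).2) :
    D.IsBoundaryCell v ∨
      ∃ f ∈ D.resolvedEdges col (D.combOrEmpty o), farCell o col f = v ∧
        rank o f < rank o e := by
  by_cases hC : e ∈ D.combOrEmpty o
  · rw [mem_resolvedEdges_of_mem hC, not_not] at he
    rw [endCells_of_eq he] at hv
    rcases hv with rfl | rfl
    · exact exists_far_of_left hC he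
    · exact exists_far_of_right hC he
  · rw [mem_resolvedEdges_of_notMem hC] at he
    rw [endCells_of_ne he] at hv
    have hp : (e.1.level + 1) % 2 = col.parity :=
      (parity_cases col _).resolve_left ((horizontalColor_eq_iff e col).not.1 he)
    rcases hv with rfl | rfl
    · exact exists_far_of_bottom_or_top hC
        (visible_bottom e e.1.col_left e.1.center_left) (by omega) (Or.inl rfl)
    · exact exists_far_of_bottom_or_top hC
        (visible_top e e.1.col_left e.1.center_left) hp (Or.inr rfl)

/-! ### Labels at a crossing -/

lemma label_right_of_mem {e : D.Crossing} (he : e ∈ D.combOrEmpty o) :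
    label o e.1.right e.1.level = (0, e.1.level - 2 * crossingDepth o e) := by
  have h1 := e.1.left_add_two_le_right
  have h2 := tipLevel_le he
  by_cases ha : Above o e.1.right e.1.level
  · rw [label_of_above ha, depth_of_right rfl he ha]
  · obtain ⟨h3, h4⟩ := tipCol_le_of_right rfl he ha
    rw [label_of_gt ha (by omega) (by omega), h4]
    simp

lemma label_left_of_mem {e : D.Crossing} (he : e ∈ D.combOrEmpty o) :
    label o e.1.left e.1.level = (0, e.1.level - 2 * crossingDepth o e - 2) := by
  have h2 := tipLevel_le he
  by_cases ha : Above o e.1.left e.1.level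
  · obtain ⟨u, -, -, -, h3⟩ := depth_of_left rfl he ha
    rw [label_of_above ha, h3]
    congr 1
    push_cast
    ring
  · have hs := mem_spine_of_left rfl he ha
    rw [label_of_le ha (by omega) (left_le_tipCol hs).1, crossingDepth, depth_spine hs]
    congr 1
    ring

lemma label_top_of_mem {e : D.Crossing} (he : e ∈ D.combOrEmpty o) :
    label o (e.1.left + 1) (e.1.level + 1) = (0, e.1.level - 1 - 2 * crossingDepth o e) := by
  obtain ⟨ha, h1⟩ := depth_of_top (o := o) (e := e) rfl he
  rw [label_of_above ha, h1]
  congr 1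
  push_cast
  ring

lemma label_bottom_of_mem {e : D.Crossing} (he : e ∈ D.combOrEmpty o) :
    label o (e.1.left + 1) (e.1.level - 1) = (0, e.1.level - 1 - 2 * crossingDepth o e) := by
  have h2 := tipLevel_le he
  by_cases ha : Above o (e.1.left + 1) (e.1.level - 1)
  · rw [label_of_above ha, depth_of_bottom rfl ha]
  by_cases hx : e.1.left + 1 ≤ D.tipCol o
  · rw [label_of_le ha (by omega) hx]
    rcases cases_of_bottom rfl he with ⟨hs, -⟩ | ⟨t, ht, hte, htr⟩
    · rw [crossingDepth, depth_spine hs]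
      congr 1
      ring
    · have := (tipCol_le_of_right htr ht ha).1
      rw [upRight_iff] at hte
      have := t.1.left_add_two_le_right
      omega
  · have h3 : crossingDepth o e = 0 :=
      depth_eq_zero (fun h => ha ((above_bottom e e.1.col_left).2 h)) (by omega)
    rw [label_of_gt ha (by omega) (by omega), h3]
    simp

lemma label_left_eq_right {e : D.Crossing} (he : e ∉ D.combOrEmpty o) :
    label o e.1.left e.1.level = label o e.1.right e.1.level :=
  eq_of_combRow (fun _ _ => label_step) (combRow_crossing he)

lemma label_bottom_ne_top {e : D.Crossing} (he : e ∉ D.combOrEmpty o) :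
    label o (e.1.left + 1) (e.1.level - 1) ≠ label o (e.1.left + 1) (e.1.level + 1) := by
  have h1 := above_bottom (o := o) e e.1.col_left
  have h2 := above_succ (o := o) (level_ne he e.1.col_left)
  by_cases ha : Above o (e.1.left + 1) e.1.level
  · rw [label_of_above (h1.2 ha), label_of_above (h2.2 ha), depth_bottom e e.1.col_left,
      depth_succ (level_ne he e.1.col_left), Ne, Prod.mk.injEq]
    omega
  have ha1 := fun h => ha (h1.1 h)
  have ha2 := fun h => ha (h2.1 h)
  by_cases h3 : e.1.level - 1 < D.tipLevel o - 1
  · rw [label_of_lt ha1 h3, Ne, label]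
    split_ifs <;> simp only [Prod.mk.injEq] <;> omega
  · by_cases h4 : e.1.left + 1 ≤ D.tipCol o
    · rw [label_of_le ha1 (by omega) h4, label_of_le ha2 (by omega) h4, Ne, Prod.mk.injEq]
      omega
    · rw [label_of_gt ha1 (by omega) (by omega), label_of_gt ha2 (by omega) (by omega), Ne,
        Prod.mk.injEq]
      omega

variable (o) in
/-- The label of the points of a cell. -/
noncomputable def cellLabel (v : Quot D.SameCell) : ℤ × ℤ :=
  Quot.lift (fun p : ℕ × ℤ => label o p.1 p.2)
    (fun _ _ h => label_eq_of_cell_eq (Quot.sound h)) v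

lemma cellLabel_eq {e : D.Crossing} (he : e ∈ D.resolvedEdges col (D.combOrEmpty o)) :
    cellLabel o (D.endCells col e).1 = cellLabel o (D.endCells col e).2 := by
  by_cases hC : e ∈ D.combOrEmpty o
  · rw [mem_resolvedEdges_of_mem hC] at he
    rw [endCells_of_ne he]
    exact (label_bottom_of_mem hC).trans (label_top_of_mem hC).symm
  · rw [mem_resolvedEdges_of_notMem hC] at he
    rw [endCells_of_eq he]
    exact label_left_eq_right hC

lemma cellLabel_ne {e : D.Crossing} (he : e ∉ D.resolvedEdges col (D.combOrEmpty o)) :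
    cellLabel o (D.endCells col e).1 ≠ cellLabel o (D.endCells col e).2 := by
  by_cases hC : e ∈ D.combOrEmpty o
  · rw [mem_resolvedEdges_of_mem hC, not_not] at he
    rw [endCells_of_eq he]
    change label o e.1.left e.1.level ≠ label o e.1.right e.1.level
    rw [label_left_of_mem hC, label_right_of_mem hC, Ne, Prod.mk.injEq]
    omega
  · rw [mem_resolvedEdges_of_notMem hC] at he
    rw [endCells_of_ne he]
    exact label_bottom_ne_top hC

/-! ### Tripod variables are products of conductances -/

variable (o col) in
/-- The edges that are selected by a comb form a grove that is determined by its partition. -/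
noncomputable def certificate (hn : 0 < n) :
    (D.graph col).Certificate (D.resolvedEdges col (D.combOrEmpty o)) where
  near e := ⟨nearCell o col e, by
    unfold nearCell
    split_ifs
    exacts [Or.inr ⟨e, Or.inl rfl⟩, Or.inr ⟨e, Or.inr rfl⟩]⟩
  far e := ⟨farCell o col e, by
    unfold farCell
    split_ifs
    exacts [Or.inr ⟨e, Or.inr rfl⟩, Or.inr ⟨e, Or.inl rfl⟩]⟩
  rank := rank o
  label v := cellLabel o v.1
  ends_eq e _ := by
    by_cases hf : Forward o e
    · simp only [graph, nearCell, farCell, if_pos hf]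
    · simp only [graph, nearCell, farCell, if_neg hf]
      exact Sym2.eq_swap
  near_ne_far e _ h := nearCell_ne_farCell e (Subtype.ext_iff.1 h)
  rank_lt e he e' hne h := by
    refine rank_lt_of_nearCell he hne ?_
    rcases Sym2.mem_iff.1 h with h | h
    · have h1 : nearCell o col e = (D.endCells col e').1 := Subtype.ext_iff.1 h
      exact h1 ▸ (incident_endCells e').1
    · have h1 : nearCell o col e = (D.endCells col e').2 := Subtype.ext_iff.1 h
      exact h1 ▸ (incident_endCells e').2
  degree := by
    rintro ⟨v, hv⟩
    obtain ⟨x, y, hxy, rfl, hy⟩ := exists_visible hv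
    rcases degree_cases (o := o) hxy hy with
      h | ⟨e, he, f, hf, h1, h2⟩ | ⟨f, hf, f', hf', hne, h1, h2⟩
    · obtain ⟨i, hi⟩ := exists_node hn hv h
      exact Or.inl ⟨i, Subtype.ext hi⟩
    · exact Or.inr (Or.inl ⟨e, he, f, hf, Subtype.ext h1, Subtype.ext h2⟩)
    · exact Or.inr (Or.inr ⟨f, hf, f', hf', hne, Subtype.ext h1, Subtype.ext h2⟩)
  leaf := by
    rintro e he ⟨v, hv⟩ h
    have h1 : v = (D.endCells col e).1 ∨ v = (D.endCells col e).2 :=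
      (Sym2.mem_iff.1 h).imp Subtype.ext_iff.1 Subtype.ext_iff.1
    rcases exists_far he h1 with h2 | ⟨f, hf, h2, h3⟩
    · obtain ⟨i, hi⟩ := exists_node hn hv h2
      exact Or.inl ⟨i, Subtype.ext hi⟩
    · exact Or.inr ⟨f, hf, Subtype.ext h2, h3⟩
  label_eq e he := by
    have := cellLabel_eq he
    simp only [nearCell, farCell]
    split_ifs
    exacts [this, this.symm]
  label_ne := by
    rintro e he u v h
    have := cellLabel_ne he
    rcases Sym2.eq_iff.1 h with ⟨rfl, rfl⟩ | ⟨rfl, rfl⟩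
    exacts [this, this.symm]

open Classical in
/-- A tripod variable is the product of the conductances of the edges that are selected by the
comb. -/
theorem tripodVariable_eq_prod (hn : 0 < n) (c : D.Conductances) :
    D.tripodVariable col o c =
      ∏ e : D.Crossing with e ∈ D.resolvedEdges col (D.combOrEmpty o),
        D.edgeConductance c col e :=
  NodedGraph.Certificate.partitionSum_eq (certificate o col hn) _

end DyckTiling

/-! ### Combs and vertical conductances -/

namespace DyckTiling

variable {n : ℕ} {D : DyckTiling n} {o : Option D.Crossing} {col : CellColor}

lemma verticalConductance_pos (c : D.Conductances) (e : D.Crossing) :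
    0 < D.verticalConductance c e := by
  have := c.2 e
  unfold verticalConductance edgeConductance
  split_ifs
  · exact inv_pos.2 this
  · exact this

lemma edgeConductance_of_ne {c : D.Conductances} {e : D.Crossing}
    (h : e.1.horizontalColor ≠ col) : D.edgeConductance c col e = D.verticalConductance c e := by
  unfold verticalConductance
  split_ifs with h1 <;> cases col <;> cases h2 : e.1.horizontalColor <;> simp_all

lemma edgeConductance_of_eq {c : D.Conductances} {e : D.Crossing}
    (h : e.1.horizontalColor = col) :
    D.edgeConductance c col e = (D.verticalConductance c e)⁻¹ := by
  subst h
  unfold verticalConductance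
  split_ifs with h1 <;> cases h2 : e.1.horizontalColor <;> simp_all [edgeConductance]

/-- Compared with the exterior partition, each crossing of the comb contributes its vertical
conductance: a vertical edge is inserted, or a horizontal one is removed. -/
lemma tripodVariable_eq_mul (hn : 0 < n) (c : D.Conductances) :
    D.tripodVariable col o c =
      D.tripodVariable col none c * ∏ᶠ e ∈ D.combOrEmpty o, D.verticalConductance c e := by
  classical
  rw [tripodVariable_eq_prod hn, tripodVariable_eq_prod hn, finprod_mem_def,
    finprod_eq_prod_of_fintype, Finset.prod_filter, Finset.prod_filter, ← Finset.prod_mul_distrib]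
  refine Finset.prod_congr rfl fun e _ => ?_
  have hw := (verticalConductance_pos c e).ne'
  have h0 : e ∉ D.combOrEmpty none := Set.notMem_empty e
  rw [mem_resolvedEdges_of_notMem h0]
  by_cases hC : e ∈ D.combOrEmpty o
  · rw [mem_resolvedEdges_of_mem hC, Set.mulIndicator_of_mem hC]
    by_cases h : e.1.horizontalColor = col
    · rw [if_neg (not_not.2 h), if_pos h, edgeConductance_of_eq h, inv_mul_cancel₀ hw]
    · rw [if_pos h, if_neg h, edgeConductance_of_ne h, one_mul]
  · rw [mem_resolvedEdges_of_notMem hC, Set.mulIndicator_of_notMem hC, mul_one]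

lemma tripodVariable_none_pos (hn : 0 < n) (c : D.Conductances) :
    0 < D.tripodVariable col none c := by
  classical
  rw [tripodVariable_eq_prod hn]
  refine Finset.prod_pos fun e _ => ?_
  have := verticalConductance_pos c e
  by_cases h : e.1.horizontalColor = col
  · rw [edgeConductance_of_eq h]
    exact inv_pos.2 this
  · rwa [edgeConductance_of_ne h]

lemma firstUpLeft_eq_some_iff {e t : D.Crossing} : D.firstUpLeft e = some t ↔ D.UpLeft e t := by
  unfold firstUpLeft
  split_ifs with h
  · rw [Option.some_inj]
    exact ⟨fun h' => h' ▸ h.choose_spec, fun h' => h.choose_spec.unique h'⟩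
  · exact iff_of_false (by simp) fun h' => h ⟨t, h'⟩

lemma firstUpRight_eq_some_iff {e t : D.Crossing} :
    D.firstUpRight e = some t ↔ D.UpRight e t := by
  unfold firstUpRight
  split_ifs with h
  · rw [Option.some_inj]
    exact ⟨fun h' => h' ▸ h.choose_spec, fun h' => h.choose_spec.unique h'⟩
  · exact iff_of_false (by simp) fun h' => h ⟨t, h'⟩

variable (D) in
/-- The tooth that starts at a crossing, if there is one. -/
def toothOrEmpty : Option D.Crossing → Set D.Crossing
  | some e => {t | D.Tooth e t}
  | none => ∅

lemma mem_combOrEmpty_iff {t : D.Crossing} :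
    t ∈ D.combOrEmpty o ↔ ∃ e ∈ o, t ∈ D.comb e := by
  cases o <;> simp [combOrEmpty]

lemma mem_toothOrEmpty_iff {t : D.Crossing} :
    t ∈ D.toothOrEmpty o ↔ ∃ e ∈ o, D.Tooth e t := by
  cases o <;> simp [toothOrEmpty]

lemma comb_eq_union (e : D.Crossing) :
    D.comb e = {t | D.Tooth e t} ∪ D.combOrEmpty (D.firstUpLeft e) := by
  ext t
  simp only [Set.mem_union, mem_combOrEmpty_iff, Option.mem_def, firstUpLeft_eq_some_iff]
  constructor
  · rintro ⟨s, h, h'⟩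
    rcases h.cases_head with rfl | ⟨a, ha, h1⟩
    · exact Or.inl h'
    · exact Or.inr ⟨a, ha, s, h1, h'⟩
  · rintro (h | ⟨a, ha, s, h1, h'⟩)
    · exact ⟨e, Relation.ReflTransGen.refl, h⟩
    · exact ⟨s, Relation.ReflTransGen.head ha h1, h'⟩

lemma disjoint_tooth_comb (e : D.Crossing) :
    Disjoint {t | D.Tooth e t} (D.combOrEmpty (D.firstUpLeft e)) := by
  rw [Set.disjoint_left]
  intro t h h'
  rw [mem_combOrEmpty_iff] at h'
  obtain ⟨a, ha, s, h1, h2⟩ := h'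
  rw [Option.mem_def, firstUpLeft_eq_some_iff] at ha
  have h3 := tooth_disjoint (o := some e) Relation.ReflTransGen.refl
    (Relation.ReflTransGen.head ha h1) h h2
  subst h3
  have h4 := upLeft_iff.1 ha
  have h5 := a.1.left_add_two_le_right
  rcases upLeft_chain h1 with h6 | h6
  · have : e.1.level = a.1.level := by rw [h6]
    omega
  · omega

lemma tooth_eq_insert (e : D.Crossing) :
    {t | D.Tooth e t} = insert e (D.toothOrEmpty (D.firstUpRight e)) := by
  ext t
  simp only [Set.mem_insert_iff, mem_toothOrEmpty_iff, Option.mem_def, firstUpRight_eq_some_iff]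
  constructor
  · intro h
    rcases Relation.ReflTransGen.cases_head h with rfl | ⟨b, hb, h1⟩
    · exact Or.inl rfl
    · exact Or.inr ⟨b, hb, h1⟩
  · rintro (rfl | ⟨b, hb, h1⟩)
    · exact Relation.ReflTransGen.refl
    · exact Relation.ReflTransGen.head hb h1

lemma notMem_toothOrEmpty (e : D.Crossing) : e ∉ D.toothOrEmpty (D.firstUpRight e) := by
  rw [mem_toothOrEmpty_iff]
  rintro ⟨b, hb, h⟩
  rw [Option.mem_def, firstUpRight_eq_some_iff, upRight_iff] at hb
  have := h.le
  omega

lemma finprod_comb (w : D.Crossing → ℝ) (o : Option D.Crossing) :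
    ∏ᶠ t ∈ D.combOrEmpty o, w t =
      (∏ᶠ t ∈ D.toothOrEmpty o, w t) * ∏ᶠ t ∈ D.combOrEmpty (o.bind D.firstUpLeft), w t := by
  cases o with
  | none => simp [combOrEmpty, toothOrEmpty]
  | some e =>
    change ∏ᶠ t ∈ D.comb e, w t = _
    rw [comb_eq_union, finprod_mem_union (disjoint_tooth_comb e) (Set.toFinite _)
      (Set.toFinite _)]
    rfl

lemma finprod_tooth (w : D.Crossing → ℝ) (e : D.Crossing) :
    ∏ᶠ t ∈ D.toothOrEmpty (some e), w t =
      w e * ∏ᶠ t ∈ D.toothOrEmpty (D.firstUpRight e), w t := by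
  change ∏ᶠ t ∈ {t | D.Tooth e t}, w t = _
  rw [tooth_eq_insert, finprod_mem_insert _ (notMem_toothOrEmpty e) (Set.toFinite _)]

/-- The comb at `e` consists of `e`, of the comb at the next crossing up and left, and of the first
tooth of the comb at the next crossing up and right. -/
lemma finprod_comb_mul (w : D.Crossing → ℝ) (e : D.Crossing) :
    (∏ᶠ t ∈ D.combOrEmpty (some e), w t) *
        ∏ᶠ t ∈ D.combOrEmpty ((D.firstUpRight e).bind D.firstUpLeft), w t =
      w e * ((∏ᶠ t ∈ D.combOrEmpty (D.firstUpLeft e), w t) *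
        ∏ᶠ t ∈ D.combOrEmpty (D.firstUpRight e), w t) := by
  rw [finprod_comb w (some e), finprod_comb w (D.firstUpRight e), finprod_tooth,
    Option.bind_some]
  ring

theorem verticalConductance_eq (hn : 0 < n) (c : D.Conductances) (e : D.Crossing) :
    D.verticalConductance c e =
      D.tripodVariable col (some e) c *
          D.tripodVariable col ((D.firstUpRight e).bind D.firstUpLeft) c /
        (D.tripodVariable col (D.firstUpLeft e) c *
          D.tripodVariable col (D.firstUpRight e) c) := by
  have hpos : ∀ o, 0 < D.tripodVariable col o c := by
    intro o
    rw [tripodVariable_eq_mul hn]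
    exact mul_pos (tripodVariable_none_pos hn c)
      (finprod_mem_induction _ one_pos (fun _ _ => mul_pos)
        fun e _ => verticalConductance_pos c e)
  rw [eq_div_iff (mul_pos (hpos _) (hpos _)).ne', tripodVariable_eq_mul hn c (o := some e),
    tripodVariable_eq_mul hn c (o := (D.firstUpRight e).bind D.firstUpLeft),
    tripodVariable_eq_mul hn c (o := D.firstUpLeft e),
    tripodVariable_eq_mul hn c (o := D.firstUpRight e)]
  linear_combination (-(D.tripodVariable col none c) ^ 2) *
    finprod_comb_mul (D.verticalConductance c) e

/-! ### Tripod variables are distinct -/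

lemma eq_or_level_lt_of_mem_comb {e t : D.Crossing} (h : t ∈ D.comb e) :
    t = e ∨ e.1.level < t.1.level := by
  obtain ⟨s, h1, h2⟩ := h
  rcases upLeft_chain h1 with rfl | h1 <;> rcases Tooth.eq_or_right_le h2 with rfl | h2
  · exact Or.inl rfl
  all_goals exact Or.inr (by omega)

lemma self_mem_comb (e : D.Crossing) : e ∈ D.comb e :=
  ⟨e, Relation.ReflTransGen.refl, Relation.ReflTransGen.refl⟩

lemma combOrEmpty_injective : Function.Injective D.combOrEmpty := by
  rintro (_ | e) (_ | e') h
  · rfl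
  · exact absurd ((Set.ext_iff.1 h e').2 (self_mem_comb e')) (Set.notMem_empty _)
  · exact absurd ((Set.ext_iff.1 h e).1 (self_mem_comb e)) (Set.notMem_empty _)
  · change D.comb e = D.comb e' at h
    rcases eq_or_level_lt_of_mem_comb (h ▸ self_mem_comb e) with h1 | h1
    · rw [h1]
    rcases eq_or_level_lt_of_mem_comb (h ▸ self_mem_comb e') with h2 | h2
    · rw [h2]
    · omega

lemma tripodVariable_injective (hn : 0 < n) (col : CellColor) :
    Function.Injective (D.tripodVariable col) := by
  classical
  intro o o' h
  refine combOrEmpty_injective (Set.ext fun e => ?_)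
  -- The comb is detected by changing a single conductance.
  let c : D.Conductances := ⟨Function.update 1 e 2, fun x => by
    by_cases hx : x = e
    · rw [hx, Function.update_self]; exact two_pos
    · rw [Function.update_of_ne hx]; exact one_pos⟩
  have hc : D.verticalConductance c e ≠ 1 := by
    unfold verticalConductance
    split_ifs <;> simp [edgeConductance, c]
  have hc' : ∀ x ≠ e, D.verticalConductance c x = 1 := by
    intro x hx
    unfold verticalConductance
    split_ifs <;> simp [edgeConductance, c, Function.update_of_ne hx]
  have key : ∀ o, ∏ᶠ x ∈ D.combOrEmpty o, D.verticalConductance c x =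
      if e ∈ D.combOrEmpty o then D.verticalConductance c e else 1 := by
    intro o
    rw [finprod_mem_def, finprod_eq_single _ e fun x hx => ?_]
    · rfl
    · rw [Set.mulIndicator_apply, hc' x hx, ite_self]
  have h1 := congrFun h c
  rw [tripodVariable_eq_mul hn c (o := o), tripodVariable_eq_mul hn c (o := o'),
    mul_right_inj' (tripodVariable_none_pos hn c).ne', key, key] at h1
  by_cases h2 : e ∈ D.combOrEmpty o <;> by_cases h3 : e ∈ D.combOrEmpty o' <;>
    simp_all [eq_comm]

lemma ncard_range_tripodVariable (hn : 0 < n) (col : CellColor) :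
    (Set.range (D.tripodVariable col)).ncard = Nat.card (D.graph col).Edge + 1 := by
  rw [← Set.image_univ, Set.ncard_image_of_injective _ (tripodVariable_injective hn col),
    Set.ncard_univ, Finite.card_option]
  rfl

end DyckTiling

theorem mainTheorem3 {n : ℕ} (hn : 0 < n) (D : DyckTiling n) :
    -- there is one more tripod variable than edges, for the network and for its dual
    (∀ col : CellColor,
      (Set.range (D.tripodVariable col)).ncard = Nat.card (D.graph col).Edge + 1) ∧
    -- each tripod variable is a product of conductances
    (∀ (col : CellColor) (o : Option D.Crossing), ∃ S : Finset D.Crossing,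
      ∀ c : D.Conductances, D.tripodVariable col o c = ∏ e ∈ S, D.edgeConductance c col e) ∧
    -- the vertical conductances are biratios of tripod variables, and of dual tripod variables
    (∀ (col : CellColor) (c : D.Conductances) (e : D.Crossing),
      D.verticalConductance c e =
        D.tripodVariable col (some e) c *
            D.tripodVariable col ((D.firstUpRight e).bind D.firstUpLeft) c /
          (D.tripodVariable col (D.firstUpLeft e) c *
            D.tripodVariable col (D.firstUpRight e) c)) := by
  classical
  exact ⟨DyckTiling.ncard_range_tripodVariable hn,
    fun _ _ => ⟨_, fun c => DyckTiling.tripodVariable_eq_prod hn c⟩,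
    fun _ c e => DyckTiling.verticalConductance_eq hn c e⟩
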